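/- Let $\kappa$ be a probability measure on $\mathbb{R}$ with $\kappa([0,c^*])=1$ for some $0<c^*<\infty$, and let $B>\tfrac14$. For $N\ge 1$ let $\mathcal{T}_N^2$ be the $N\times N$ discrete torus graph, i.e. the Cartesian product of two $N$-cycles (with $2N^2$ edges when $N\ge 3$). A path-flow is a finite nonnegative measure $\mu$ on the set of finite oriented paths in $\mathcal{T}_N^2$; its flow-volume is $f(e)=\int n(\sigma,e)\,\mu(d\sigma)$, where $n(\sigma,e)$ is the number of times the path $\sigma$ traverses the edge $e$ (in either direction). A standardized global flow is the (finite) flow-volume $\mathbf f$ of some path-flow $\mu$ under which, for every ordered pair $(v,w)$ of vertices (including $v=w$), the set of paths from $v$ to $w$ has measure $N^{-3}$. For an environment $\mathbf c=(c(e))_e$ put $$\mathrm{cost}_{(N)}(\mathbf c,B)=\inf\Big\{\sum_e c(e)f(e)^2 : \mathbf f \text{ a standardized global flow with } \max_e f(e)\le B\Big\}.$$ Let the $c(e)$ be i.i.d. with distribution $\kappa$, and write $\mathbb{E}$ for the corresponding expectation. Then for every $N\ge 3$ the infimum is over a nonempty set and $\mathrm{cost}_{(N)}(\mathbf c,B)$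 is integrable, and there is a constant $\gamma(\kappa,B)\in\mathbb{R}$, depending only on $\kappa$ and $B$, such that $$\lim_{N\to\infty} N^{-2}\,\mathbb{E}\,\mathrm{cost}_{(N)}(\mathbf c,B)=\gamma(\kappa,B).$$ -/

import Mathlib

open Set Filter Topology MeasureTheory
open scoped NNReal ENNReal

noncomputable section

namespace LatticeFlow

universe u

variable {V : Type u}

/-- The space of finite oriented paths `(v₀, v₁, …, v_k)` (with `k ≥ 0`) in a graph. A path is
recorded together with its pair (source, destination). -/
def FinitePath (G : SimpleGraph V) : Type u := Σ p : V × V, G.Walk p.1 p.2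

/-- The space of finite paths is countable when the graph is finite, and it is given the discrete
sigma-algebra. -/
instance (G : SimpleGraph V) : MeasurableSpace (FinitePath G) := ⊤

/-- The source (entrance) of a path. -/
def ent {G : SimpleGraph V} (σ : FinitePath G) : V := σ.1.1

/-- The destination (exit) of a path. -/
def exi {G : SimpleGraph V} (σ : FinitePath G) : V := σ.1.2

open Classical in
/-- `traversals σ e` is the number of times that the edge `e` occurs (in either direction)
in the path `σ`. -/
def traversals {G : SimpleGraph V} (σ : FinitePath G) (e : G.edgeSet) : ℕ :=
  σ.2.edges.count (e : Sym2 V)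

/-- The transportation measure of a path-flow `μ`: the push-forward of `μ` under
`σ ↦ (ent σ, exi σ)`. -/
def tra [MeasurableSpace V] {G : SimpleGraph V} (μ : Measure (FinitePath G)) : Measure (V × V) :=
  μ.map (fun σ => (ent σ, exi σ))

/-- The volume of flow across the edge `e` in the path-flow `μ` (a priori possibly infinite). -/
def flo {G : SimpleGraph V} (μ : Measure (FinitePath G)) (e : G.edgeSet) : ℝ≥0∞ :=
  ∫⁻ σ, (traversals σ e : ℝ≥0∞) ∂μ

/-- The cost `∑ₑ c(e) f(e)²` of the flow-volume `f` in the environment `c`. -/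
def cost {G : SimpleGraph V} [Fintype G.edgeSet] (f : G.edgeSet → ℝ≥0) (c : G.edgeSet → ℝ) : ℝ :=
  ∑ e, c e * (f e : ℝ) ^ 2

/-- The discrete `N × N` torus. -/
abbrev torus (N : ℕ) : SimpleGraph (Fin N × Fin N) :=
  (SimpleGraph.cycleGraph N).boxProd (SimpleGraph.cycleGraph N)

/-- The edge set of the discrete `N × N` torus (it has `2 N ^ 2` elements when `3 ≤ N`). -/
abbrev TorusEdge (N : ℕ) : Type := (torus N).edgeSet

instance (N : ℕ) : Fintype (TorusEdge N) := Fintype.ofFinite _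

/-- A standardized global flow: the flow-volume of some path-flow (finite measure on paths) which
sends volume `N⁻³` between every ordered pair of vertices of the torus. -/
def IsStandardizedGlobalFlow (N : ℕ) (f : TorusEdge N → ℝ≥0) : Prop :=
  ∃ μ : Measure (FinitePath (torus N)), IsFiniteMeasure μ ∧
    (∀ v w : Fin N × Fin N, tra μ {(v, w)} = ((N : ℝ≥0∞) ^ 3)⁻¹) ∧
    ∀ e, flo μ e = (f e : ℝ≥0∞)

/-- The standardized global flows on the `N × N` torus which carry at most `B` on each edge. -/
def feasibleFlows (N : ℕ) (B : ℝ) : Set (TorusEdge N → ℝ≥0) :=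
  {f | IsStandardizedGlobalFlow N f ∧ ∀ e, (f e : ℝ) ≤ B}

/-- The infimum cost, in the environment `c`, of a standardized global flow on the `N × N` torus
which carries at most `B` on each edge. -/
def costN (N : ℕ) (c : TorusEdge N → ℝ) (B : ℝ) : ℝ :=
  sInf ((fun f => cost f c) '' feasibleFlows N B)

/-- The law of the random environment: the cost-factors of the edges of the `N × N` torus are
independent with common distribution `κ`. -/
def environment (N : ℕ) (κ : Measure ℝ) : Measure (TorusEdge N → ℝ) :=
  Measure.pi (fun _ => κ)

end LatticeFlow

end

/-!
A standardized global flow on the torus amounts to a multiflow: for each ordered pair of vertices,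
an antisymmetric edge function whose divergence is `N⁻³` at the first vertex and `-N⁻³` at the
second. Cancelling opposite traversals only lowers the volume, and flow decomposition turns a
multiflow back into a path-flow.

The expected costs on a small `M`-torus and a large `N`-torus are compared by gluing. Group the
vertices into boundedly many cells and keep only the aggregated flows between cells; this costs
little volume, because mass is spread inside the cells by short paths. In each `M × M` window of the
large torus use a nearly optimal flow of the small torus for the environment seen in that window.
The flows of two windows between the same cells differ by a circulation, and averaging the stream
functions of these circulations over the windows containing a vertex glues them. The error of the
gluing is governed by the distances between stream functions, so only flows with nearby stream
functions may be used together. By compactness finitely many classes of such flows suffice,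
uniformly in `M`, and by the Efron–Stein inequality the optimal cost within each class has
fluctuations of order `M`. Since this is small compared with `M²`, one class may be fixed in advance
for all windows and environments.

The canonical flow along the two coordinate directions has volume at most `1/4`, so mixing in a
little of it restores the capacity `B` after the small errors above. Hence the normalised expected
costs satisfy `a N ≤ a M + ε` for large `M` and all `N` large in terms of `M`, and they converge.
-/

open Set Filter Topology MeasureTheory
open scoped NNReal ENNReal

noncomputable section

namespace LatticeFlow

section WalkFlows

variable {V : Type*} {G : SimpleGraph V}

instance : DiscreteMeasurableSpace (FinitePath G) := ⟨fun _ => trivial⟩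

/-- The ordered pairs of vertices traversed by a walk. -/
def arcs {u v : V} (p : G.Walk u v) : List (V × V) := p.darts.map (·.toProd)

lemma adj_of_mem_arcs {u v : V} {p : G.Walk u v} {a b : V} (h : (a, b) ∈ arcs p) : G.Adj a b := by
  obtain ⟨d, -, hd⟩ := List.mem_map.1 h
  simpa only [hd] using d.adj

variable [DecidableEq V]

/-- The net number of times that a walk steps from `a` to `b`. -/
def netFlow {u v : V} (p : G.Walk u v) (a b : V) : ℝ :=
  (arcs p).count (a, b) - (arcs p).count (b, a)

lemma netFlow_antisymm {u v : V} (p : G.Walk u v) (a b : V) :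
    netFlow p a b = -netFlow p b a := by
  simp only [netFlow, neg_sub]

lemma netFlow_cons {u v w : V} (h : G.Adj u v) (p : G.Walk v w) (a b : V) :
    netFlow (.cons h p) a b =
      (if u = a ∧ v = b then 1 else 0) - (if u = b ∧ v = a then 1 else 0) + netFlow p a b := by
  simp only [netFlow, arcs, SimpleGraph.Walk.darts_cons, List.map_cons, List.count_cons,
    beq_iff_eq, Prod.mk.injEq]
  push_cast
  ring

lemma sum_netFlow [Fintype V] {u v : V} (p : G.Walk u v) (a : V) :
    ∑ b, netFlow p a b = (if a = u then 1 else 0) - (if a = v then 1 else 0) := by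
  induction p with
  | nil => simp [netFlow, arcs]
  | cons h p ih =>
    simp only [netFlow_cons, Finset.sum_add_distrib, Finset.sum_sub_distrib, ih, ite_and,
      Finset.sum_ite_irrel, Finset.sum_ite_eq, Finset.mem_univ, if_true, Finset.sum_const_zero,
      eq_comm (b := a)]
    ring

lemma count_edges {u v : V} (p : G.Walk u v) {a b : V} (hab : a ≠ b) :
    p.edges.count s(a, b) = (arcs p).count (a, b) + (arcs p).count (b, a) := by
  induction p with
  | nil => simp [arcs]
  | cons h p ih =>
    simp only [arcs] at ih
    simp only [SimpleGraph.Walk.edges_cons, arcs, SimpleGraph.Walk.darts_cons, List.map_cons,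
      List.count_cons, ih, beq_iff_eq, Prod.mk.injEq, Sym2.eq_iff]
    grind

lemma abs_netFlow_le_count_edges {u v : V} (p : G.Walk u v) {a b : V} (hab : a ≠ b) :
    |netFlow p a b| ≤ p.edges.count s(a, b) := by
  rw [count_edges p hab, netFlow, Nat.cast_add]
  exact (abs_sub _ _).trans_eq (by simp only [Nat.abs_cast])

lemma netFlow_eq_zero_of_not_adj {u v : V} (p : G.Walk u v) {a b : V} (hab : ¬G.Adj a b) :
    netFlow p a b = 0 := by
  have hba : ¬G.Adj b a := fun h => hab h.symm
  rw [netFlow, List.count_eq_zero.2 (mt adj_of_mem_arcs hab),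
    List.count_eq_zero.2 (mt adj_of_mem_arcs hba), sub_self]

lemma traversals_mk (σ : FinitePath G) {a b : V} (h : G.Adj a b) :
    traversals σ ⟨s(a, b), h⟩ = σ.2.edges.count s(a, b) := by
  unfold traversals
  congr!

/-- A flow of value `m` from `v` to `w` in `G`; `g a b` is the net volume from `a` to `b`. -/
structure IsFlow [Fintype V] (G : SimpleGraph V) (g : V → V → ℝ) (v w : V) (m : ℝ) : Prop where
  antisymm : ∀ a b, g a b = -g b a
  eq_zero_of_not_adj : ∀ a b, ¬G.Adj a b → g a b = 0
  sum_eq : ∀ a, ∑ b, g a b = m * ((if a = v then 1 else 0) - (if a = w then 1 else 0))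

lemma isFlow_netFlow [Fintype V] {v w : V} (p : G.Walk v w) : IsFlow G (netFlow p) v w 1 where
  antisymm := netFlow_antisymm p
  eq_zero_of_not_adj _ _ h := netFlow_eq_zero_of_not_adj p h
  sum_eq a := by rw [sum_netFlow, one_mul]

lemma IsFlow.sub_smul [Fintype V] {g g' : V → V → ℝ} {v w : V} {m m' : ℝ}
    (hg : IsFlow G g v w m) (hg' : IsFlow G g' v w m') (δ : ℝ) :
    IsFlow G (fun a b => g a b - δ * g' a b) v w (m - δ * m') where
  antisymm a b := by rw [hg.antisymm a b, hg'.antisymm a b]; ring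
  eq_zero_of_not_adj a b h := by
    rw [hg.eq_zero_of_not_adj a b h, hg'.eq_zero_of_not_adj a b h, mul_zero, sub_zero]
  sum_eq a := by
    rw [Finset.sum_sub_distrib, ← Finset.mul_sum, hg.sum_eq, hg'.sum_eq]
    ring

end WalkFlows

section PathFlows

variable {V : Type*} {G : SimpleGraph V}

lemma tra_add [MeasurableSpace V] (μ ν : Measure (FinitePath G)) :
    tra (μ + ν) = tra μ + tra ν :=
  Measure.map_add _ _ .of_discrete

lemma tra_smul_dirac [MeasurableSpace V] (r : ℝ≥0∞) (σ : FinitePath G) :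
    tra (r • Measure.dirac σ) = r • Measure.dirac (ent σ, exi σ) := by
  rw [tra, Measure.map_smul, Measure.map_dirac' .of_discrete]

lemma tra_apply_univ [MeasurableSpace V] (μ : Measure (FinitePath G)) : tra μ univ = μ univ :=
  Measure.map_apply .of_discrete .univ

lemma flo_add (μ ν : Measure (FinitePath G)) (e : G.edgeSet) :
    flo (μ + ν) e = flo μ e + flo ν e :=
  lintegral_add_measure _ μ ν

lemma flo_smul_dirac (r : ℝ≥0∞) (σ : FinitePath G) (e : G.edgeSet) :
    flo (r • Measure.dirac σ) e = r * traversals σ e := by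
  rw [flo, lintegral_smul_measure, lintegral_dirac' _ .of_discrete, smul_eq_mul]

/-- The set of paths from `v` to `w`. -/
def pathsBetween (G : SimpleGraph V) (v w : V) : Set (FinitePath G) :=
  {σ | ent σ = v ∧ exi σ = w}

lemma tra_singleton [MeasurableSpace V] [MeasurableSingletonClass V] (μ : Measure (FinitePath G))
    (v w : V) : tra μ {(v, w)} = μ (pathsBetween G v w) := by
  rw [tra, Measure.map_apply .of_discrete (measurableSet_singleton _)]
  congr 1
  ext σ
  exact Prod.mk_inj

lemma sum_setIntegral_pathsBetween [Fintype V] {μ : Measure (FinitePath G)} {F : FinitePath G → ℝ}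
    (hF : Integrable F μ) : ∑ v, ∑ w, ∫ σ in pathsBetween G v w, F σ ∂μ = ∫ σ, F σ ∂μ := by
  rw [← Fintype.sum_prod_type' fun v w => ∫ σ in pathsBetween G v w, F σ ∂μ,
    ← integral_iUnion_fintype (fun _ => .of_discrete) ?_ fun _ => hF.integrableOn]
  · rw [show ⋃ q : V × V, pathsBetween G q.1 q.2 = univ by ext σ; simp [pathsBetween],
      setIntegral_univ]
  · rintro ⟨v, w⟩ ⟨v', w'⟩ hne
    refine Set.disjoint_left.2 ?_
    rintro σ ⟨rfl, rfl⟩ ⟨rfl, rfl⟩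
    exact hne rfl

lemma integrable_traversals {μ : Measure (FinitePath G)} {e : G.edgeSet}
    (he : flo μ e ≠ ⊤) : Integrable (fun σ => (traversals σ e : ℝ)) μ := by
  refine ⟨Measurable.of_discrete.aestronglyMeasurable, ?_⟩
  simpa [hasFiniteIntegral_iff_norm, flo, lt_top_iff_ne_top] using he

lemma integral_traversals (μ : Measure (FinitePath G)) (e : G.edgeSet) :
    ∫ σ, (traversals σ e : ℝ) ∂μ = (flo μ e).toReal := by
  rw [integral_eq_lintegral_of_nonneg_ae (ae_of_all _ fun _ => Nat.cast_nonneg _)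
    Measurable.of_discrete.aestronglyMeasurable]
  simp only [ENNReal.ofReal_natCast, flo]

variable [DecidableEq V]

lemma abs_netFlow_le_traversals (σ : FinitePath G) {a b : V} (h : G.Adj a b) :
    |netFlow σ.2 a b| ≤ traversals σ ⟨s(a, b), h⟩ := by
  rw [traversals_mk]
  exact abs_netFlow_le_count_edges _ h.ne

lemma integrable_netFlow {μ : Measure (FinitePath G)} (hμ : ∀ e, flo μ e ≠ ⊤) (a b : V) :
    Integrable (fun σ : FinitePath G => netFlow σ.2 a b) μ := by
  by_cases h : G.Adj a b
  · exact (integrable_traversals (hμ ⟨s(a, b), h⟩)).mono'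
      Measurable.of_discrete.aestronglyMeasurable
      (ae_of_all _ fun σ => abs_netFlow_le_traversals σ h)
  · simp [netFlow_eq_zero_of_not_adj _ h]

/-- The net flow of the paths from `v` to `w` in a path-flow. -/
def pairFlow (μ : Measure (FinitePath G)) (v w a b : V) : ℝ :=
  ∫ σ in pathsBetween G v w, netFlow σ.2 a b ∂μ

lemma isFlow_pairFlow [Fintype V] {μ : Measure (FinitePath G)} (hμ : ∀ e, flo μ e ≠ ⊤) (v w : V) :
    IsFlow G (pairFlow μ v w) v w (μ.real (pathsBetween G v w)) where
  antisymm a b := by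
    rw [pairFlow, pairFlow, ← integral_neg]
    exact integral_congr_ae (ae_of_all _ fun σ => netFlow_antisymm σ.2 a b)
  eq_zero_of_not_adj a b h := by
    simp only [pairFlow, netFlow_eq_zero_of_not_adj _ h, integral_zero]
  sum_eq a := by
    have hdiv : ∀ σ ∈ pathsBetween G v w, ∑ b, netFlow σ.2 a b
        = ((if a = v then 1 else 0) - (if a = w then 1 else 0) : ℝ) := by
      rintro σ ⟨rfl, rfl⟩
      exact sum_netFlow σ.2 a
    simp only [pairFlow]
    rw [← integral_finsetSum _ fun b _ => (integrable_netFlow hμ a b).integrableOn,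
      setIntegral_congr_fun .of_discrete hdiv, setIntegral_const, smul_eq_mul]

lemma sum_abs_pairFlow_le [Fintype V] {μ : Measure (FinitePath G)} (hμ : ∀ e, flo μ e ≠ ⊤)
    {a b : V} (h : G.Adj a b) :
    ∑ v, ∑ w, |pairFlow μ v w a b| ≤ (flo μ ⟨s(a, b), h⟩).toReal := by
  have htr := integrable_traversals (hμ ⟨s(a, b), h⟩)
  calc ∑ v, ∑ w, |pairFlow μ v w a b|
      ≤ ∑ v, ∑ w, ∫ σ in pathsBetween G v w, (traversals σ ⟨s(a, b), h⟩ : ℝ) ∂μ := by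
        gcongr with v _ w _
        exact abs_integral_le_integral_abs.trans <| integral_mono
          (integrable_netFlow hμ a b).abs.integrableOn htr.integrableOn
          fun σ => abs_netFlow_le_traversals σ h
    _ = (flo μ ⟨s(a, b), h⟩).toReal := by
        rw [sum_setIntegral_pathsBetween htr, integral_traversals]

end PathFlows

section FlowDecomposition

variable {V : Type*} [DecidableEq V] {G : SimpleGraph V} {g : V → V → ℝ} {v w : V} {m δ : ℝ}

section PositivePath

variable {p : G.Walk v w}

lemma netFlow_eq_count_edges (hg : ∀ a b, g a b = -g b a) (hp : ∀ q ∈ arcs p, 0 < g q.1 q.2)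
    {a b : V} (hne : a ≠ b) (hab : 0 ≤ g a b) : netFlow p a b = p.edges.count s(a, b) := by
  have hba : (b, a) ∉ arcs p := fun h => by linarith [hp (b, a) h, hg a b]
  rw [netFlow, count_edges p hne, List.count_eq_zero.2 hba, Nat.cast_zero, sub_zero, add_zero]

lemma netFlow_eq_one_of_mem_arcs (hg : ∀ a b, g a b = -g b a)
    (hp : ∀ q ∈ arcs p, 0 < g q.1 q.2) (hpath : p.IsPath) {a b : V} (hab : (a, b) ∈ arcs p) :
    netFlow p a b = 1 := by
  have hne : a ≠ b := (adj_of_mem_arcs hab).ne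
  rw [netFlow_eq_count_edges hg hp hne (hp (a, b) hab).le, List.count_eq_one_of_mem
    hpath.isTrail.edges_nodup, Nat.cast_one]
  rw [← List.count_pos_iff, count_edges p hne]
  exact Nat.add_pos_left (List.count_pos_iff.2 hab) _

lemma mul_netFlow_le (hg : ∀ a b, g a b = -g b a) (hp : ∀ q ∈ arcs p, 0 < g q.1 q.2)
    (hpath : p.IsPath) (hδ : ∀ q ∈ arcs p, δ ≤ g q.1 q.2) {a b : V}
    (hab : 0 ≤ g a b) : δ * netFlow p a b ≤ g a b := by
  by_cases hmem : (a, b) ∈ arcs p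
  · rw [netFlow_eq_one_of_mem_arcs hg hp hpath hmem, mul_one]
    exact hδ (a, b) hmem
  · have hba : (b, a) ∉ arcs p := fun h => by linarith [hp (b, a) h, hg a b]
    rwa [netFlow, List.count_eq_zero.2 hmem, List.count_eq_zero.2 hba, sub_self, mul_zero]

lemma abs_sub_mul_netFlow_add_le (hg : ∀ a b, g a b = -g b a)
    (hp : ∀ q ∈ arcs p, 0 < g q.1 q.2) (hpath : p.IsPath) (hδ : ∀ q ∈ arcs p, δ ≤ g q.1 q.2)
    {a b : V} (hne : a ≠ b) :
    |g a b - δ * netFlow p a b| + δ * p.edges.count s(a, b) ≤ |g a b| := by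
  wlog hab : 0 ≤ g a b generalizing a b
  · have := this hne.symm (by linarith [hg a b])
    rwa [Sym2.eq_swap, netFlow_antisymm, hg b a, mul_neg, neg_sub_neg, abs_sub_comm,
      abs_neg] at this
  rw [abs_of_nonneg (sub_nonneg.2 (mul_netFlow_le hg hp hpath hδ hab)),
    ← netFlow_eq_count_edges hg hp hne hab, abs_of_nonneg hab, sub_add_cancel]

/-- The ordered pairs of vertices between which `g` carries positive volume: the size of this set
is the induction parameter of the flow decomposition. -/
def positiveArcs [Fintype V] (g : V → V → ℝ) : Finset (V × V) := {q | 0 < g q.1 q.2}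

lemma positiveArcs_sub_ssubset [Fintype V] (hg : ∀ a b, g a b = -g b a)
    (hp : ∀ q ∈ arcs p, 0 < g q.1 q.2) (hpath : p.IsPath) (hδ : ∀ q ∈ arcs p, δ ≤ g q.1 q.2)
    {q : V × V} (hq : q ∈ arcs p) (hqδ : g q.1 q.2 = δ) :
    (positiveArcs fun a b => g a b - δ * netFlow p a b) ⊂ positiveArcs g := by
  refine (Finset.ssubset_iff_of_subset fun r hr => ?_).2 ⟨q, ?_, fun h => ?_⟩
  · simp only [positiveArcs, Finset.mem_filter_univ] at hr ⊢
    by_contra! hneg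
    have := mul_netFlow_le hg hp hpath hδ (a := r.2) (b := r.1) (by linarith [hg r.1 r.2])
    rw [netFlow_antisymm] at hr
    linarith [hg r.1 r.2]
  · exact (Finset.mem_filter_univ q).2 (hp q hq)
  · rw [positiveArcs, Finset.mem_filter_univ, netFlow_eq_one_of_mem_arcs hg hp hpath hq, hqδ,
      mul_one, sub_self] at h
    exact lt_irrefl 0 h

end PositivePath

variable [Fintype V]

lemma IsFlow.mem_of_forall_pos (hg : IsFlow G g v w m) (hm : 0 < m) {S : Finset V} (hv : v ∈ S)
    (hS : ∀ a ∈ S, ∀ b, 0 < g a b → b ∈ S) : w ∈ S := by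
  by_contra hw
  have total : ∑ a ∈ S, ∑ b, g a b = m := by
    simp [hg.sum_eq, ← Finset.mul_sum, Finset.sum_sub_distrib, hv, hw]
  have inner : ∑ a ∈ S, ∑ b ∈ S, g a b = 0 := by
    have : ∑ a ∈ S, ∑ b ∈ S, g a b = -∑ a ∈ S, ∑ b ∈ S, g a b := by
      conv_lhs => rw [Finset.sum_comm]
      simp only [← Finset.sum_neg_distrib, ← hg.antisymm]
    linarith
  have outer : ∑ a ∈ S, ∑ b ∈ Sᶜ, g a b ≤ 0 :=
    Finset.sum_nonpos fun a ha => Finset.sum_nonpos fun b hb =>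
      not_lt.1 fun h => Finset.mem_compl.1 hb (hS a ha b h)
  simp only [← Finset.sum_add_sum_compl S (g _), Finset.sum_add_distrib] at total
  linarith

lemma IsFlow.exists_isPath_pos (hg : IsFlow G g v w m) (hm : 0 < m) :
    ∃ p : G.Walk v w, p.IsPath ∧ ∀ q ∈ arcs p, 0 < g q.1 q.2 := by
  classical
  let S : Finset V := {x | ∃ p : G.Walk v x, ∀ q ∈ arcs p, 0 < g q.1 q.2}
  have hS : ∀ a ∈ S, ∀ b, 0 < g a b → b ∈ S := by
    simp only [S, Finset.mem_filter_univ]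
    rintro a ⟨p, hp⟩ b hab
    have hadj : G.Adj a b := by
      by_contra h
      exact hab.ne' (hg.eq_zero_of_not_adj a b h)
    refine ⟨p.concat hadj, fun q hq => ?_⟩
    rw [arcs, SimpleGraph.Walk.darts_concat, List.concat_eq_append, List.map_append,
      List.mem_append, List.map_singleton, List.mem_singleton] at hq
    rcases hq with hq | rfl
    exacts [hp q hq, hab]
  have hvS : v ∈ S := by
    rw [Finset.mem_filter_univ]
    exact ⟨.nil, by simp [arcs]⟩
  obtain ⟨p, hp⟩ := (Finset.mem_filter_univ _).1 (hg.mem_of_forall_pos hm hvS hS)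
  exact ⟨p.bypass, p.bypass_isPath,
    fun q hq => hp q (List.map_subset _ p.darts_bypass_subset_darts hq)⟩

-- The volume `δ` moved along a positive path is limited by the value of the flow and by the
-- weakest arc of the path; in the latter case that arc loses all of its volume.
lemma IsFlow.exists_reduction (hg : IsFlow G g v w m) (hm : 0 < m) (hvw : v ≠ w) :
    ∃ (p : G.Walk v w) (δ : ℝ), 0 ≤ δ ∧ δ ≤ m ∧
      (∀ a b, G.Adj a b →
        |g a b - δ * netFlow p a b| + δ * p.edges.count s(a, b) ≤ |g a b|) ∧
      (δ = m ∨ (positiveArcs fun a b => g a b - δ * netFlow p a b) ⊂ positiveArcs g) := by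
  obtain ⟨p, hpath, hp⟩ := hg.exists_isPath_pos hm
  have hne : (arcs p).toFinset.Nonempty := by
    cases p with
    | nil => exact absurd rfl hvw
    | cons h p => simp [arcs]
  obtain ⟨q, hq, hmin⟩ := Finset.exists_min_image _ (fun q : V × V => g q.1 q.2) hne
  simp only [List.mem_toFinset] at hq hmin
  refine ⟨p, min m (g q.1 q.2), le_min hm.le (hp q hq).le, min_le_left _ _, fun a b hab =>
    abs_sub_mul_netFlow_add_le hg.antisymm hp hpath
      (fun r hr => (min_le_right _ _).trans (hmin r hr)) hab.ne, ?_⟩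
  rcases min_choice m (g q.1 q.2) with h | h <;> rw [h]
  · exact .inl rfl
  · exact .inr (positiveArcs_sub_ssubset hg.antisymm hp hpath hmin hq rfl)

theorem IsFlow.exists_pathFlow [MeasurableSpace V] (hm : 0 ≤ m) (hg : IsFlow G g v w m) :
    ∃ μ : Measure (FinitePath G), tra μ = ENNReal.ofReal m • Measure.dirac (v, w) ∧
      ∀ a b (h : G.Adj a b), flo μ ⟨s(a, b), h⟩ ≤ ENNReal.ofReal |g a b| := by
  induction hn : positiveArcs g using Finset.strongInduction generalizing g m with
  | H S ih =>
  subst hn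
  rcases hm.eq_or_lt with rfl | hm
  · exact ⟨0, by simp [tra], by simp [flo]⟩
  rcases eq_or_ne v w with rfl | hvw
  · let σ : FinitePath G := ⟨(v, v), .nil⟩
    refine ⟨ENNReal.ofReal m • Measure.dirac σ, tra_smul_dirac _ σ, fun a b h => ?_⟩
    rw [flo_smul_dirac, traversals_mk]
    simp [σ]
  obtain ⟨p, δ, hδ, hδm, hle, hdec⟩ := hg.exists_reduction hm hvw
  obtain ⟨μ, htra, hflo⟩ : ∃ μ : Measure (FinitePath G),
      tra μ = ENNReal.ofReal (m - δ) • Measure.dirac (v, w) ∧ ∀ a b (h : G.Adj a b),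
        flo μ ⟨s(a, b), h⟩ ≤ ENNReal.ofReal |g a b - δ * netFlow p a b| := by
    rcases hdec with rfl | hdec
    · exact ⟨0, by simp [tra], by simp [flo]⟩
    · exact ih _ hdec (sub_nonneg.2 hδm) (by simpa using hg.sub_smul (isFlow_netFlow p) δ) rfl
  let σ : FinitePath G := ⟨(v, w), p⟩
  refine ⟨μ + ENNReal.ofReal δ • Measure.dirac σ, ?_, fun a b h => ?_⟩
  · rw [tra_add, tra_smul_dirac, htra, ent, exi, ← add_smul,
      ← ENNReal.ofReal_add (sub_nonneg.2 hδm) hδ, sub_add_cancel]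
  · rw [flo_add, flo_smul_dirac, traversals_mk]
    calc _ ≤ ENNReal.ofReal |g a b - δ * netFlow p a b| +
          ENNReal.ofReal (δ * p.edges.count s(a, b)) := by
          gcongr
          · exact hflo a b h
          · rw [ENNReal.ofReal_mul hδ, ENNReal.ofReal_natCast]
      _ ≤ ENNReal.ofReal |g a b| := by
          rw [← ENNReal.ofReal_add (abs_nonneg _) (by positivity)]
          exact ENNReal.ofReal_le_ofReal (hle a b h)

end FlowDecomposition

section TorusFlows

/-- The vertices of the `N × N` torus, in additive notation. -/
abbrev Vertex (N : ℕ) : Type := ZMod N × ZMod N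

/-- The oriented edges of the torus: `(false, p)` goes from `p` one step to the right and
`(true, p)` goes from `p` one step up. -/
abbrev Edge (N : ℕ) : Type := Bool × Vertex N

/-- The end of an oriented edge. -/
def target {N : ℕ} (e : Edge N) : Vertex N :=
  if e.1 then (e.2.1, e.2.2 + 1) else (e.2.1 + 1, e.2.2)

/-- The divergence of an edge function: what leaves a vertex minus what enters it. -/
def divergence {N : ℕ} (F : Edge N → ℝ) (p : Vertex N) : ℝ :=
  F (false, p) - F (false, (p.1 - 1, p.2)) + (F (true, p) - F (true, (p.1, p.2 - 1)))

/-- The identification of the two descriptions of the vertices of the torus. -/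
def vertexEquiv (N : ℕ) [NeZero N] : Vertex N ≃ Fin N × Fin N :=
  Equiv.prodCongr (ZMod.finEquiv N).symm.toEquiv (ZMod.finEquiv N).symm.toEquiv

lemma two_ne_zero_zmod {N : ℕ} (hN : 3 ≤ N) : (1 + 1 : ZMod N) ≠ 0 := by
  rw [one_add_one_eq_two, ← Nat.cast_ofNat, Ne, ZMod.natCast_eq_zero_iff]
  exact Nat.not_dvd_of_pos_of_lt two_pos hN

lemma one_ne_zero_zmod {N : ℕ} (hN : 3 ≤ N) : (1 : ZMod N) ≠ 0 := by
  rw [← Nat.cast_one, Ne, ZMod.natCast_eq_zero_iff]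
  exact Nat.not_dvd_of_pos_of_lt one_pos (by omega)

/-- A family of flows which send volume `N⁻³` between each ordered pair of vertices. -/
def IsMultiflow {N : ℕ} (G : Vertex N → Vertex N → Edge N → ℝ) : Prop :=
  ∀ v w p, divergence (G v w) p =
    ((N : ℝ) ^ 3)⁻¹ * ((if p = v then 1 else 0) - (if p = w then 1 else 0))

/-- The volume of a family of flows. -/
def totalVolume {N : ℕ} {ι κ : Type*} [Fintype ι] [Fintype κ] (G : ι → κ → Edge N → ℝ)
    (e : Edge N) : ℝ :=
  ∑ i, ∑ j, |G i j e|

lemma totalVolume_nonneg {N : ℕ} {ι κ : Type*} [Fintype ι] [Fintype κ] (G : ι → κ → Edge N → ℝ)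
    (e : Edge N) : 0 ≤ totalVolume G e :=
  Finset.sum_nonneg fun _ _ => Finset.sum_nonneg fun _ _ => abs_nonneg _

variable {N : ℕ} [NeZero N]

lemma cycleGraph_adj_iff (hN : 3 ≤ N) (a b : ZMod N) :
    (SimpleGraph.cycleGraph N).Adj ((ZMod.finEquiv N).symm a) ((ZMod.finEquiv N).symm b) ↔
      b = a + 1 ∨ a = b + 1 := by
  obtain ⟨n, rfl⟩ : ∃ n, N = n + 2 := ⟨N - 2, by omega⟩
  have h : (SimpleGraph.cycleGraph (n + 2)).Adj ((ZMod.finEquiv (n + 2)).symm a)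
      ((ZMod.finEquiv (n + 2)).symm b) ↔ a - b = 1 ∨ b - a = 1 :=
    SimpleGraph.cycleGraph_adj (n := n)
  rw [h, sub_eq_iff_eq_add', sub_eq_iff_eq_add', or_comm]

lemma torus_adj_iff (hN : 3 ≤ N) (p q : Vertex N) :
    (torus N).Adj (vertexEquiv N p) (vertexEquiv N q) ↔
      ((q.1 = p.1 + 1 ∨ p.1 = q.1 + 1) ∧ p.2 = q.2) ∨
      ((q.2 = p.2 + 1 ∨ p.2 = q.2 + 1) ∧ p.1 = q.1) := by
  rw [SimpleGraph.boxProd_adj]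
  simp only [vertexEquiv, Equiv.prodCongr_apply, Prod.map_fst, Prod.map_snd,
    RingEquiv.toEquiv_eq_coe, EquivLike.coe_coe, cycleGraph_adj_iff hN,
    EmbeddingLike.apply_eq_iff_eq]

lemma torus_adj_target (hN : 3 ≤ N) (e : Edge N) :
    (torus N).Adj (vertexEquiv N e.2) (vertexEquiv N (target e)) := by
  rw [torus_adj_iff hN]
  obtain ⟨d, p⟩ := e
  cases d <;> simp [target]

lemma ext_of_target_eq {N : ℕ} (hN : 3 ≤ N) {e e' : Edge N} (h1 : e.2 = e'.2)
    (h2 : target e = target e') : e = e' := by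
  have h := one_ne_zero_zmod hN
  obtain ⟨d, x, y⟩ := e
  obtain ⟨d', x', y'⟩ := e'
  cases d <;> cases d' <;> simp_all [target]

lemma target_ne_of_eq_target {N : ℕ} (hN : 3 ≤ N) {e e' : Edge N} (h1 : e.2 = target e') :
    target e ≠ e'.2 := by
  have h := one_ne_zero_zmod hN
  have h' := two_ne_zero_zmod hN
  obtain ⟨d, x, y⟩ := e
  obtain ⟨d', x', y'⟩ := e'
  cases d <;> cases d' <;> simp_all [target, add_assoc]

lemma exists_torusEdge_eq (hN : 3 ≤ N) {p q : Vertex N}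
    (h : (torus N).Adj (vertexEquiv N p) (vertexEquiv N q)) :
    ∃ e : Edge N, s(vertexEquiv N e.2, vertexEquiv N (target e)) =
      s(vertexEquiv N p, vertexEquiv N q) := by
  obtain ⟨p₁, p₂⟩ := p
  obtain ⟨q₁, q₂⟩ := q
  rw [torus_adj_iff hN] at h
  dsimp only at h
  rcases h with ⟨rfl | rfl, rfl⟩ | ⟨rfl | rfl, rfl⟩
  · exact ⟨(false, (p₁, p₂)), by simp [target]⟩
  · exact ⟨(false, (q₁, p₂)), by simp [target, Sym2.eq_swap]⟩
  · exact ⟨(true, (p₁, p₂)), by simp [target]⟩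
  · exact ⟨(true, (p₁, q₂)), by simp [target, Sym2.eq_swap]⟩

/-- Forgetting the orientation identifies the oriented edges with the edges of the torus graph
(for `N < 3` distinct oriented edges may have the same endpoints). -/
def edgeEquiv (hN : 3 ≤ N) : Edge N ≃ TorusEdge N :=
  Equiv.ofBijective
    (fun e => ⟨s(vertexEquiv N e.2, vertexEquiv N (target e)), torus_adj_target hN e⟩) <| by
    constructor
    · intro e e' h
      have h' : s(vertexEquiv N e.2, vertexEquiv N (target e)) =
          s(vertexEquiv N e'.2, vertexEquiv N (target e')) :=
        congrArg Subtype.val h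
      rw [Sym2.eq_iff] at h'
      simp only [EmbeddingLike.apply_eq_iff_eq] at h'
      rcases h' with h | h
      · exact ext_of_target_eq hN h.1 h.2
      · exact absurd h.2 (target_ne_of_eq_target hN h.1)
    · rintro ⟨e, he⟩
      induction e using Sym2.ind with
      | _ a b =>
        obtain ⟨p, rfl⟩ := (vertexEquiv N).surjective a
        obtain ⟨q, rfl⟩ := (vertexEquiv N).surjective b
        obtain ⟨e, h⟩ := exists_torusEdge_eq hN he
        exact ⟨e, Subtype.ext h⟩

lemma edgeEquiv_apply (hN : 3 ≤ N) (e : Edge N) :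
    edgeEquiv hN e = ⟨s(vertexEquiv N e.2, vertexEquiv N (target e)), torus_adj_target hN e⟩ := rfl

lemma sum_eq_sum_neighbors (hN : 3 ≤ N) (p : Vertex N) {k : Vertex N → ℝ}
    (hk : ∀ q, ¬ (torus N).Adj (vertexEquiv N p) (vertexEquiv N q) → k q = 0) :
    ∑ q, k q = k (p.1 + 1, p.2) + k (p.1 - 1, p.2) + (k (p.1, p.2 + 1) + k (p.1, p.2 - 1)) := by
  obtain ⟨x, y⟩ := p
  have h1 := one_ne_zero_zmod hN
  have h2 : (-1 : ZMod N) ≠ 1 := fun h => two_ne_zero_zmod hN (by linear_combination -h)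
  have hsub : ∑ q ∈ ({(x + 1, y), (x - 1, y), (x, y + 1), (x, y - 1)} : Finset (Vertex N)), k q =
      ∑ q, k q := by
    refine Finset.sum_subset (Finset.subset_univ _) ?_
    rintro ⟨a, b⟩ - hq
    refine hk _ fun hadj => hq ?_
    simp only [Finset.mem_insert, Finset.mem_singleton, Prod.mk.injEq, eq_sub_iff_add_eq]
    rcases (torus_adj_iff hN _ _).1 hadj with ⟨h | h, h'⟩ | ⟨h | h, h'⟩ <;> simp_all
  rw [← hsub, Finset.sum_insert, Finset.sum_insert, Finset.sum_insert, Finset.sum_singleton,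
    add_assoc]
  · simp [sub_eq_add_neg, h2.symm]
  · simp [h1]
  · simp [sub_eq_add_neg, h2.symm, h1]

lemma IsFlow.divergence_eq (hN : 3 ≤ N) {g : Fin N × Fin N → Fin N × Fin N → ℝ} {v w : Vertex N}
    {m : ℝ} (hg : IsFlow (torus N) g (vertexEquiv N v) (vertexEquiv N w) m) (p : Vertex N) :
    divergence (fun e => g (vertexEquiv N e.2) (vertexEquiv N (target e))) p =
      m * ((if p = v then 1 else 0) - (if p = w then 1 else 0)) := by
  have h := hg.sum_eq (vertexEquiv N p)
  simp only [EmbeddingLike.apply_eq_iff_eq] at h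
  rw [← h, ← (vertexEquiv N).sum_comp,
    sum_eq_sum_neighbors hN p fun q hq => hg.eq_zero_of_not_adj _ _ hq]
  simp only [divergence, target, if_true, Bool.false_eq_true, if_false, sub_add_cancel]
  rw [hg.antisymm (vertexEquiv N (p.1 - 1, p.2)), hg.antisymm (vertexEquiv N (p.1, p.2 - 1))]
  ring

theorem exists_multiflow (hN : 3 ≤ N) {f : TorusEdge N → ℝ≥0}
    (hf : IsStandardizedGlobalFlow N f) :
    ∃ G : Vertex N → Vertex N → Edge N → ℝ, IsMultiflow G ∧
      ∀ e, totalVolume G e ≤ f (edgeEquiv hN e) := by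
  obtain ⟨μ, _, htra, hflo⟩ := hf
  have hμ : ∀ e, flo μ e ≠ ⊤ := fun e => hflo e ▸ ENNReal.coe_ne_top
  have hmass : ∀ v w, μ.real (pathsBetween (torus N) v w) = ((N : ℝ) ^ 3)⁻¹ := fun v w => by
    rw [measureReal_def, ← tra_singleton, htra]
    simp
  refine ⟨fun v w e => pairFlow μ (vertexEquiv N v) (vertexEquiv N w) (vertexEquiv N e.2)
    (vertexEquiv N (target e)), fun v w p => ?_, fun e => ?_⟩
  · rw [(isFlow_pairFlow hμ (vertexEquiv N v) (vertexEquiv N w)).divergence_eq hN, hmass]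
  · calc totalVolume (fun v w e => pairFlow μ (vertexEquiv N v) (vertexEquiv N w)
          (vertexEquiv N e.2) (vertexEquiv N (target e))) e
        = ∑ v, ∑ w, |pairFlow μ v w (vertexEquiv N e.2) (vertexEquiv N (target e))| := by
          rw [← (vertexEquiv N).sum_comp]
          exact Finset.sum_congr rfl fun v _ =>
            (vertexEquiv N).sum_comp fun w =>
              |pairFlow μ (vertexEquiv N v) w (vertexEquiv N e.2) (vertexEquiv N (target e))|
      _ ≤ (flo μ ⟨_, torus_adj_target hN e⟩).toReal := sum_abs_pairFlow_le hμ _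
      _ = f (edgeEquiv hN e) := by rw [hflo, edgeEquiv_apply, ENNReal.coe_toReal]

lemma sum_ite_eq_target (F : Edge N → ℝ) (p : Vertex N) :
    ∑ e, F e * (if p = target e then 1 else 0) =
      F (false, (p.1 - 1, p.2)) + F (true, (p.1, p.2 - 1)) := by
  have hfalse : ∀ q : Vertex N, p = target (false, q) ↔ (p.1 - 1, p.2) = q := fun q => by
    simp [target, Prod.ext_iff, sub_eq_iff_eq_add]
  have htrue : ∀ q : Vertex N, p = target (true, q) ↔ (p.1, p.2 - 1) = q := fun q => by
    simp [target, Prod.ext_iff, sub_eq_iff_eq_add]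
  rw [Fintype.sum_prod_type, Fintype.sum_bool]
  simp only [hfalse, htrue, mul_ite, mul_one, mul_zero, Finset.sum_ite_eq, Finset.mem_univ,
    if_true]
  exact add_comm _ _

lemma sum_mul_ite_sub_ite_eq_divergence (F : Edge N → ℝ) (p : Vertex N) :
    ∑ e, F e * ((if p = e.2 then 1 else 0) - (if p = target e then 1 else 0)) = divergence F p := by
  simp only [mul_sub, Finset.sum_sub_distrib, sum_ite_eq_target]
  rw [Fintype.sum_prod_type, Fintype.sum_bool]
  simp only [mul_ite, mul_one, mul_zero, Finset.sum_ite_eq, Finset.mem_univ, if_true, divergence]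
  ring

/-- The antisymmetric function on ordered pairs of vertices which an edge function determines. -/
def arcFlow (F : Edge N → ℝ) (a b : Fin N × Fin N) : ℝ :=
  ∑ e, F e * ((if a = vertexEquiv N e.2 ∧ b = vertexEquiv N (target e) then 1 else 0) -
    (if a = vertexEquiv N (target e) ∧ b = vertexEquiv N e.2 then 1 else 0))

lemma sum_arcFlow (F : Edge N → ℝ) (p : Vertex N) :
    ∑ b, arcFlow F (vertexEquiv N p) b = divergence F p := by
  unfold arcFlow
  rw [Finset.sum_comm, ← sum_mul_ite_sub_ite_eq_divergence F p]
  refine Finset.sum_congr rfl fun e _ => ?_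
  rw [← Finset.mul_sum, Finset.sum_sub_distrib]
  simp [ite_and]

lemma isFlow_arcFlow (hN : 3 ≤ N) {F : Edge N → ℝ} {v w : Vertex N} {m : ℝ}
    (hF : ∀ p, divergence F p = m * ((if p = v then 1 else 0) - (if p = w then 1 else 0))) :
    IsFlow (torus N) (arcFlow F) (vertexEquiv N v) (vertexEquiv N w) m where
  antisymm a b := by
    rw [arcFlow, arcFlow, ← Finset.sum_neg_distrib]
    refine Finset.sum_congr rfl fun e _ => ?_
    simp only [← mul_neg, neg_sub, and_comm]
  eq_zero_of_not_adj a b h := by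
    refine Finset.sum_eq_zero fun e _ => ?_
    rw [if_neg, if_neg, sub_zero, mul_zero]
    · rintro ⟨rfl, rfl⟩
      exact h (torus_adj_target hN e).symm
    · rintro ⟨rfl, rfl⟩
      exact h (torus_adj_target hN e)
  sum_eq a := by
    obtain ⟨p, rfl⟩ := (vertexEquiv N).surjective a
    simp only [sum_arcFlow, hF, EmbeddingLike.apply_eq_iff_eq]

lemma arcFlow_target (hN : 3 ≤ N) (F : Edge N → ℝ) (e : Edge N) :
    arcFlow F (vertexEquiv N e.2) (vertexEquiv N (target e)) = F e := by
  unfold arcFlow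
  simp only [EmbeddingLike.apply_eq_iff_eq]
  rw [Finset.sum_eq_single e _ fun h => absurd (Finset.mem_univ e) h]
  · have h : ¬ (e.2 = target e ∧ target e = e.2) := fun h => target_ne_of_eq_target hN h.1 h.2
    simp [h]
  · intro e' _ hne
    have h₁ : ¬ (e.2 = e'.2 ∧ target e = target e') := fun h =>
      hne (ext_of_target_eq hN h.1 h.2).symm
    have h₂ : ¬ (e.2 = target e' ∧ target e = e'.2) := fun h => target_ne_of_eq_target hN h.1 h.2
    simp [h₁, h₂]

lemma exists_pathFlow_of_isMultiflow (hN : 3 ≤ N) {G : Vertex N → Vertex N → Edge N → ℝ}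
    (hG : IsMultiflow G) :
    ∃ μ : Measure (FinitePath (torus N)), IsFiniteMeasure μ ∧
      (∀ a b, tra μ {(a, b)} = ENNReal.ofReal ((N : ℝ) ^ 3)⁻¹) ∧
      ∀ e, flo μ (edgeEquiv hN e) ≤ ENNReal.ofReal (totalVolume G e) := by
  choose ν htra hflo using fun q : Vertex N × Vertex N =>
    (isFlow_arcFlow hN (hG q.1 q.2)).exists_pathFlow (by positivity)
  have hν : ∀ q, IsFiniteMeasure (ν q) := fun q => ⟨by rw [← tra_apply_univ, htra]; simp⟩
  refine ⟨Measure.sum ν, by rw [Measure.sum_fintype]; infer_instance, fun a b => ?_, fun e => ?_⟩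
  · have h : tra (Measure.sum ν) {(a, b)} = ∑ q, tra (ν q) {(a, b)} := by
      simp only [tra_singleton, Measure.sum_apply _ (.of_discrete), tsum_fintype]
    rw [h, Finset.sum_eq_single ((vertexEquiv N).symm a, (vertexEquiv N).symm b)]
    · simp [htra]
    · rintro ⟨v, w⟩ - hne
      have hab : (vertexEquiv N v, vertexEquiv N w) ∉ ({(a, b)} : Set _) := fun hab => hne <| by
        obtain ⟨rfl, rfl⟩ := Prod.mk.inj hab
        simp
      simp [htra, hab]
    · simp
  · rw [flo, lintegral_sum_measure, tsum_fintype, Fintype.sum_prod_type, totalVolume,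
      ENNReal.ofReal_sum_of_nonneg fun _ _ => Finset.sum_nonneg fun _ _ => abs_nonneg _]
    refine Finset.sum_le_sum fun v _ => ?_
    rw [ENNReal.ofReal_sum_of_nonneg fun _ _ => abs_nonneg _]
    refine Finset.sum_le_sum fun w _ => ?_
    exact (hflo (v, w) _ _ (torus_adj_target hN e)).trans_eq (by rw [arcFlow_target hN])

theorem exists_standardizedGlobalFlow (hN : 3 ≤ N) {G : Vertex N → Vertex N → Edge N → ℝ}
    (hG : IsMultiflow G) :
    ∃ f : TorusEdge N → ℝ≥0, IsStandardizedGlobalFlow N f ∧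
      ∀ e, (f (edgeEquiv hN e) : ℝ) ≤ totalVolume G e := by
  obtain ⟨μ, hfin, htra, hflo⟩ := exists_pathFlow_of_isMultiflow hN hG
  have hne : ∀ e, flo μ e ≠ ⊤ := fun e => by
    obtain ⟨e, rfl⟩ := (edgeEquiv hN).surjective e
    exact ((hflo e).trans_lt ENNReal.ofReal_lt_top).ne
  refine ⟨fun e => (flo μ e).toNNReal, ⟨μ, hfin, fun a b => ?_, fun e =>
    (ENNReal.coe_toNNReal (hne e)).symm⟩, fun e => ?_⟩
  · rw [htra, ENNReal.ofReal_inv_of_pos (by have := NeZero.pos N; positivity),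
      ENNReal.ofReal_pow (by positivity), ENNReal.ofReal_natCast]
  · exact ENNReal.toReal_le_of_le_ofReal (totalVolume_nonneg G e) (hflo e)

end TorusFlows

section CanonicalFlows

variable {N : ℕ}

/-- The number of times that the walk `a, a + 1, …, a + n` on the cycle uses the edge from `x` to
`x + 1`. -/
def arcCount (a : ZMod N) (n : ℕ) (x : ZMod N) : ℝ :=
  ∑ k ∈ Finset.range n, if a + k = x then 1 else 0

lemma arcCount_nonneg (a : ZMod N) (n : ℕ) (x : ZMod N) : 0 ≤ arcCount a n x :=
  Finset.sum_nonneg fun _ _ => by positivity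

lemma arcCount_add (a : ZMod N) (m n : ℕ) (x : ZMod N) :
    arcCount a (m + n) x = arcCount a m x + arcCount (a + (m : ZMod N)) n x := by
  simp only [arcCount, Finset.sum_range_add, Nat.cast_add, add_assoc]

lemma arcCount_mono (a : ZMod N) {m n : ℕ} (h : m ≤ n) (x : ZMod N) :
    arcCount a m x ≤ arcCount a n x := by
  obtain ⟨k, rfl⟩ := Nat.exists_eq_add_of_le h
  rw [arcCount_add]
  exact le_add_of_nonneg_right (arcCount_nonneg _ _ _)

lemma arcCount_sub_le (a : ZMod N) {m n : ℕ} (h : m ≤ n) (x : ZMod N) :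
    arcCount (a - (m : ZMod N)) m x ≤ arcCount (a - (n : ZMod N)) n x := by
  obtain ⟨k, rfl⟩ := Nat.exists_eq_add_of_le' h
  rw [arcCount_add, Nat.cast_add, sub_add_eq_sub_sub_swap, sub_add_cancel]
  exact le_add_of_nonneg_left (arcCount_nonneg _ _ _)

lemma arcCount_sub_arcCount (a : ZMod N) (n : ℕ) (x : ZMod N) :
    arcCount a n x - arcCount a n (x - 1) =
      (if x = a then 1 else 0) - (if x = a + n then 1 else 0) := by
  have h := Finset.sum_range_sub' (fun k : ℕ => if x = a + k then (1 : ℝ) else 0) n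
  rw [Nat.cast_zero, add_zero] at h
  rw [arcCount, arcCount, ← Finset.sum_sub_distrib, ← h]
  refine Finset.sum_congr rfl fun k _ => ?_
  simp only [eq_sub_iff_add_eq, Nat.cast_add, Nat.cast_one, add_assoc, eq_comm (a := x)]

lemma sum_arcCount [NeZero N] (c : ZMod N) (n : ℕ) (x : ZMod N) :
    ∑ a, arcCount (a + c) n x = n := by
  unfold arcCount
  rw [Finset.sum_comm]
  simp [add_assoc, ← eq_sub_iff_add_eq]

/-- The unit flow from `a` to `b` along the shorter arc of the cycle; `cycleFlow a b x` is the flow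
from `x` to `x + 1`. -/
def cycleFlow (a b x : ZMod N) : ℝ :=
  if 0 ≤ (b - a).valMinAbs then arcCount a (b - a).valMinAbs.natAbs x
  else -arcCount b (b - a).valMinAbs.natAbs x

lemma cycleFlow_cases (a b : ZMod N) :
    (b = a + (b - a).valMinAbs.natAbs ∧
      ∀ x, cycleFlow a b x = arcCount a (b - a).valMinAbs.natAbs x) ∨
    (a = b + (b - a).valMinAbs.natAbs ∧
      ∀ x, cycleFlow a b x = -arcCount b (b - a).valMinAbs.natAbs x) := by
  rcases le_or_gt 0 (b - a).valMinAbs with h | h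
  · refine .inl ⟨?_, fun x => if_pos h⟩
    rw [← Int.cast_natCast, Int.natAbs_of_nonneg h, ZMod.coe_valMinAbs, add_sub_cancel]
  · refine .inr ⟨?_, fun x => if_neg h.not_ge⟩
    rw [← Int.cast_natCast, Int.ofNat_natAbs_of_nonpos h.le, Int.cast_neg, ZMod.coe_valMinAbs,
      neg_sub, add_sub_cancel]

lemma cycleFlow_sub_cycleFlow (a b x : ZMod N) :
    cycleFlow a b x - cycleFlow a b (x - 1) =
      (if x = a then 1 else 0) - (if x = b then 1 else 0) := by
  rcases cycleFlow_cases a b with ⟨h, hcyc⟩ | ⟨h, hcyc⟩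
  · rw [hcyc, hcyc, arcCount_sub_arcCount, ← h]
  · rw [hcyc, hcyc, neg_sub_neg, ← neg_sub, arcCount_sub_arcCount, ← h, neg_sub]

/-- The number of times that the walk `a - D, a - D + 1, …, a + D` on the cycle uses the edge from
`x` to `x + 1`. -/
def nearArcCount (D : ℕ) (a x : ZMod N) : ℝ := arcCount a D x + arcCount (a - (D : ZMod N)) D x

lemma sum_nearArcCount [NeZero N] (D : ℕ) (x : ZMod N) : ∑ a, nearArcCount D a x = 2 * D := by
  have h₀ := sum_arcCount 0 D x
  have h₁ := sum_arcCount (-(D : ZMod N)) D x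
  simp only [add_zero, ← sub_eq_add_neg] at h₀ h₁
  simp only [nearArcCount, Finset.sum_add_distrib, h₀, h₁, two_mul]

lemma abs_cycleFlow_le_nearArcCount_left {D : ℕ} {a b : ZMod N} (h : (b - a).valMinAbs.natAbs ≤ D)
    (x : ZMod N) : |cycleFlow a b x| ≤ nearArcCount D a x := by
  rcases cycleFlow_cases a b with ⟨-, hcyc⟩ | ⟨hab, hcyc⟩
  · rw [hcyc, abs_of_nonneg (arcCount_nonneg _ _ _)]
    exact le_add_of_le_of_nonneg (arcCount_mono a h x) (arcCount_nonneg _ _ _)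
  · rw [hcyc, abs_neg, abs_of_nonneg (arcCount_nonneg _ _ _),
      show arcCount b = _ from congrArg arcCount (eq_sub_of_add_eq hab.symm)]
    exact le_add_of_nonneg_of_le (arcCount_nonneg _ _ _) (arcCount_sub_le a h x)

lemma abs_cycleFlow_le_nearArcCount_right {D : ℕ} {a b : ZMod N} (h : (b - a).valMinAbs.natAbs ≤ D)
    (x : ZMod N) : |cycleFlow a b x| ≤ nearArcCount D b x := by
  rcases cycleFlow_cases a b with ⟨hab, hcyc⟩ | ⟨-, hcyc⟩
  · rw [hcyc, abs_of_nonneg (arcCount_nonneg _ _ _),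
      show arcCount a = _ from congrArg arcCount (eq_sub_of_add_eq hab.symm)]
    exact le_add_of_nonneg_of_le (arcCount_nonneg _ _ _) (arcCount_sub_le b h x)
  · rw [hcyc, abs_neg, abs_of_nonneg (arcCount_nonneg _ _ _)]
    exact le_add_of_le_of_nonneg (arcCount_mono b h x) (arcCount_nonneg _ _ _)

lemma four_mul_sum_min_le (n : ℕ) : 4 * ∑ k ∈ Finset.range n, min k (n - k) ≤ n ^ 2 := by
  induction n using Nat.twoStepInduction with
  | zero => simp
  | one => simp
  | more n ih _ =>
    have hmin : ∀ k ∈ Finset.range (n + 1),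
        min (k + 1) (n + 2 - (k + 1)) = min k (n - k) + 1 := fun k hk => by
      have := Finset.mem_range.1 hk
      omega
    rw [Finset.sum_range_succ', Finset.sum_congr rfl hmin, Finset.sum_add_distrib,
      Finset.sum_range_succ]
    simp only [Finset.sum_const, Finset.card_range, smul_eq_mul, mul_one, Nat.sub_self,
      Nat.zero_min, Nat.min_zero, add_zero]
    nlinarith

/-- The unit flow from `v` to `w` which first moves horizontally and then vertically. -/
def canonicalFlow (v w : Vertex N) (e : Edge N) : ℝ :=
  if e.1 then (if e.2.1 = w.1 then cycleFlow v.2 w.2 e.2.2 else 0)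
  else (if e.2.2 = v.2 then cycleFlow v.1 w.1 e.2.1 else 0)

lemma divergence_canonicalFlow (v w p : Vertex N) :
    divergence (canonicalFlow v w) p = (if p = v then 1 else 0) - (if p = w then 1 else 0) := by
  obtain ⟨x, y⟩ := p
  obtain ⟨v₁, v₂⟩ := v
  obtain ⟨w₁, w₂⟩ := w
  have hx := cycleFlow_sub_cycleFlow v₁ w₁ x
  have hy := cycleFlow_sub_cycleFlow v₂ w₂ y
  simp only [divergence, canonicalFlow, Bool.false_eq_true, if_false, if_true, Prod.mk.injEq]
  by_cases h1 : y = v₂ <;> by_cases h2 : x = w₁ <;> simp only [h1, h2, if_true, if_false] at * <;>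
    by_cases h3 : x = v₁ <;> by_cases h4 : y = w₂ <;> simp_all

/-- The multiflow which uses the canonical paths. -/
def canonicalMultiflow (N : ℕ) (v w : Vertex N) (e : Edge N) : ℝ :=
  ((N : ℝ) ^ 3)⁻¹ * canonicalFlow v w e

lemma divergence_mul (a : ℝ) (F : Edge N → ℝ) (p : Vertex N) :
    divergence (fun e => a * F e) p = a * divergence F p := by
  unfold divergence; ring

lemma divergence_add (F F' : Edge N → ℝ) (p : Vertex N) :
    divergence (fun e => F e + F' e) p = divergence F p + divergence F' p := by
  unfold divergence; ring

lemma divergence_sub (F F' : Edge N → ℝ) (p : Vertex N) :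
    divergence (fun e => F e - F' e) p = divergence F p - divergence F' p := by
  unfold divergence; ring

lemma divergence_sum {ι : Type*} (s : Finset ι) (F : ι → Edge N → ℝ) (p : Vertex N) :
    divergence (fun e => ∑ i ∈ s, F i e) p = ∑ i ∈ s, divergence (F i) p := by
  simp only [divergence, ← Finset.sum_sub_distrib, ← Finset.sum_add_distrib]

lemma isMultiflow_canonicalMultiflow : IsMultiflow (canonicalMultiflow N) := fun v w p => by
  unfold canonicalMultiflow
  rw [divergence_mul, divergence_canonicalFlow]

variable [NeZero N]

lemma sum_natAbs_valMinAbs_le : ∑ d : ZMod N, (d.valMinAbs.natAbs : ℝ) ≤ (N : ℝ) ^ 2 / 4 := by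
  have h : ∑ d : ZMod N, d.valMinAbs.natAbs = ∑ k ∈ Finset.range N, min k (N - k) := by
    simp only [ZMod.valMinAbs_natAbs_eq_min]
    obtain ⟨n, rfl⟩ := Nat.exists_eq_add_one_of_ne_zero (NeZero.ne N)
    exact Fin.sum_univ_eq_sum_range (fun k => min k (n + 1 - k)) (n + 1)
  have h4 : (4 : ℝ) * ∑ d : ZMod N, (d.valMinAbs.natAbs : ℝ) ≤ (N : ℝ) ^ 2 := by
    exact_mod_cast h ▸ four_mul_sum_min_le N
  linarith

lemma sum_abs_cycleFlow_add (d x : ZMod N) : ∑ a, |cycleFlow a (a + d) x| = d.valMinAbs.natAbs := by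
  unfold cycleFlow
  simp only [add_sub_cancel_left]
  split_ifs
  · simpa only [add_zero, abs_of_nonneg (arcCount_nonneg _ _ _)] using sum_arcCount 0 _ x
  · simpa only [abs_neg, abs_of_nonneg (arcCount_nonneg _ _ _)] using sum_arcCount d _ x

lemma sum_abs_cycleFlow_le (x : ZMod N) : ∑ a, ∑ b, |cycleFlow a b x| ≤ (N : ℝ) ^ 2 / 4 := by
  calc ∑ a, ∑ b, |cycleFlow a b x| = ∑ a, ∑ d, |cycleFlow a (a + d) x| :=
        Finset.sum_congr rfl fun a _ =>
          (Equiv.sum_comp (Equiv.addLeft a) fun b => |cycleFlow a b x|).symm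
    _ = ∑ d : ZMod N, (d.valMinAbs.natAbs : ℝ) := by
        rw [Finset.sum_comm]
        exact Finset.sum_congr rfl fun d _ => sum_abs_cycleFlow_add d x
    _ ≤ (N : ℝ) ^ 2 / 4 := sum_natAbs_valMinAbs_le

lemma sum_abs_canonicalFlow_le (e : Edge N) :
    ∑ v, ∑ w, |canonicalFlow v w e| ≤ (N : ℝ) ^ 3 / 4 := by
  suffices h : ∃ x, ∑ v, ∑ w, |canonicalFlow v w e| = N * ∑ a, ∑ b, |cycleFlow a b x| by
    obtain ⟨x, hx⟩ := h
    calc _ = N * ∑ a, ∑ b, |cycleFlow a b x| := hx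
      _ ≤ N * ((N : ℝ) ^ 2 / 4) := by gcongr; exact sum_abs_cycleFlow_le x
      _ = (N : ℝ) ^ 3 / 4 := by ring
  obtain ⟨d, x, y⟩ := e
  cases d
  · refine ⟨x, ?_⟩
    simp only [canonicalFlow, Bool.false_eq_true, if_false, apply_ite abs, abs_zero,
      Fintype.sum_prod_type, Finset.sum_const, Finset.card_univ, ZMod.card, nsmul_eq_mul]
    rw [Finset.mul_sum]
    refine Finset.sum_congr rfl fun a _ => ?_
    rw [Finset.sum_comm]
    simp [Finset.mul_sum]
  · refine ⟨y, ?_⟩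
    have h : ∀ b : ZMod N, ∑ c : ZMod N, ∑ d : ZMod N, (if x = c then |cycleFlow b d y| else 0) =
        ∑ d, |cycleFlow b d y| := fun b => by
      rw [Finset.sum_comm]
      simp
    simp only [canonicalFlow, if_true, apply_ite abs, abs_zero, Fintype.sum_prod_type, h,
      Finset.sum_const, Finset.card_univ, ZMod.card, nsmul_eq_mul]

lemma totalVolume_canonicalMultiflow_le (e : Edge N) :
    totalVolume (canonicalMultiflow N) e ≤ 1 / 4 := by
  have hN : (0 : ℝ) < N := Nat.cast_pos.2 (NeZero.pos N)
  calc totalVolume (canonicalMultiflow N) e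
      = ((N : ℝ) ^ 3)⁻¹ * ∑ v, ∑ w, |canonicalFlow v w e| := by
        simp only [totalVolume, canonicalMultiflow, abs_mul, ← Finset.mul_sum,
          abs_of_pos (inv_pos.2 (pow_pos hN 3))]
    _ ≤ ((N : ℝ) ^ 3)⁻¹ * ((N : ℝ) ^ 3 / 4) := by gcongr; exact sum_abs_canonicalFlow_le e
    _ = 1 / 4 := by field_simp

end CanonicalFlows

section Partitions

variable {N : ℕ} [NeZero N]

/-- The canonical flow which moves a unit mass at `v` to the distribution `ρ v`. -/
def spreadFlow (ρ : Vertex N → Vertex N → ℝ) (v : Vertex N) (e : Edge N) : ℝ :=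
  ∑ w, ρ v w * canonicalFlow v w e

lemma divergence_spreadFlow {ρ : Vertex N → Vertex N → ℝ} {v : Vertex N} (hρ : ∑ w, ρ v w = 1)
    (p : Vertex N) : divergence (spreadFlow ρ v) p = (if p = v then 1 else 0) - ρ v p := by
  unfold spreadFlow
  rw [divergence_sum]
  simp only [divergence_mul, divergence_canonicalFlow, mul_sub, Finset.sum_sub_distrib]
  rw [← Finset.sum_mul, hρ]
  simp

lemma sum_abs_spreadFlow_le {ρ : Vertex N → Vertex N → ℝ} (hρ₀ : ∀ v w, 0 ≤ ρ v w)
    (hrow : ∀ v, ∑ w, ρ v w = 1) (hcol : ∀ w, ∑ v, ρ v w = 1) {D : ℕ}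
    (hD : ∀ v w, ρ v w ≠ 0 →
      (w.1 - v.1).valMinAbs.natAbs ≤ D ∧ (w.2 - v.2).valMinAbs.natAbs ≤ D) (e : Edge N) :
    ∑ v, |spreadFlow ρ v e| ≤ 2 * D := by
  have habs : ∑ v, |spreadFlow ρ v e| ≤ ∑ v, ∑ w, ρ v w * |canonicalFlow v w e| := by
    refine Finset.sum_le_sum fun v _ => (Finset.abs_sum_le_sum_abs _ _).trans_eq ?_
    exact Finset.sum_congr rfl fun w _ => by rw [abs_mul, abs_of_nonneg (hρ₀ v w)]
  have hle : ∀ k : Vertex N → Vertex N → ℝ, (∀ v w, ρ v w ≠ 0 → |canonicalFlow v w e| ≤ k v w) →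
      ∑ v, |spreadFlow ρ v e| ≤ ∑ v, ∑ w, ρ v w * k v w := fun k hk => by
    refine habs.trans (Finset.sum_le_sum fun v _ => Finset.sum_le_sum fun w _ => ?_)
    by_cases h : ρ v w = 0
    · rw [h, zero_mul, zero_mul]
    · exact mul_le_mul_of_nonneg_left (hk v w h) (hρ₀ v w)
  obtain ⟨d, x, y⟩ := e
  cases d
  · calc _ ≤ ∑ v : Vertex N, ∑ w : Vertex N,
        ρ v w * (if y = v.2 then nearArcCount D v.1 x else 0) :=
          hle _ fun v w h => by
            simp only [canonicalFlow, Bool.false_eq_true, if_false, apply_ite abs, abs_zero]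
            split_ifs
            exacts [abs_cycleFlow_le_nearArcCount_left (hD v w h).1 x, le_rfl]
      _ = ∑ v : Vertex N, (if y = v.2 then nearArcCount D v.1 x else 0) := by
          simp only [← Finset.sum_mul, hrow, one_mul]
      _ = 2 * D := by
          simp only [Fintype.sum_prod_type, Finset.sum_ite_eq, Finset.mem_univ, if_true,
            sum_nearArcCount]
  · calc _ ≤ ∑ v : Vertex N, ∑ w : Vertex N,
        ρ v w * (if x = w.1 then nearArcCount D w.2 y else 0) :=
          hle _ fun v w h => by
            simp only [canonicalFlow, if_true, apply_ite abs, abs_zero]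
            split_ifs
            exacts [abs_cycleFlow_le_nearArcCount_right (hD v w h).2 y, le_rfl]
      _ = ∑ w : Vertex N, (if x = w.1 then nearArcCount D w.2 y else 0) := by
          rw [Finset.sum_comm]
          simp only [← Finset.sum_mul, hcol, one_mul]
      _ = 2 * D := by
          rw [Fintype.sum_prod_type, Finset.sum_comm]
          simp only [Finset.sum_ite_eq, Finset.mem_univ, if_true, sum_nearArcCount]

variable {ι α : Type*} [Fintype ι] [Fintype α]

/-- A fractional partition of `α` into parts indexed by `ι`: the point `v` belongs to the part `i`
with weight `χ i v`. -/
structure IsFractionalPartition (χ : ι → α → ℝ) : Prop where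
  nonneg : ∀ i v, 0 ≤ χ i v
  sum_eq_one : ∀ v, ∑ i, χ i v = 1

/-- The transition matrix of the chain which moves from a point to a part and then to a point of
that part, both times according to the weights. -/
def mixingWeight (χ : ι → α → ℝ) (v w : α) : ℝ := ∑ i, χ i v * χ i w / ∑ u, χ i u

lemma mixingWeight_comm (χ : ι → α → ℝ) (v w : α) : mixingWeight χ v w = mixingWeight χ w v := by
  simp only [mixingWeight, mul_comm]

namespace IsFractionalPartition

variable {χ : ι → α → ℝ}

lemma sum_nonneg (hχ : IsFractionalPartition χ) (i : ι) : 0 ≤ ∑ v, χ i v :=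
  Finset.sum_nonneg fun v _ => hχ.nonneg i v

-- A part of total weight zero is harmless, since then both sides vanish.
lemma mul_sum_div_sum (hχ : IsFractionalPartition χ) (i : ι) (v : α) :
    χ i v * ((∑ u, χ i u) / ∑ u, χ i u) = χ i v := by
  rcases eq_or_ne (∑ u, χ i u) 0 with h | h
  · rw [(Finset.sum_eq_zero_iff_of_nonneg fun v _ => hχ.nonneg i v).1 h v (Finset.mem_univ v),
      zero_mul]
  · rw [div_self h, mul_one]

lemma mixingWeight_nonneg (hχ : IsFractionalPartition χ) (v w : α) : 0 ≤ mixingWeight χ v w :=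
  Finset.sum_nonneg fun i _ =>
    div_nonneg (mul_nonneg (hχ.nonneg i v) (hχ.nonneg i w)) (hχ.sum_nonneg i)

lemma sum_mixingWeight (hχ : IsFractionalPartition χ) (v : α) : ∑ w, mixingWeight χ v w = 1 := by
  unfold mixingWeight
  rw [Finset.sum_comm, ← hχ.sum_eq_one v]
  refine Finset.sum_congr rfl fun i _ => ?_
  rw [← Finset.sum_div, ← Finset.mul_sum, mul_div_assoc, hχ.mul_sum_div_sum]

end IsFractionalPartition

/-- The flows between points obtained from flows `H` between the parts of a fractional partition:
the mass at `v` is mixed within the parts of `v`, moved by `H`, and mixed within the parts of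
`w`. -/
def partitionFlow (χ : ι → Vertex N → ℝ) (H : ι → ι → Edge N → ℝ) (v w : Vertex N)
    (e : Edge N) : ℝ :=
  ((N : ℝ) ^ 3)⁻¹ * (spreadFlow (mixingWeight χ) v e - spreadFlow (mixingWeight χ) w e) +
    ∑ i, ∑ j, χ i v * χ j w / ((∑ u, χ i u) * ∑ u, χ j u) * H i j e

lemma isMultiflow_partitionFlow {χ : ι → Vertex N → ℝ} (hχ : IsFractionalPartition χ)
    {H : ι → ι → Edge N → ℝ}
    (hH : ∀ i j p, divergence (H i j) p =
      ((N : ℝ) ^ 3)⁻¹ * ((∑ v, χ j v) * χ i p - (∑ v, χ i v) * χ j p)) :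
    IsMultiflow (partitionFlow χ H) := fun v w p => by
  unfold partitionFlow
  rw [divergence_add, divergence_mul, divergence_sub, divergence_spreadFlow (hχ.sum_mixingWeight v),
    divergence_spreadFlow (hχ.sum_mixingWeight w), divergence_sum]
  simp only [divergence_sum, divergence_mul, hH]
  have hterm : ∀ i j, χ i v * χ j w / ((∑ u, χ i u) * ∑ u, χ j u) *
      (((N : ℝ) ^ 3)⁻¹ * ((∑ u, χ j u) * χ i p - (∑ u, χ i u) * χ j p)) =
      ((N : ℝ) ^ 3)⁻¹ * ((χ i v * χ i p / ∑ u, χ i u) * (χ j w * ((∑ u, χ j u) / ∑ u, χ j u)) -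
        (χ i v * ((∑ u, χ i u) / ∑ u, χ i u)) * (χ j w * χ j p / ∑ u, χ j u)) := fun i j => by
    simp only [div_eq_mul_inv, mul_inv]
    ring
  have hsum : ∑ i, ∑ j, χ i v * χ j w / ((∑ u, χ i u) * ∑ u, χ j u) *
      (((N : ℝ) ^ 3)⁻¹ * ((∑ u, χ j u) * χ i p - (∑ u, χ i u) * χ j p)) =
      ((N : ℝ) ^ 3)⁻¹ * (mixingWeight χ v p - mixingWeight χ w p) := by
    simp only [hterm, hχ.mul_sum_div_sum, ← Finset.mul_sum, Finset.sum_sub_distrib,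
      ← Finset.sum_mul, hχ.sum_eq_one, mul_one, one_mul, mixingWeight]
  rw [hsum]
  ring

lemma IsFractionalPartition.sum_weight_le_one {χ : ι → α → ℝ} (hχ : IsFractionalPartition χ)
    (i j : ι) : ∑ v, ∑ w, χ i v * χ j w / ((∑ u, χ i u) * ∑ u, χ j u) ≤ 1 := by
  simp only [mul_div_mul_comm, ← Finset.mul_sum, ← Finset.sum_mul, ← Finset.sum_div]
  exact mul_le_one₀ (div_self_le_one _) (div_nonneg (hχ.sum_nonneg j) (hχ.sum_nonneg j))
    (div_self_le_one _)

lemma abs_partitionFlow_le {χ : ι → Vertex N → ℝ} (hχ : IsFractionalPartition χ)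
    (H : ι → ι → Edge N → ℝ) (v w : Vertex N) (e : Edge N) :
    |partitionFlow χ H v w e| ≤
      ((N : ℝ) ^ 3)⁻¹ * (|spreadFlow (mixingWeight χ) v e| + |spreadFlow (mixingWeight χ) w e|) +
        ∑ i, ∑ j, χ i v * χ j w / ((∑ u, χ i u) * ∑ u, χ j u) * |H i j e| := by
  refine (abs_add_le _ _).trans (add_le_add ?_ ?_)
  · rw [abs_mul, abs_of_nonneg (by positivity)]
    gcongr
    exact abs_sub _ _
  · refine (Finset.abs_sum_le_sum_abs _ _).trans (Finset.sum_le_sum fun i _ => ?_)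
    refine (Finset.abs_sum_le_sum_abs _ _).trans_eq (Finset.sum_congr rfl fun j _ => ?_)
    rw [abs_mul, abs_of_nonneg (div_nonneg (mul_nonneg (hχ.nonneg _ _) (hχ.nonneg _ _))
      (mul_nonneg (hχ.sum_nonneg _) (hχ.sum_nonneg _)))]

theorem totalVolume_partitionFlow_le {χ : ι → Vertex N → ℝ} (hχ : IsFractionalPartition χ) {D : ℕ}
    (hD : ∀ i v w, χ i v ≠ 0 → χ i w ≠ 0 →
      (w.1 - v.1).valMinAbs.natAbs ≤ D ∧ (w.2 - v.2).valMinAbs.natAbs ≤ D)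
    (H : ι → ι → Edge N → ℝ) (e : Edge N) :
    totalVolume (partitionFlow χ H) e ≤ totalVolume H e + 4 * D / N := by
  have hN : (0 : ℝ) < N := Nat.cast_pos.2 (NeZero.pos N)
  have hspread : ∑ v, |spreadFlow (mixingWeight χ) v e| ≤ 2 * D := by
    refine sum_abs_spreadFlow_le hχ.mixingWeight_nonneg hχ.sum_mixingWeight
      (fun w => by simpa only [mixingWeight_comm χ w] using hχ.sum_mixingWeight w)
      (fun v w h => ?_) e
    obtain ⟨i, -, hi⟩ := Finset.exists_ne_zero_of_sum_ne_zero h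
    exact hD i v w (fun h => hi (by simp [h])) fun h => hi (by simp [h])
  calc totalVolume (partitionFlow χ H) e
      ≤ ∑ v, ∑ w, (((N : ℝ) ^ 3)⁻¹ *
            (|spreadFlow (mixingWeight χ) v e| + |spreadFlow (mixingWeight χ) w e|) +
          ∑ i, ∑ j, χ i v * χ j w / ((∑ u, χ i u) * ∑ u, χ j u) * |H i j e|) :=
        Finset.sum_le_sum fun v _ => Finset.sum_le_sum fun w _ => abs_partitionFlow_le hχ H v w e
    _ = ((N : ℝ) ^ 3)⁻¹ * (2 * (N : ℝ) ^ 2 * ∑ v, |spreadFlow (mixingWeight χ) v e|) +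
          ∑ i, ∑ j, (∑ v, ∑ w, χ i v * χ j w / ((∑ u, χ i u) * ∑ u, χ j u)) * |H i j e| := by
        simp only [Finset.sum_add_distrib, ← Finset.mul_sum, Finset.sum_const,
          Finset.card_univ, Fintype.card_prod, ZMod.card, nsmul_eq_mul]
        congr 1
        · push_cast
          ring
        · simp only [Finset.sum_mul]
          rw [Finset.sum_congr rfl fun v _ => Finset.sum_comm, Finset.sum_comm]
          refine Finset.sum_congr rfl fun i _ => ?_
          rw [Finset.sum_congr rfl fun v _ => Finset.sum_comm, Finset.sum_comm]
    _ ≤ ((N : ℝ) ^ 3)⁻¹ * (2 * (N : ℝ) ^ 2 * (2 * D)) + ∑ i, ∑ j, 1 * |H i j e| := by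
        gcongr with i _ j _
        exact hχ.sum_weight_le_one i j
    _ = totalVolume H e + 4 * D / N := by
        simp only [one_mul, totalVolume]
        field_simp
        ring

end Partitions

section Concentration

open ProbabilityTheory

variable {Ω Ω' : Type*} [MeasurableSpace Ω] [MeasurableSpace Ω'] {D C : ℝ}

lemma memLp_two_of_abs_le {μ : Measure Ω} [IsFiniteMeasure μ] {X : Ω → ℝ} (hX : Measurable X)
    (hC : ∀ ω, |X ω| ≤ C) : MemLp X 2 μ :=
  .of_bound hX.aestronglyMeasurable C (.of_forall hC)

lemma variance_le_sq_of_abs_sub_le {μ : Measure Ω} [IsProbabilityMeasure μ] {X : Ω → ℝ}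
    (hX : Measurable X) (hD : ∀ ω ω', |X ω - X ω'| ≤ D) : Var[X; μ] ≤ D ^ 2 := by
  obtain ⟨ω₀⟩ := μ.nonempty_of_neZero
  have h : ∀ ω, X ω ∈ Icc (X ω₀ - D) (X ω₀ + D) := fun ω =>
    ⟨by linarith [(abs_le.1 (hD ω ω₀)).1], by linarith [(abs_le.1 (hD ω ω₀)).2]⟩
  refine (variance_le_sq_of_bounded (.of_forall h) hX.aemeasurable).trans_eq ?_
  ring

lemma abs_integral_le_of_abs_le {μ : Measure Ω} [IsProbabilityMeasure μ] {X : Ω → ℝ}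
    (hC : ∀ ω, |X ω| ≤ C) : |∫ ω, X ω ∂μ| ≤ C := by
  simpa using norm_integral_le_of_norm_le_const (μ := μ) (f := X) (C := C) (.of_forall hC)

lemma variance_prod {μ : Measure Ω} {ν : Measure Ω'} [IsProbabilityMeasure μ]
    [IsProbabilityMeasure ν] {g : Ω × Ω' → ℝ} (hg : Measurable g) (hC : ∀ z, |g z| ≤ C) :
    Var[g; μ.prod ν] =
      ∫ x, Var[fun y => g (x, y); ν] ∂μ + Var[fun x => ∫ y, g (x, y) ∂ν; μ] := by
  have hmem : MemLp g 2 (μ.prod ν) := memLp_two_of_abs_le hg hC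
  have hmean : MemLp (fun x => ∫ y, g (x, y) ∂ν) 2 μ :=
    memLp_two_of_abs_le hg.stronglyMeasurable.integral_prod_right'.measurable fun x =>
      abs_integral_le_of_abs_le fun y => hC (x, y)
  have hsection : ∀ x, Var[fun y => g (x, y); ν] =
      ∫ y, g (x, y) ^ 2 ∂ν - (∫ y, g (x, y) ∂ν) ^ 2 := fun x =>
    variance_eq_sub (memLp_two_of_abs_le (hg.comp measurable_prodMk_left) fun y => hC (x, y))
  simp only [hsection]
  rw [variance_eq_sub hmem, variance_eq_sub hmean, integral_sub
    hmem.integrable_sq.integral_prod_left hmean.integrable_sq]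
  simp only [Pi.pow_apply]
  rw [integral_prod _ hmem.integrable_sq, integral_prod _ (hmem.integrable one_le_two)]
  ring

lemma sq_integral_abs_sub_integral_le_variance {μ : Measure Ω} [IsProbabilityMeasure μ]
    {X : Ω → ℝ} (hX : MemLp X 2 μ) : (∫ ω, |X ω - ∫ ω', X ω' ∂μ| ∂μ) ^ 2 ≤ Var[X; μ] := by
  have hdev : MemLp (fun ω => |X ω - ∫ ω', X ω' ∂μ|) 2 μ := (hX.sub (memLp_const _)).abs
  have h := variance_nonneg (fun ω => |X ω - ∫ ω', X ω' ∂μ|) μ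
  rw [variance_eq_sub hdev] at h
  simp only [Pi.pow_apply, sq_abs] at h
  rw [variance_eq_integral hX.aemeasurable]
  linarith

/-- Changing one variable changes the value of `g` by at most `D` (McDiarmid's condition). -/
def HasBoundedDifferences {E : Type*} (g : (E → Ω) → ℝ) (D : ℝ) : Prop :=
  ∀ c c' i, (∀ j ≠ i, c j = c' j) → |g c - g c'| ≤ D

-- Efron–Stein inequality, by induction over the variables: split off one of them by the law of
-- total variance.
lemma variance_le_of_hasBoundedDifferences_fin (κ : Measure Ω) [IsProbabilityMeasure κ] {n : ℕ}
    {g : (Fin n → Ω) → ℝ} (hg : Measurable g) (hC : ∀ c, |g c| ≤ C)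
    (hD : HasBoundedDifferences g D) : Var[g; Measure.pi fun _ => κ] ≤ n * D ^ 2 := by
  induction n with
  | zero =>
    refine (variance_le_sq_of_abs_sub_le (D := 0) hg fun c c' => ?_).trans_eq (by simp)
    rw [Subsingleton.elim c c', sub_self, abs_zero]
  | succ n ih =>
    let φ := (MeasurableEquiv.piFinSuccAbove (fun _ : Fin (n + 1) => Ω) 0).symm
    have hφ : ∀ z, φ z = Fin.cons z.1 z.2 := fun z => by
      simp only [φ, MeasurableEquiv.piFinSuccAbove_symm_apply, Fin.insertNthEquiv_zero]
      rfl
    have hgφ : Measurable fun z => g (φ z) := hg.comp φ.measurable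
    have hrest : ∀ x, Var[fun y => g (φ (x, y)); Measure.pi fun _ => κ] ≤ n * D ^ 2 := fun x =>
      ih (hgφ.comp measurable_prodMk_left) (fun y => hC _) fun y y' i hi => by
        rw [hφ, hφ]
        exact hD _ _ i.succ (Fin.cases (fun _ => rfl) fun j hj => hi j fun h => hj (h ▸ rfl))
    have hfirst : Var[fun x => ∫ y, g (φ (x, y)) ∂(Measure.pi fun _ => κ); κ] ≤ D ^ 2 := by
      refine variance_le_sq_of_abs_sub_le
        hgφ.stronglyMeasurable.integral_prod_right'.measurable fun x x' => ?_
      have hint : ∀ x, Integrable (fun y => g (φ (x, y))) (Measure.pi fun _ => κ) := fun x =>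
        (memLp_two_of_abs_le (hgφ.comp measurable_prodMk_left) fun y => hC _).integrable one_le_two
      rw [← integral_sub (hint x) (hint x')]
      refine abs_integral_le_of_abs_le fun y => ?_
      rw [hφ, hφ]
      exact hD _ _ 0 (Fin.cases (fun h => absurd rfl h) fun j _ => rfl)
    have hpres := (measurePreserving_piFinSuccAbove (fun _ : Fin (n + 1) => κ) 0).symm
    calc Var[g; Measure.pi fun _ => κ]
        = Var[fun z => g (φ z); κ.prod (Measure.pi fun _ => κ)] :=
          (hpres.variance_fun_comp hg.aemeasurable).symm
      _ ≤ ∫ _, n * D ^ 2 ∂κ + D ^ 2 := by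
          rw [variance_prod hgφ fun z => hC _]
          refine add_le_add (integral_mono_of_nonneg (.of_forall fun _ => variance_nonneg _ _)
            (integrable_const _) (.of_forall hrest)) hfirst
      _ = (n + 1 : ℕ) * D ^ 2 := by
          simp only [integral_const, probReal_univ, smul_eq_mul, one_mul, Nat.cast_add,
            Nat.cast_one]
          ring

lemma variance_le_of_hasBoundedDifferences (κ : Measure Ω) [IsProbabilityMeasure κ]
    {E : Type*} [Fintype E] {g : (E → Ω) → ℝ} (hg : Measurable g) (hC : ∀ c, |g c| ≤ C)
    (hD : HasBoundedDifferences g D) :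
    Var[g; Measure.pi fun _ => κ] ≤ Fintype.card E * D ^ 2 := by
  let e := (Fintype.equivFin E).symm
  let φ := MeasurableEquiv.piCongrLeft (fun _ : E => Ω) e
  have hφ : ∀ c i, φ c (e i) = c i := fun c i =>
    Equiv.piCongrLeft_apply_apply (P := fun _ : E => Ω) e c i
  rw [← (measurePreserving_piCongrLeft (fun _ : E => κ) e).variance_fun_comp hg.aemeasurable]
  refine variance_le_of_hasBoundedDifferences_fin κ (hg.comp φ.measurable) (fun _ => hC _)
    fun c c' i h => hD _ _ (e i) fun j hj => ?_
  obtain ⟨j, rfl⟩ := e.surjective j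
  rw [hφ, hφ]
  exact h j fun hji => hj (hji ▸ rfl)

theorem integral_abs_sub_integral_le_of_hasBoundedDifferences (κ : Measure Ω)
    [IsProbabilityMeasure κ] {E : Type*} [Fintype E] (hD₀ : 0 ≤ D) {g : (E → Ω) → ℝ}
    (hg : Measurable g) (hC : ∀ c, |g c| ≤ C) (hD : HasBoundedDifferences g D) :
    ∫ c, |g c - ∫ c', g c' ∂(Measure.pi fun _ => κ)| ∂(Measure.pi fun _ => κ) ≤
      D * √(Fintype.card E) := by
  refine le_of_sq_le_sq ?_ (by positivity)
  calc _ ≤ Var[g; Measure.pi fun _ => κ] :=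
        sq_integral_abs_sub_integral_le_variance (memLp_two_of_abs_le hg hC)
    _ ≤ Fintype.card E * D ^ 2 := variance_le_of_hasBoundedDifferences κ hg hC hD
    _ = (D * √(Fintype.card E)) ^ 2 := by
        rw [mul_pow, Real.sq_sqrt (Nat.cast_nonneg _), mul_comm]

end Concentration

section Selection

variable {E : Type*} [Fintype E] {T : Type*} {B cm : ℝ} {v c : E → ℝ} {vol : T → E → ℝ}

/-- The cost of the flow-volumes `v` in the environment `c`. -/
def quadCost (v c : E → ℝ) : ℝ := ∑ e, c e * v e ^ 2

/-- The infimum of the costs of a family of flow-volumes, as a function of the environment. -/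
def infCost (vol : T → E → ℝ) (c : E → ℝ) : ℝ := ⨅ t, quadCost (vol t) c

lemma continuous_quadCost_right (v : E → ℝ) : Continuous (quadCost v) := by
  unfold quadCost; fun_prop

lemma continuous_quadCost_left (c : E → ℝ) : Continuous fun v => quadCost v c := by
  unfold quadCost; fun_prop

lemma quadCost_nonneg (hc : ∀ e, 0 ≤ c e) : 0 ≤ quadCost v c :=
  Finset.sum_nonneg fun e _ => mul_nonneg (hc e) (sq_nonneg _)

lemma quadCost_le (h0 : ∀ e, 0 ≤ v e) (hB : ∀ e, v e ≤ B) (hc : ∀ e, c e ∈ Icc 0 cm) :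
    quadCost v c ≤ Fintype.card E * (cm * B ^ 2) := by
  calc quadCost v c ≤ ∑ _e : E, cm * B ^ 2 := Finset.sum_le_sum fun e _ =>
        mul_le_mul (hc e).2 (pow_le_pow_left₀ (h0 e) (hB e) 2) (sq_nonneg _)
          ((hc e).1.trans (hc e).2)
    _ = Fintype.card E * (cm * B ^ 2) := by simp

lemma abs_quadCost_sub_le (h0 : ∀ e, 0 ≤ v e) (hB : ∀ e, v e ≤ B) (c c' : E → ℝ) :
    |quadCost v c - quadCost v c'| ≤ B ^ 2 * ∑ e, |c e - c' e| := by
  unfold quadCost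
  rw [← Finset.sum_sub_distrib, Finset.mul_sum]
  refine (Finset.abs_sum_le_sum_abs _ _).trans (Finset.sum_le_sum fun e _ => ?_)
  rw [← sub_mul, abs_mul, abs_of_nonneg (sq_nonneg (v e)), mul_comm]
  exact mul_le_mul_of_nonneg_right (pow_le_pow_left₀ (h0 e) (hB e) 2) (abs_nonneg _)

lemma bddBelow_quadCost (h0 : ∀ t e, 0 ≤ vol t e) (hB : ∀ t e, vol t e ≤ B) (c : E → ℝ) :
    BddBelow (range fun t => quadCost (vol t) c) := by
  refine ⟨-(B ^ 2 * ∑ e, |c e - 0|), ?_⟩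
  rintro _ ⟨t, rfl⟩
  have hzero : quadCost (vol t) (fun _ => 0) = 0 := by simp [quadCost]
  have h := abs_quadCost_sub_le (h0 t) (hB t) c fun _ => 0
  rw [hzero, sub_zero] at h
  exact (abs_le.1 h).1

lemma infCost_le (h0 : ∀ t e, 0 ≤ vol t e) (hB : ∀ t e, vol t e ≤ B) (c : E → ℝ) (t : T) :
    infCost vol c ≤ quadCost (vol t) c :=
  ciInf_le (bddBelow_quadCost h0 hB c) t

section Nonempty

variable [Nonempty T]

lemma exists_quadCost_lt_infCost_add (vol : T → E → ℝ) (c : E → ℝ) {ε : ℝ} (hε : 0 < ε) :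
    ∃ t, quadCost (vol t) c < infCost vol c + ε :=
  exists_lt_of_ciInf_lt (lt_add_of_pos_right _ hε)

lemma infCost_nonneg (hc : ∀ e, 0 ≤ c e) : 0 ≤ infCost vol c :=
  le_ciInf fun _ => quadCost_nonneg hc

lemma infCost_le_card (h0 : ∀ t e, 0 ≤ vol t e) (hB : ∀ t e, vol t e ≤ B)
    (hc : ∀ e, c e ∈ Icc 0 cm) : infCost vol c ≤ Fintype.card E * (cm * B ^ 2) := by
  obtain ⟨t⟩ := ‹Nonempty T›
  exact (infCost_le h0 hB c t).trans (quadCost_le (h0 t) (hB t) hc)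

lemma abs_infCost_sub_le (h0 : ∀ t e, 0 ≤ vol t e) (hB : ∀ t e, vol t e ≤ B) (c c' : E → ℝ) :
    |infCost vol c - infCost vol c'| ≤ B ^ 2 * ∑ e, |c e - c' e| := by
  have key : ∀ c c' : E → ℝ, infCost vol c - B ^ 2 * ∑ e, |c e - c' e| ≤ infCost vol c' := by
    refine fun c c' => le_ciInf fun t => ?_
    have h1 := infCost_le h0 hB c t
    have h2 := (abs_le.1 (abs_quadCost_sub_le (h0 t) (hB t) c c')).2
    linarith
  have h1 := key c c'
  have h2 := key c' c
  simp only [abs_sub_comm (c' _)] at h2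
  rw [abs_le]
  constructor <;> linarith

lemma continuous_infCost (h0 : ∀ t e, 0 ≤ vol t e) (hB : ∀ t e, vol t e ≤ B) :
    Continuous (infCost vol) := by
  refine continuous_iff_continuousAt.2 fun c₀ => tendsto_iff_dist_tendsto_zero.2 ?_
  have hcont : Continuous fun c : E → ℝ => B ^ 2 * ∑ e, |c e - c₀ e| := by fun_prop
  refine squeeze_zero (fun _ => dist_nonneg) (fun c => abs_infCost_sub_le h0 hB c c₀) ?_
  simpa using hcont.tendsto c₀

-- A countable dense set of volumes suffices; pick the first of its members that is good enough.
lemma exists_measurable_selection (h0 : ∀ t e, 0 ≤ vol t e) (hB : ∀ t e, vol t e ≤ B) {ε : ℝ}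
    (hε : 0 < ε) :
    ∃ s : (E → ℝ) → T, (∀ e, Measurable fun c => vol (s c) e) ∧
      ∀ c, quadCost (vol (s c)) c ≤ infCost vol c + ε := by
  classical
  let W := range vol
  have : Nonempty W := (range_nonempty vol).to_subtype
  have hdense : ∀ n, ∃ t, vol t = (TopologicalSpace.denseSeq W n : E → ℝ) := fun n =>
    (TopologicalSpace.denseSeq W n).2
  choose τ hτ using hdense
  have hex : ∀ c, ∃ n, quadCost (vol (τ n)) c < infCost vol c + ε := by
    intro c
    obtain ⟨t, ht⟩ := exists_quadCost_lt_infCost_add vol c hε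
    have hopen : IsOpen {w : W | quadCost (w : E → ℝ) c < infCost vol c + ε} :=
      isOpen_lt ((continuous_quadCost_left c).comp continuous_subtype_val) continuous_const
    obtain ⟨n, hn⟩ := (TopologicalSpace.denseRange_denseSeq W).exists_mem_open hopen
      ⟨⟨vol t, t, rfl⟩, ht⟩
    exact ⟨n, by rwa [hτ]⟩
  refine ⟨fun c => τ (Nat.find (hex c)), fun e => ?_, fun c => (Nat.find_spec (hex c)).le⟩
  have hfind : Measurable fun c => Nat.find (hex c) := measurable_find hex fun n =>
    measurableSet_lt (continuous_quadCost_right _).measurable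
      ((continuous_infCost h0 hB).measurable.add_const _)
  exact (Measurable.of_discrete (f := fun n => vol (τ n) e)).comp hfind

end Nonempty

section Expectation

variable {κ : Measure ℝ} [IsProbabilityMeasure κ]

lemma ae_pi_mem_Icc (hκ : κ (Icc 0 cm) = 1) :
    ∀ᵐ c ∂(Measure.pi fun _ : E => κ), ∀ e, c e ∈ Icc 0 cm := by
  have h : ∀ᵐ x ∂κ, x ∈ Icc 0 cm := (prob_compl_eq_zero_iff measurableSet_Icc).2 hκ
  exact ae_all_iff.2 fun e => (Measure.quasiMeasurePreserving_eval (fun _ : E => κ) e).ae h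

lemma integrable_quadCost_selection (hκ : κ (Icc 0 cm) = 1) {v : (E → ℝ) → E → ℝ}
    (h0 : ∀ c e, 0 ≤ v c e) (hB : ∀ c e, v c e ≤ B) (hv : ∀ e, Measurable fun c => v c e) :
    Integrable (fun c => quadCost (v c) c) (Measure.pi fun _ : E => κ) := by
  have hmeas : Measurable fun c => quadCost (v c) c :=
    Finset.measurable_sum _ fun e _ => (measurable_pi_apply e).mul ((hv e).pow_const 2)
  refine Integrable.of_bound hmeas.aestronglyMeasurable (Fintype.card E * (cm * B ^ 2)) ?_
  filter_upwards [ae_pi_mem_Icc hκ] with c hc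
  rw [Real.norm_of_nonneg (quadCost_nonneg fun e => (hc e).1)]
  exact quadCost_le (h0 c) (hB c) hc

-- The bound on the fluctuations of each `f i` makes the choice of the best `i` in expectation
-- nearly as good as the best choice of `i` for each `ω`.
lemma exists_integral_le_of_forall_exists_le {Ω ι : Type*} [MeasurableSpace Ω] {μ : Measure Ω}
    [IsProbabilityMeasure μ] [Fintype ι] [Nonempty ι] {f : ι → Ω → ℝ} {g : Ω → ℝ} {D : ℝ}
    (hf : ∀ i, Integrable (f i) μ) (hg : Integrable g μ)
    (hD : ∀ i, ∫ ω, |f i ω - ∫ ω', f i ω' ∂μ| ∂μ ≤ D) (h : ∀ ω, ∃ i, f i ω ≤ g ω) :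
    ∃ i, ∫ ω, f i ω ∂μ ≤ ∫ ω, g ω ∂μ + Fintype.card ι * D := by
  obtain ⟨i, hi⟩ := Finite.exists_min fun i => ∫ ω, f i ω ∂μ
  have hdev : ∀ j, Integrable (fun ω => |f j ω - ∫ ω', f j ω' ∂μ|) μ := fun j =>
    ((hf j).sub (integrable_const _)).abs
  have hpointwise : ∀ ω, ∫ ω', f i ω' ∂μ ≤ g ω + ∑ j, |f j ω - ∫ ω', f j ω' ∂μ| := by
    intro ω
    obtain ⟨j, hj⟩ := h ω
    have hle := Finset.single_le_sum (f := fun j => |f j ω - ∫ ω', f j ω' ∂μ|)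
      (fun _ _ => abs_nonneg _) (Finset.mem_univ j)
    linarith [hi j, neg_abs_le (f j ω - ∫ ω', f j ω' ∂μ)]
  refine ⟨i, ?_⟩
  calc ∫ ω, f i ω ∂μ = ∫ _, ∫ ω', f i ω' ∂μ ∂μ := by simp
    _ ≤ ∫ ω, (g ω + ∑ j, |f j ω - ∫ ω', f j ω' ∂μ|) ∂μ :=
        integral_mono (integrable_const _)
          (hg.add (integrable_finsetSum _ fun j _ => hdev j)) hpointwise
    _ = ∫ ω, g ω ∂μ + ∑ j, ∫ ω, |f j ω - ∫ ω', f j ω' ∂μ| ∂μ := by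
        rw [integral_add hg (integrable_finsetSum _ fun j _ => hdev j),
          integral_finsetSum _ fun j _ => hdev j]
    _ ≤ ∫ ω, g ω ∂μ + ∑ _j : ι, D := by gcongr; exact hD _
    _ = ∫ ω, g ω ∂μ + Fintype.card ι * D := by simp

variable [Nonempty T]

lemma integrable_infCost (hκ : κ (Icc 0 cm) = 1) (h0 : ∀ t e, 0 ≤ vol t e)
    (hB : ∀ t e, vol t e ≤ B) : Integrable (infCost vol) (Measure.pi fun _ : E => κ) := by
  refine Integrable.of_bound (continuous_infCost h0 hB).aestronglyMeasurable
    (Fintype.card E * (cm * B ^ 2)) ?_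
  filter_upwards [ae_pi_mem_Icc hκ] with c hc
  rw [Real.norm_of_nonneg (infCost_nonneg fun e => (hc e).1)]
  exact infCost_le_card h0 hB hc

lemma hasBoundedDifferences_infCost_projIcc (hcm : 0 ≤ cm) (h0 : ∀ t e, 0 ≤ vol t e)
    (hB : ∀ t e, vol t e ≤ B) :
    HasBoundedDifferences (fun c : E → ℝ => infCost vol fun e => projIcc 0 cm hcm (c e))
      (cm * B ^ 2) := by
  intro c c' i hi
  have hosc : |(projIcc 0 cm hcm (c i) : ℝ) - projIcc 0 cm hcm (c' i)| ≤ cm := by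
    obtain ⟨h1, h2⟩ := (projIcc 0 cm hcm (c i)).2
    obtain ⟨h1', h2'⟩ := (projIcc 0 cm hcm (c' i)).2
    rw [abs_le]
    constructor <;> linarith
  refine (abs_infCost_sub_le h0 hB _ _).trans ?_
  rw [Finset.sum_eq_single i (fun j _ hj => by rw [hi j hj, sub_self, abs_zero]) (by simp),
    mul_comm]
  gcongr

-- The costs lie in `[0, cm]` almost surely, but bounded differences are needed everywhere:
-- truncate the environment.
lemma integral_abs_infCost_sub_le (hcm : 0 ≤ cm) (hκ : κ (Icc 0 cm) = 1)
    (h0 : ∀ t e, 0 ≤ vol t e) (hB : ∀ t e, vol t e ≤ B) :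
    ∫ c, |infCost vol c - ∫ c', infCost vol c' ∂(Measure.pi fun _ => κ)|
      ∂(Measure.pi fun _ : E => κ) ≤ (cm * B ^ 2) * √(Fintype.card E) := by
  let clip : (E → ℝ) → E → ℝ := fun c e => projIcc 0 cm hcm (c e)
  have hclip : ∀ c e, clip c e ∈ Icc 0 cm := fun c e => (projIcc 0 cm hcm (c e)).2
  have hmeas : Measurable clip := measurable_pi_lambda _ fun e =>
    ((continuous_subtype_val.comp continuous_projIcc).measurable).comp (measurable_pi_apply e)
  have hae : ∀ᵐ c ∂(Measure.pi fun _ : E => κ), infCost vol c = infCost vol (clip c) := by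
    filter_upwards [ae_pi_mem_Icc hκ] with c hc
    congr 1
    exact funext fun e => (congrArg Subtype.val (projIcc_of_mem hcm (hc e))).symm
  have hmean := integral_congr_ae hae
  calc _ = ∫ c, |infCost vol (clip c) - ∫ c', infCost vol (clip c') ∂(Measure.pi fun _ => κ)|
          ∂(Measure.pi fun _ : E => κ) := by
        refine integral_congr_ae ?_
        filter_upwards [hae] with c hc
        rw [hc, hmean]
    _ ≤ _ := integral_abs_sub_integral_le_of_hasBoundedDifferences κ (by positivity)
        ((continuous_infCost h0 hB).measurable.comp hmeas)
        (fun c => (abs_of_nonneg (infCost_nonneg fun e => (hclip c e).1)).trans_le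
          (infCost_le_card h0 hB (hclip c)))
        (hasBoundedDifferences_infCost_projIcc hcm h0 hB)

lemma exists_measurable_selection_integral_le (hκ : κ (Icc 0 cm) = 1) (h0 : ∀ t e, 0 ≤ vol t e)
    (hB : ∀ t e, vol t e ≤ B) {ε : ℝ} (hε : 0 < ε) :
    ∃ s : (E → ℝ) → T, (∀ e, Measurable fun c => vol (s c) e) ∧
      ∫ c, quadCost (vol (s c)) c ∂(Measure.pi fun _ => κ) ≤
        ∫ c, infCost vol c ∂(Measure.pi fun _ => κ) + ε := by
  obtain ⟨s, hmeas, hs⟩ := exists_measurable_selection h0 hB hε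
  have hint := integrable_infCost hκ h0 hB
  refine ⟨s, hmeas, ?_⟩
  calc _ ≤ ∫ c, (infCost vol c + ε) ∂(Measure.pi fun _ => κ) :=
        integral_mono (integrable_quadCost_selection hκ (fun _ => h0 _) (fun _ => hB _) hmeas)
          (hint.add (integrable_const ε)) hs
    _ = _ := by rw [integral_add hint (integrable_const ε)]; simp

theorem exists_selection_in_class (hcm : 0 ≤ cm) (hκ : κ (Icc 0 cm) = 1)
    (h0 : ∀ t e, 0 ≤ vol t e) (hB : ∀ t e, vol t e ≤ B) {ι : Type*} [Fintype ι] (pr : T → ι) :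
    ∃ s : (E → ℝ) → T, (∀ c c', pr (s c) = pr (s c')) ∧ (∀ e, Measurable fun c => vol (s c) e) ∧
      ∫ c, quadCost (vol (s c)) c ∂(Measure.pi fun _ => κ) ≤
        ∫ c, infCost vol c ∂(Measure.pi fun _ => κ) +
          Fintype.card ι * ((cm * B ^ 2) * √(Fintype.card E)) + 1 := by
  classical
  set ν : Measure (E → ℝ) := Measure.pi fun _ => κ
  have : Nonempty (range pr) := (range_nonempty pr).to_subtype
  let classVol (i : range pr) (t : {t // pr t = i}) : E → ℝ := vol t.1
  have hne : ∀ i : range pr, Nonempty {t // pr t = i} := by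
    rintro ⟨_, t, rfl⟩
    exact ⟨⟨t, rfl⟩⟩
  have hc0 : ∀ i t e, 0 ≤ classVol i t e := fun _ _ => h0 _
  have hcB : ∀ i t e, classVol i t e ≤ B := fun _ _ => hB _
  have hint := integrable_infCost hκ h0 hB
  obtain ⟨i, hi⟩ := exists_integral_le_of_forall_exists_le (μ := ν)
    (f := fun i => infCost (classVol i)) (g := fun c => infCost vol c + 1 / 2)
    (fun i => integrable_infCost hκ (hc0 i) (hcB i)) (hint.add (integrable_const _))
    (fun i => integral_abs_infCost_sub_le hcm hκ (hc0 i) (hcB i)) fun c => by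
      obtain ⟨t, ht⟩ := exists_quadCost_lt_infCost_add vol c one_half_pos
      exact ⟨⟨pr t, t, rfl⟩, (infCost_le (hc0 _) (hcB _) c ⟨t, rfl⟩).trans ht.le⟩
  obtain ⟨s, hmeas, hs⟩ :=
    exists_measurable_selection_integral_le hκ (hc0 i) (hcB i) one_half_pos
  refine ⟨fun c => (s c).1, fun c c' => (s c).2.trans (s c').2.symm, hmeas, hs.trans ?_⟩
  have hcard : Fintype.card (range pr) * ((cm * B ^ 2) * √(Fintype.card E)) ≤
      Fintype.card ι * ((cm * B ^ 2) * √(Fintype.card E)) := by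
    gcongr
    exact Fintype.card_subtype_le _
  rw [integral_add hint (integrable_const _)] at hi
  simp only [integral_const, probReal_univ, smul_eq_mul, one_mul] at hi
  linarith

end Expectation

end Selection

section Streams

variable {M : ℕ}

/-- The stream function, normalised to vanish at the origin and lifted to the quadrant of the
plane, of a flow `F` on the torus. Its increment across an edge is the flow through that edge; it
is path independent only if `F` is divergence-free, so the definition fixes the path that goes
along the first axis and then up. -/
def stream (F : Edge M → ℝ) (x y : ℕ) : ℝ :=
  ∑ t ∈ Finset.range y, F (false, ((x : ZMod M) - 1, (t : ZMod M))) -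
    ∑ t ∈ Finset.range x, F (true, ((t : ZMod M), -1))

lemma stream_sub (F F' : Edge M → ℝ) (x y : ℕ) :
    stream (fun e => F e - F' e) x y = stream F x y - stream F' x y := by
  unfold stream
  simp only [Finset.sum_sub_distrib]
  ring

lemma stream_succ_right (F : Edge M → ℝ) (x y : ℕ) :
    stream F x (y + 1) - stream F x y = F (false, ((x : ZMod M) - 1, (y : ZMod M))) := by
  unfold stream
  rw [Finset.sum_range_succ]
  ring

lemma stream_false (F : Edge M → ℝ) (x y : ℕ) :
    stream F (x + 1) (y + 1) - stream F (x + 1) y = F (false, ((x : ZMod M), (y : ZMod M))) := by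
  rw [stream_succ_right, Nat.cast_add, Nat.cast_one, add_sub_cancel_right]

lemma stream_succ_left_zero (F : Edge M → ℝ) (x : ℕ) :
    stream F x 0 - stream F (x + 1) 0 = F (true, ((x : ZMod M), -1)) := by
  unfold stream
  rw [Finset.sum_range_succ, Finset.sum_range_zero, Finset.sum_range_zero]
  ring

lemma stream_true {F : Edge M → ℝ} (hF : ∀ p, divergence F p = 0) (x y : ℕ) :
    stream F x (y + 1) - stream F (x + 1) (y + 1) = F (true, ((x : ZMod M), (y : ZMod M))) := by
  have hconserved : ∀ z : ℕ, F (false, ((x : ZMod M) - 1, (z : ZMod M))) -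
      F (false, ((x : ZMod M), (z : ZMod M))) =
      F (true, ((x : ZMod M), (z : ZMod M))) - F (true, ((x : ZMod M), (z : ZMod M) - 1)) := by
    intro z
    have h := hF ((x : ZMod M), (z : ZMod M))
    simp only [divergence] at h
    linarith
  induction y with
  | zero =>
    have h1 := stream_succ_right F x 0
    have h2 := stream_false F x 0
    have h3 := stream_succ_left_zero F x
    have h4 := hconserved 0
    simp only [Nat.cast_zero, zero_sub] at h1 h2 h4 ⊢
    linarith
  | succ y ih =>
    have h1 := stream_succ_right F x (y + 1)
    have h2 := stream_false F x (y + 1)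
    have h4 := hconserved (y + 1)
    simp only [Nat.cast_add, Nat.cast_one, add_sub_cancel_right] at h1 h2 h4 ⊢
    linarith

section Bounds

variable {F : Edge M → ℝ} {b : ℝ}

lemma abs_stream_le (hb : ∀ e, |F e| ≤ b) (x y : ℕ) : |stream F x y| ≤ b * (x + y) := by
  have hsum : ∀ (n : ℕ) (f : ℕ → Edge M), |∑ t ∈ Finset.range n, F (f t)| ≤ b * n := fun n f => by
    refine (Finset.abs_sum_le_sum_abs _ _).trans ((Finset.sum_le_sum fun t _ => hb (f t)).trans ?_)
    simp [mul_comm]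
  calc |stream F x y| ≤ b * y + b * x := (abs_sub _ _).trans (add_le_add (hsum _ _) (hsum _ _))
    _ = b * (x + y) := by ring

lemma abs_add_sub_le_of_abs_succ_sub_le {f : ℕ → ℝ} (h : ∀ n, |f (n + 1) - f n| ≤ b) (m k : ℕ) :
    |f (m + k) - f m| ≤ b * k := by
  have hsum := dist_le_range_sum_of_dist_le (f := fun k => f (m + k)) (d := fun _ => b) k
    fun {i} _ => by rw [dist_comm]; exact h (m + i)
  rw [dist_comm] at hsum
  simpa [Real.dist_eq, mul_comm] using hsum

lemma abs_stream_sub_le (hF : ∀ p, divergence F p = 0) (hb : ∀ e, |F e| ≤ b) (x y k m : ℕ) :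
    |stream F (x + k) (y + m) - stream F x y| ≤ b * (k + m) := by
  have hup : |stream F (x + k) (y + m) - stream F (x + k) y| ≤ b * m :=
    abs_add_sub_le_of_abs_succ_sub_le (f := fun y => stream F (x + k) y)
      (fun n => by rw [stream_succ_right]; exact hb _) y m
  have hright : |stream F (x + k) y - stream F x y| ≤ b * k := by
    refine abs_add_sub_le_of_abs_succ_sub_le (f := fun x => stream F x y) (fun n => ?_) x k
    rw [abs_sub_comm]
    cases y with
    | zero => rw [stream_succ_left_zero]; exact hb _
    | succ y => rw [stream_true hF]; exact hb _
  calc _ ≤ b * m + b * k := (abs_sub_le _ _ _).trans (add_le_add hup hright)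
    _ = b * (k + m) := by ring

lemma abs_stream_le_of_abs_stream_mul_le (hF : ∀ p, divergence F p = 0) (hb : ∀ e, |F e| ≤ b)
    {R x y : ℕ} (hR : 0 < R) {δ : ℝ} (hδ : |stream F (x / R * R) (y / R * R)| ≤ δ) :
    |stream F x y| ≤ 2 * b * R + δ := by
  have hb0 : 0 ≤ b := (abs_nonneg _).trans (hb (false, 0))
  have hx : ((x % R : ℕ) : ℝ) ≤ R := by exact_mod_cast (Nat.mod_lt _ hR).le
  have hy : ((y % R : ℕ) : ℝ) ≤ R := by exact_mod_cast (Nat.mod_lt _ hR).le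
  have h := abs_stream_sub_le hF hb (x / R * R) (y / R * R) (x % R) (y % R)
  rw [Nat.div_add_mod', Nat.div_add_mod'] at h
  calc |stream F x y|
      ≤ |stream F x y - stream F (x / R * R) (y / R * R)| +
          |stream F (x / R * R) (y / R * R)| := by
        linarith [abs_sub_abs_le_abs_sub (stream F x y) (stream F (x / R * R) (y / R * R))]
    _ ≤ b * (R + R) + δ := add_le_add (h.trans (by gcongr)) hδ
    _ = 2 * b * R + δ := by ring

end Bounds

end Streams

section Classes

lemma exists_classification_of_totallyBounded {Y : Type*} [PseudoMetricSpace Y] {s : Set Y}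
    (hs : TotallyBounded s) {ε : ℝ} (hε : 0 < ε) :
    ∃ n : ℕ, ∀ {T : Type*} (f : T → Y), (∀ t, f t ∈ s) →
      ∃ pr : T → Fin n, ∀ t t', pr t = pr t' → dist (f t) (f t') < ε := by
  obtain ⟨A, hA, hcover⟩ := Metric.totallyBounded_iff.1 hs (ε / 2) (half_pos hε)
  have := hA.fintype
  let φ := Fintype.equivFin A
  refine ⟨Fintype.card A, fun f hf => ?_⟩
  have hcenter : ∀ t, ∃ a : A, dist (f t) a < ε / 2 := fun t => by
    obtain ⟨a, ha, hta⟩ := mem_iUnion₂.1 (hcover (hf t))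
    exact ⟨⟨a, ha⟩, hta⟩
  choose a ha using hcenter
  refine ⟨φ ∘ a, fun t t' h => ?_⟩
  have h' := ha t'
  rw [← φ.injective h] at h'
  linarith [dist_triangle_right (f t) (f t') (a t), ha t]

lemma exists_lt_mul_le_two_mul {Q M : ℕ} (hQ : 0 < Q) (hQM : Q ≤ M) :
    ∃ R, 0 < R ∧ M < Q * R ∧ Q * R ≤ 2 * M := by
  refine ⟨M / Q + 1, Nat.succ_pos _, Nat.lt_mul_div_succ M hQ, ?_⟩
  have := Nat.mul_div_le M Q
  lia

variable {M : ℕ}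

lemma abs_le_totalVolume {ι κ : Type*} [Fintype ι] [Fintype κ] (F : ι → κ → Edge M → ℝ) (i : ι)
    (j : κ) (e : Edge M) : |F i j e| ≤ totalVolume F e :=
  (Finset.single_le_sum (f := fun j => |F i j e|) (fun _ _ => abs_nonneg _)
    (Finset.mem_univ j)).trans
    (Finset.single_le_sum (f := fun i => ∑ j, |F i j e|)
      (fun _ _ => Finset.sum_nonneg fun _ _ => abs_nonneg _) (Finset.mem_univ i))

/-- The values of the stream functions of a family of flows at the points of mesh `R` in a square
of the plane, divided by the side `M` of the torus: a vector whose dimension does not depend on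
`M`. -/
def streamSample {I : Type*} (K R : ℕ) (F : I → I → Edge M → ℝ) : I × I × Fin K × Fin K → ℝ :=
  fun z => stream (F z.1 z.2.1) (z.2.2.1 * R) (z.2.2.2 * R) / M

variable {I : Type*} [Fintype I] {B : ℝ}

lemma streamSample_mem_closedBall (hM : 0 < M) {Q R : ℕ} (hB : 0 ≤ B) (hMR : M < Q * R)
    (hRM : Q * R ≤ 2 * M) {F : I → I → Edge M → ℝ} (hF : ∀ e, totalVolume F e ≤ B) :
    streamSample (2 * Q + 3) R F ∈ Metric.closedBall 0 (16 * B) := by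
  have hcoord : ∀ p : Fin (2 * Q + 3), ((p * R : ℕ) : ℝ) ≤ 8 * M := fun p => by
    have hQ : 0 < Q := pos_of_mul_pos_left (Nat.zero_lt_of_lt hMR) (Nat.zero_le R)
    have hp : (p : ℕ) * R ≤ (2 * Q + 2) * R := Nat.mul_le_mul_right _ (by lia)
    have hle : (2 * Q + 2) * R ≤ 8 * M := by nlinarith
    exact_mod_cast hp.trans hle
  rw [mem_closedBall_zero_iff, pi_norm_le_iff_of_nonneg (by positivity)]
  rintro ⟨i, j, p, q⟩
  simp only [streamSample, Real.norm_eq_abs, abs_div, Nat.abs_cast]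
  rw [div_le_iff₀ (by exact_mod_cast hM)]
  calc _ ≤ B * ((p * R : ℕ) + (q * R : ℕ)) :=
        abs_stream_le (fun e => (abs_le_totalVolume F i j e).trans (hF e)) _ _
    _ ≤ B * (8 * M + 8 * M) := by gcongr <;> exact hcoord _
    _ = 16 * B * M := by ring

lemma abs_stream_sub_le_of_dist_streamSample (hM : 0 < M) {Q R : ℕ} (hR : 0 < R)
    (hMR : M < Q * R) {F F' : I → I → Edge M → ℝ} (hF : ∀ e, totalVolume F e ≤ B)
    (hF' : ∀ e, totalVolume F' e ≤ B)
    (hdiv : ∀ i j p, divergence (F i j) p = divergence (F' i j) p) {δ : ℝ}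
    (hδ : dist (streamSample (2 * Q + 3) R F) (streamSample (2 * Q + 3) R F') ≤ δ)
    (i j : I) {x y : ℕ} (hx : x ≤ 2 * M + 1) (hy : y ≤ 2 * M + 1) :
    |stream (fun e => F i j e - F' i j e) x y| ≤ 4 * B * R + δ * M := by
  have hlt : ∀ {x}, x ≤ 2 * M + 1 → x / R < 2 * Q + 3 := fun hx => by
    rw [Nat.div_lt_iff_lt_mul hR]
    nlinarith
  have hentry := (dist_le_pi_dist (streamSample (2 * Q + 3) R F) (streamSample (2 * Q + 3) R F')
    (i, j, ⟨x / R, hlt hx⟩, ⟨y / R, hlt hy⟩)).trans hδ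
  simp only [streamSample, Real.dist_eq, ← sub_div, ← stream_sub, abs_div, Nat.abs_cast]
    at hentry
  rw [div_le_iff₀ (by exact_mod_cast hM)] at hentry
  have hbound : ∀ e, |F i j e - F' i j e| ≤ 2 * B := fun e => by
    linarith [abs_sub (F i j e) (F' i j e), (abs_le_totalVolume F i j e).trans (hF e),
      (abs_le_totalVolume F' i j e).trans (hF' e)]
  have hfree : ∀ p, divergence (fun e => F i j e - F' i j e) p = 0 := fun p => by
    rw [divergence_sub, hdiv, sub_self]
  linarith [abs_stream_le_of_abs_stream_mul_le hfree hbound hR hentry]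

theorem exists_classification_of_stream (I : Type*) [Fintype I] {η : ℝ} (hB : 0 ≤ B)
    (hη : 0 < η) :
    ∃ n M₀ : ℕ, ∀ M, M₀ ≤ M → ∀ (T : Type*) (Φ : T → I → I → Edge M → ℝ),
      (∀ t e, totalVolume (Φ t) e ≤ B) →
      (∀ t t' i j p, divergence (Φ t i j) p = divergence (Φ t' i j) p) →
      ∃ pr : T → Fin n, ∀ t t', pr t = pr t' → ∀ i j x y, x ≤ 2 * M + 1 → y ≤ 2 * M + 1 →
        |stream (fun e => Φ t i j e - Φ t' i j e) x y| ≤ η * M := by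
  obtain ⟨Q, hQ⟩ := exists_nat_gt (16 * B / η)
  have hQ0 : 0 < Q := by exact_mod_cast (by positivity : 0 ≤ 16 * B / η).trans_lt hQ
  obtain ⟨n, hn⟩ := exists_classification_of_totallyBounded (ε := η / 2)
    (isCompact_closedBall (0 : I × I × Fin (2 * Q + 3) × Fin (2 * Q + 3) → ℝ)
      (16 * B)).totallyBounded (half_pos hη)
  refine ⟨n, Q, fun M hQM T Φ hvol hdiv => ?_⟩
  have hM : 0 < M := hQ0.trans_le hQM
  obtain ⟨R, hR, hMR, hRM⟩ := exists_lt_mul_le_two_mul hQ0 hQM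
  obtain ⟨pr, hpr⟩ := hn (fun t => streamSample (2 * Q + 3) R (Φ t)) fun t =>
    streamSample_mem_closedBall hM hB hMR hRM (hvol t)
  have hmesh : 4 * B * R ≤ η / 2 * M := by
    have hRM' : (Q : ℝ) * R ≤ 2 * M := by exact_mod_cast hRM
    rw [div_lt_iff₀ hη] at hQ
    calc 4 * B * R = 16 * B * R / 4 := by ring
      _ ≤ Q * η * R / 4 := by gcongr
      _ = η * (Q * R) / 4 := by ring
      _ ≤ η * (2 * M) / 4 := by gcongr
      _ = η / 2 * M := by ring
  refine ⟨pr, fun t t' h i j x y hx hy => ?_⟩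
  linarith [abs_stream_sub_le_of_dist_streamSample hM hR hMR (hvol t) (hvol t') (hdiv t t')
    (hpr t t' h).le i j hx hy]

end Classes

section CoarseFlows

variable {M : ℕ} [NeZero M] {I : Type*} [DecidableEq I]

/-- The number of vertices in a class `i` of the partition of the torus given by `l`. -/
def classSize (l : Vertex M → I) (i : I) : ℝ := ∑ p, if l p = i then 1 else 0

/-- A family of flows between the classes of a partition of the torus, in which each pair of
vertices contributes `M⁻³`. -/
def IsCoarseFlow (l : Vertex M → I) (F : I → I → Edge M → ℝ) : Prop :=
  ∀ i j p, divergence (F i j) p = ((M : ℝ) ^ 3)⁻¹ *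
    (classSize l j * (if l p = i then 1 else 0) - classSize l i * (if l p = j then 1 else 0))

/-- The sums of the members of a family of flows over all pairs of vertices in given classes. -/
def coarsening (l : Vertex M → I) (G : Vertex M → Vertex M → Edge M → ℝ) : I → I → Edge M → ℝ :=
  fun i j e => ∑ v, ∑ w, (if l v = i then 1 else 0) * (if l w = j then 1 else 0) * G v w e

lemma isCoarseFlow_coarsening (l : Vertex M → I) {G : Vertex M → Vertex M → Edge M → ℝ}
    (hG : IsMultiflow G) : IsCoarseFlow l (coarsening l G) := by
  intro i j p
  have hsplit : ∀ v w : Vertex M, (if l v = i then (1 : ℝ) else 0) * (if l w = j then 1 else 0) *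
      (((M : ℝ) ^ 3)⁻¹ * ((if p = v then 1 else 0) - (if p = w then 1 else 0))) =
      ((M : ℝ) ^ 3)⁻¹ * ((if p = v then (if l v = i then 1 else 0) else 0) *
        (if l w = j then 1 else 0) - (if l v = i then 1 else 0) *
        (if p = w then (if l w = j then 1 else 0) else 0)) := by
    intro v w
    split_ifs <;> ring
  unfold coarsening
  rw [divergence_sum]
  simp only [divergence_sum, divergence_mul, hG _ _ p, hsplit, ← Finset.mul_sum,
    Finset.sum_sub_distrib, ← Finset.sum_mul, Finset.sum_ite_eq, Finset.mem_univ, if_true,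
    classSize]
  ring

lemma totalVolume_coarsening_le [Fintype I] (l : Vertex M → I)
    (G : Vertex M → Vertex M → Edge M → ℝ) (e : Edge M) :
    totalVolume (coarsening l G) e ≤ totalVolume G e := by
  calc totalVolume (coarsening l G) e ≤ ∑ i, ∑ j, ∑ v, ∑ w,
        (if l v = i then 1 else 0) * (if l w = j then 1 else 0) * |G v w e| := by
        refine Finset.sum_le_sum fun i _ => Finset.sum_le_sum fun j _ => ?_
        refine (Finset.abs_sum_le_sum_abs _ _).trans (Finset.sum_le_sum fun v _ => ?_)
        refine (Finset.abs_sum_le_sum_abs _ _).trans (Finset.sum_le_sum fun w _ => ?_)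
        rw [abs_mul, abs_of_nonneg (by positivity :
          (0 : ℝ) ≤ (if l v = i then 1 else 0) * (if l w = j then 1 else 0))]
    _ = ∑ v, ∑ w, ∑ i, ∑ j,
        (if l v = i then 1 else 0) * (if l w = j then 1 else 0) * |G v w e| := by
        rw [Finset.sum_congr rfl fun i _ => Finset.sum_comm, Finset.sum_comm]
        refine Finset.sum_congr rfl fun v _ => ?_
        rw [Finset.sum_congr rfl fun i _ => Finset.sum_comm, Finset.sum_comm]
    _ = totalVolume G e := by
        simp only [← Finset.sum_mul, ← Finset.mul_sum, Finset.sum_ite_eq, Finset.mem_univ,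
          if_true, one_mul, totalVolume]

end CoarseFlows

section Rescaling

variable {M N : ℕ}

/-- The vertex of the `M`-cycle below a vertex of the `N`-cycle. -/
def scaledPos (M : ℕ) {N : ℕ} (X : ZMod N) : ℕ := X.val * M / N

/-- Pull-back of a function on the vertices of the `M`-cycle to the vertices of the `N`-cycle: the
vertex `X` is blown up to an interval of `M` points of a cycle of length `M * N`, over which the
values at the points below are averaged. -/
def vertexAvg (f : ZMod M → ℝ) (X : ZMod N) : ℝ :=
  (M : ℝ)⁻¹ * ∑ t ∈ Finset.range M, f ((X.val * M + t) / N : ℕ)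

/-- Pull-back of a function on the edges of the `M`-cycle to the edges of the `N`-cycle, averaging
over the `N` translates of the right end of `X`; an edge is named by its left end, which accounts
for the `- 1`. -/
def edgeAvg (f : ZMod M → ℝ) (X : ZMod N) : ℝ :=
  (N : ℝ)⁻¹ * ∑ t ∈ Finset.range N, f ((((X.val + 1) * M + t) / N : ℕ) - 1)

/-- Pull-back of a flow on the `M`-torus to the `N`-torus. -/
def rescale (φ : Edge M → ℝ) (e : Edge N) : ℝ :=
  if e.1 then vertexAvg (fun a => edgeAvg (fun b => φ (true, (a, b))) e.2.2) e.2.1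
  else edgeAvg (fun a => vertexAvg (fun b => φ (false, (a, b))) e.2.2) e.2.1

/-- Pull-back of a function on the vertices of the `M`-torus to the `N`-torus. -/
def torusAvg (g : Vertex M → ℝ) (X : Vertex N) : ℝ :=
  vertexAvg (fun a => vertexAvg (fun b => g (a, b)) X.2) X.1

section Linearity

lemma vertexAvg_sum {ι : Type*} (s : Finset ι) (f : ι → ZMod M → ℝ) (X : ZMod N) :
    vertexAvg (fun m => ∑ i ∈ s, f i m) X = ∑ i ∈ s, vertexAvg (f i) X := by
  unfold vertexAvg
  rw [Finset.sum_comm, Finset.mul_sum]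

lemma vertexAvg_mul (a : ℝ) (f : ZMod M → ℝ) (X : ZMod N) :
    vertexAvg (fun m => a * f m) X = a * vertexAvg f X := by
  unfold vertexAvg
  rw [← Finset.mul_sum]
  ring

lemma vertexAvg_add (f g : ZMod M → ℝ) (X : ZMod N) :
    vertexAvg (fun m => f m + g m) X = vertexAvg f X + vertexAvg g X := by
  unfold vertexAvg
  rw [Finset.sum_add_distrib, mul_add]

lemma vertexAvg_sub (f g : ZMod M → ℝ) (X : ZMod N) :
    vertexAvg (fun m => f m - g m) X = vertexAvg f X - vertexAvg g X := by
  unfold vertexAvg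
  rw [Finset.sum_sub_distrib, mul_sub]

lemma vertexAvg_nonneg {f : ZMod M → ℝ} (hf : ∀ m, 0 ≤ f m) (X : ZMod N) : 0 ≤ vertexAvg f X :=
  mul_nonneg (by positivity) (Finset.sum_nonneg fun _ _ => hf _)

lemma exists_of_vertexAvg_ne_zero {f : ZMod M → ℝ} {X : ZMod N} (h : vertexAvg f X ≠ 0) :
    ∃ t < M, f ((X.val * M + t) / N : ℕ) ≠ 0 := by
  by_contra! hc
  exact h (by rw [vertexAvg, Finset.sum_eq_zero fun t ht => hc t (Finset.mem_range.1 ht), mul_zero])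

lemma vertexAvg_const [NeZero M] (c : ℝ) (X : ZMod N) : vertexAvg (fun _ : ZMod M => c) X = c := by
  have : (M : ℝ) ≠ 0 := NeZero.ne _
  simp only [vertexAvg, Finset.sum_const, Finset.card_range, nsmul_eq_mul]
  field_simp

lemma torusAvg_sub (g h : Vertex M → ℝ) (X : Vertex N) :
    torusAvg (fun p => g p - h p) X = torusAvg g X - torusAvg h X := by
  unfold torusAvg
  simp only [vertexAvg_sub]

lemma torusAvg_mul (a : ℝ) (g : Vertex M → ℝ) (X : Vertex N) :
    torusAvg (fun p => a * g p) X = a * torusAvg g X := by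
  unfold torusAvg
  simp only [vertexAvg_mul]

lemma torusAvg_sum {ι : Type*} (s : Finset ι) (g : ι → Vertex M → ℝ) (X : Vertex N) :
    torusAvg (fun p => ∑ i ∈ s, g i p) X = ∑ i ∈ s, torusAvg (g i) X := by
  unfold torusAvg
  simp only [vertexAvg_sum]

lemma torusAvg_one [NeZero M] (X : Vertex N) : torusAvg (fun _ : Vertex M => 1) X = 1 := by
  unfold torusAvg
  simp only [vertexAvg_const]

lemma torusAvg_nonneg {g : Vertex M → ℝ} (hg : ∀ p, 0 ≤ g p) (X : Vertex N) : 0 ≤ torusAvg g X :=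
  vertexAvg_nonneg (fun _ => vertexAvg_nonneg (fun _ => hg _) _) _

lemma exists_of_torusAvg_ne_zero {g : Vertex M → ℝ} {X : Vertex N} (h : torusAvg g X ≠ 0) :
    ∃ s < M, ∃ t < M,
      g (((X.1.val * M + s) / N : ℕ), ((X.2.val * M + t) / N : ℕ)) ≠ 0 := by
  obtain ⟨s, hs, h⟩ := exists_of_vertexAvg_ne_zero h
  obtain ⟨t, ht, h⟩ := exists_of_vertexAvg_ne_zero h
  exact ⟨s, hs, t, ht, h⟩

end Linearity

section Sums

lemma sum_range_mul (h : ℕ → ℝ) (a b : ℕ) :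
    ∑ s ∈ Finset.range (a * b), h s =
      ∑ i ∈ Finset.range a, ∑ j ∈ Finset.range b, h (i * b + j) := by
  induction a with
  | zero => simp
  | succ a ih => rw [add_one_mul, Finset.sum_range_add, ih, Finset.sum_range_succ]

lemma sum_range_add_sub_sum_range (g : ℕ → ℝ) (m n : ℕ) :
    ∑ t ∈ Finset.range n, g (m + t) - ∑ t ∈ Finset.range n, g t =
      ∑ t ∈ Finset.range m, g (n + t) - ∑ t ∈ Finset.range m, g t := by
  have h1 := Finset.sum_range_add g m n
  have h2 := Finset.sum_range_add g n m
  rw [add_comm m n] at h1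
  linarith

variable [NeZero N]

lemma sum_zmod (g : ℕ → ℝ) : ∑ X : ZMod N, g X.val = ∑ n ∈ Finset.range N, g n := by
  obtain ⟨n, rfl⟩ := Nat.exists_eq_succ_of_ne_zero (NeZero.ne N)
  exact Fin.sum_univ_eq_sum_range g (n + 1)

lemma sum_vertexAvg [NeZero M] (f : ZMod M → ℝ) :
    ∑ X : ZMod N, vertexAvg f X = N / M * ∑ m, f m := by
  have hblock : ∀ i, ∑ j ∈ Finset.range N, f ((i * N + j) / N : ℕ) = N * f (i : ℕ) := by
    intro i
    have hconst : ∀ j ∈ Finset.range N, f ((i * N + j) / N : ℕ) = f (i : ℕ) := by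
      intro j hj
      rw [mul_comm, Nat.mul_add_div (NeZero.pos N), Nat.div_eq_of_lt (Finset.mem_range.1 hj),
        add_zero]
    rw [Finset.sum_congr rfl hconst, Finset.sum_const, Finset.card_range, nsmul_eq_mul]
  have hsum : ∑ m : ZMod M, f m = ∑ n ∈ Finset.range M, f (n : ℕ) := by
    rw [← sum_zmod fun n => f (n : ℕ)]
    simp
  unfold vertexAvg
  rw [← Finset.mul_sum, sum_zmod (fun x => ∑ t ∈ Finset.range M, f ((x * M + t) / N : ℕ)),
    ← sum_range_mul (fun s => f (s / N : ℕ)), mul_comm N M, sum_range_mul]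
  simp only [hblock, ← Finset.mul_sum, hsum]
  ring

lemma sum_torusAvg [NeZero M] (g : Vertex M → ℝ) :
    ∑ X : Vertex N, torusAvg g X = (N / M) ^ 2 * ∑ p, g p := by
  unfold torusAvg
  rw [Fintype.sum_prod_type]
  simp only [← vertexAvg_sum, sum_vertexAvg, vertexAvg_mul, ← Finset.mul_sum]
  rw [Fintype.sum_prod_type]
  ring

end Sums

section Divergence

variable [NeZero N]

lemma cast_val_mul_div (n a : ℕ) :
    ((((n : ZMod N).val * M + a) / N : ℕ) : ZMod M) = ((n * M + a) / N : ℕ) := by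
  have h : n * M + a = (n % N) * M + a + N * (M * (n / N)) := by
    conv_lhs => rw [← Nat.mod_add_div n N]
    ring
  rw [ZMod.val_natCast, h, Nat.add_mul_div_left _ _ (NeZero.pos N)]
  simp

lemma scaledPos_natCast (n : ℕ) : ((scaledPos M (n : ZMod N) : ℕ) : ZMod M) = (n * M / N : ℕ) :=
  cast_val_mul_div n 0

lemma vertexAvg_natCast (f : ZMod M → ℝ) (n : ℕ) : vertexAvg f (n : ZMod N) =
    (M : ℝ)⁻¹ * ∑ t ∈ Finset.range M, f ((n * M + t) / N : ℕ) := by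
  unfold vertexAvg
  simp only [cast_val_mul_div]

lemma edgeAvg_natCast (f : ZMod M → ℝ) (n : ℕ) : edgeAvg f (n : ZMod N) =
    (N : ℝ)⁻¹ * ∑ t ∈ Finset.range N, f ((((n + 1) * M + t) / N : ℕ) - 1) := by
  unfold edgeAvg
  simp only [add_one_mul, add_assoc, cast_val_mul_div]

variable [NeZero M]

lemma edgeAvg_sub (f : ZMod M → ℝ) (X : ZMod N) :
    edgeAvg f X - edgeAvg f (X - 1) = M / N * vertexAvg (fun m => f m - f (m - 1)) X := by
  obtain ⟨n, rfl⟩ : ∃ n : ℕ, X = (n + 1 : ℕ) :=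
    ⟨X.val + (N - 1), by rw [add_assoc, Nat.sub_add_cancel (NeZero.pos N)]; simp⟩
  have hpred : ((n + 1 : ℕ) : ZMod N) - 1 = (n : ℕ) := by simp
  have hM : (M : ℝ) ≠ 0 := NeZero.ne _
  set g : ℕ → ℝ := fun s => f ((((n + 1) * M + s) / N : ℕ) - 1) with hg
  have hedge : ∀ t, f ((((n + 1 + 1) * M + t) / N : ℕ) - 1) = g (M + t) := fun t => by
    simp only [hg]
    rw [show (n + 1) * M + (M + t) = (n + 1 + 1) * M + t by ring]
  have hvertex : ∀ t, f (((n + 1) * M + t) / N : ℕ) = g (N + t) := fun t => by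
    simp only [hg]
    rw [show (n + 1) * M + (N + t) = (n + 1) * M + t + N by ring,
      Nat.add_div_right _ (NeZero.pos N), Nat.cast_succ, add_sub_cancel_right]
  have hbase : ∀ t, f ((((n + 1) * M + t) / N : ℕ) - 1) = g t := fun _ => rfl
  rw [hpred, edgeAvg_natCast, edgeAvg_natCast, vertexAvg_natCast, ← mul_sub]
  simp only [hedge, hvertex, hbase, Finset.sum_sub_distrib]
  rw [sum_range_add_sub_sum_range]
  field_simp

lemma divergence_rescale (φ : Edge M → ℝ) (X : Vertex N) :
    divergence (rescale φ) X = M / N * torusAvg (divergence φ) X := by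
  unfold divergence torusAvg rescale
  simp only [if_true, Bool.false_eq_true, if_false]
  rw [edgeAvg_sub, ← vertexAvg_sub]
  simp only [edgeAvg_sub, ← vertexAvg_sub, vertexAvg_mul]
  rw [← mul_add, ← vertexAvg_add]
  simp only [← vertexAvg_add]

end Divergence

section Approximation

variable [NeZero N]

lemma abs_avg_sub_le {n : ℕ} [NeZero n] {f : ℕ → ℝ} {c ε : ℝ} (h : ∀ t < n, |f t - c| ≤ ε) :
    |(n : ℝ)⁻¹ * ∑ t ∈ Finset.range n, f t - c| ≤ ε := by
  have hn : (0 : ℝ) < n := by exact_mod_cast NeZero.pos n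
  have hconst : ∀ a : ℝ, (n : ℝ)⁻¹ * ∑ _t ∈ Finset.range n, a = a := fun a => by
    rw [Finset.sum_const, Finset.card_range, nsmul_eq_mul, inv_mul_cancel_left₀ hn.ne']
  calc |(n : ℝ)⁻¹ * ∑ t ∈ Finset.range n, f t - c|
      = (n : ℝ)⁻¹ * |∑ t ∈ Finset.range n, (f t - c)| := by
        nth_rw 1 [← hconst c]
        rw [← mul_sub, ← Finset.sum_sub_distrib, abs_mul, abs_of_pos (inv_pos.2 hn)]
    _ ≤ (n : ℝ)⁻¹ * ∑ _t ∈ Finset.range n, ε := by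
        gcongr
        exact (Finset.abs_sum_le_sum_abs _ _).trans
          (Finset.sum_le_sum fun t ht => h t (Finset.mem_range.1 ht))
    _ = ε := hconst ε

lemma abs_edgeAvg_sub_le (hMN : M ≤ N) {f : ZMod M → ℝ} {c ε : ℝ} {X : ZMod N}
    (h : ∀ m : ℕ, m ≤ scaledPos M X + 2 → scaledPos M X ≤ m → |f ((m : ZMod M) - 1) - c| ≤ ε) :
    |edgeAvg f X - c| ≤ ε := by
  refine abs_avg_sub_le fun t ht => h _ ?_ (Nat.div_le_div_right (by rw [add_one_mul]; lia))
  calc ((X.val + 1) * M + t) / N ≤ (X.val * M + N + N) / N :=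
        Nat.div_le_div_right (by rw [add_one_mul]; lia)
    _ = scaledPos M X + 2 := by
        rw [Nat.add_div_right _ (NeZero.pos N), Nat.add_div_right _ (NeZero.pos N), scaledPos]

lemma abs_vertexAvg_sub_le [NeZero M] (hMN : M ≤ N) {f : ZMod M → ℝ} {c ε : ℝ} {X : ZMod N}
    (h : ∀ m : ℕ, m ≤ scaledPos M X + 2 → scaledPos M X ≤ m → |f ((m : ZMod M) - 1) - c| ≤ ε) :
    |vertexAvg f X - c| ≤ ε := by
  refine abs_avg_sub_le fun t ht => ?_
  have hlower : X.val * M / N ≤ (X.val * M + t) / N := Nat.div_le_div_right (by lia)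
  have hupper : (X.val * M + t) / N ≤ X.val * M / N + 1 := by
    rw [← Nat.add_div_right _ (NeZero.pos N)]
    exact Nat.div_le_div_right (by lia)
  simpa using h ((X.val * M + t) / N + 1) (by unfold scaledPos; lia) (by unfold scaledPos; lia)

end Approximation

end Rescaling

section Windows

section Sums

lemma exists_sum_mul_sub_eq {δ : ℕ → ℕ} (hδ : Monotone δ) (hδ1 : ∀ y, δ y ≤ 1) (g : ℕ → ℝ)
    (L : ℕ) :
    ∃ k, ∑ y ∈ Finset.range L, (δ y : ℝ) * (g (y + 1) - g y) = g L - g k := by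
  induction L with
  | zero => exact ⟨0, by simp⟩
  | succ L ih =>
    rcases Nat.eq_zero_or_pos (δ L) with hzero | hpos
    · refine ⟨L + 1, ?_⟩
      rw [sub_self]
      refine Finset.sum_eq_zero fun y hy => ?_
      have hy0 : δ y = 0 := Nat.le_zero.1 (hzero ▸ hδ (Finset.mem_range_succ_iff.1 hy))
      simp [hy0]
    · obtain ⟨k, hk⟩ := ih
      refine ⟨k, ?_⟩
      rw [Finset.sum_range_succ, hk, show δ L = 1 from le_antisymm (hδ1 L) hpos]
      push_cast
      ring

lemma abs_sum_sub_shift_le {h : ℕ → ℝ} {c : ℝ} {L : ℕ} (h0 : |h 0| ≤ c) (hL : |h L| ≤ c) :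
    |∑ y ∈ Finset.range L, h y - ∑ y ∈ Finset.range L, h (y + 1)| ≤ 2 * c := by
  rw [← Finset.sum_sub_distrib, Finset.sum_range_sub']
  exact (abs_sub _ _).trans (by linarith)

variable {M : ℕ} {f : ZMod M → ℝ} {b : ℝ}

lemma abs_sum_sub_sum_add_one_le (hf : ∀ m, |f m| ≤ b) (L : ℕ) (a : ZMod M) :
    |∑ y ∈ Finset.range L, f (a + (y : ℕ)) - ∑ y ∈ Finset.range L, f (a + 1 + (y : ℕ))| ≤
      2 * b := by
  have hstep : ∀ y : ℕ, a + 1 + (y : ZMod M) = a + ((y + 1 : ℕ) : ZMod M) := fun y => by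
    push_cast
    ring
  simp only [hstep]
  exact abs_sum_sub_shift_le (h := fun y : ℕ => f (a + (y : ℕ))) (hf _) (hf _)

lemma abs_sum_pred_sub_sum_le (hf : ∀ m, |f m| ≤ b) (L : ℕ) {x m : ℕ} (hxm : x ≤ m)
    (hmx : m ≤ x + 2) :
    |∑ y ∈ Finset.range L, f ((m : ZMod M) - 1 + (y : ℕ)) -
      ∑ y ∈ Finset.range L, f ((x : ZMod M) + (y : ℕ))| ≤ 2 * b := by
  obtain rfl | rfl | rfl : m = x ∨ m = x + 1 ∨ m = x + 2 := by omega
  · simpa only [sub_add_cancel] using abs_sum_sub_sum_add_one_le hf L ((m : ZMod M) - 1)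
  · simpa using (abs_nonneg _).trans (hf 0)
  · have hpred : ((x + 2 : ℕ) : ZMod M) - 1 = x + 1 := by
      push_cast
      ring
    rw [hpred, abs_sub_comm]
    exact abs_sum_sub_sum_add_one_le hf L x

lemma abs_sum_sub_sum_sub_switch_le (hf : ∀ m, |f m| ≤ b) {δ : ℕ → ℕ} (hδ : Monotone δ)
    (hδ1 : ∀ y, δ y ≤ 1) (L : ℕ) (a : ZMod M) :
    |∑ y ∈ Finset.range L, f (a + (y : ℕ)) -
      ∑ y ∈ Finset.range L, f (a - (δ y : ℕ) + (y : ℕ))| ≤ 2 * b := by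
  obtain ⟨k, hk⟩ := exists_sum_mul_sub_eq hδ hδ1 (fun y : ℕ => f (a - 1 + (y : ℕ))) L
  have hterm : ∀ y : ℕ, f (a + (y : ℕ)) - f (a - (δ y : ℕ) + (y : ℕ)) =
      (δ y : ℝ) * (f (a - 1 + ((y + 1 : ℕ) : ZMod M)) - f (a - 1 + (y : ℕ))) := by
    intro y
    have hsucc : a - 1 + ((y + 1 : ℕ) : ZMod M) = a + (y : ℕ) := by
      push_cast
      ring
    rw [hsucc]
    rcases Nat.le_one_iff_eq_zero_or_eq_one.1 (hδ1 y) with h | h <;> simp [h]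
  rw [← Finset.sum_sub_distrib]
  simp only [hterm, hk]
  exact (abs_sub _ _).trans ((add_le_add (hf _) (hf _)).trans_eq (two_mul b).symm)

end Sums

section Positions

variable {M N : ℕ} [NeZero N]

lemma exists_scaledPos_sub_natCast_eq [NeZero M] (X : ZMod N) :
    ∃ δ : ℕ → ℕ, Monotone δ ∧ (∀ y, δ y ≤ 1) ∧ ∀ y, y * M ≤ N →
      ((scaledPos M (X - (y : ZMod N)) : ℕ) : ZMod M) = (scaledPos M X : ℕ) - (δ y : ℕ) := by
  set n := X.val + N with hn
  have hnX : (n : ZMod N) = X := by simp [hn]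
  refine ⟨fun y => min 1 (n * M / N - (n - y) * M / N), fun y y' hyy' => ?_,
    fun y => min_le_left _ _, fun y hy => ?_⟩
  · exact min_le_min_left _ (Nat.sub_le_sub_left
      (Nat.div_le_div_right (Nat.mul_le_mul_right _ (Nat.sub_le_sub_left hyy' n))) _)
  have hyn : y ≤ n := (Nat.le_mul_of_pos_right y (NeZero.pos M)).trans (hy.trans (by omega))
  have hlower : (n - y) * M / N ≤ n * M / N :=
    Nat.div_le_div_right (Nat.mul_le_mul_right _ (Nat.sub_le _ _))
  have hupper : n * M / N ≤ (n - y) * M / N + 1 := by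
    rw [← Nat.add_div_right _ (NeZero.pos N), Nat.sub_mul]
    exact Nat.div_le_div_right (by omega)
  have hsub : X - (y : ZMod N) = ((n - y : ℕ) : ZMod N) := by rw [Nat.cast_sub hyn, hnX]
  beta_reduce
  rw [hsub, scaledPos_natCast, ← hnX, scaledPos_natCast, min_eq_right (by omega),
    Nat.cast_sub hlower, sub_sub_cancel]

-- Along a window the positions `scaledPos M (X - y)` drop only once, so that the two sums
-- agree up to boundary terms.
lemma abs_sum_scaledPos_sub_le [NeZero M] (hMN : M * M ≤ N) {L : ℕ} (hL : L ≤ M + 1)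
    {f : ZMod M → ℝ} {b : ℝ} (hf : ∀ m, |f m| ≤ b) (X : ZMod N) {m : ℕ}
    (hm : m ≤ scaledPos M X + 2) (hm' : scaledPos M X ≤ m) :
    |∑ y ∈ Finset.range L, f ((m : ZMod M) - 1 + (y : ℕ)) -
      ∑ y ∈ Finset.range L, f ((scaledPos M (X - (y : ZMod N)) : ℕ) + (y : ℕ))| ≤ 4 * b := by
  obtain ⟨δ, hδ, hδ1, hpos⟩ := exists_scaledPos_sub_natCast_eq (M := M) X
  have hdrop : ∀ y ∈ Finset.range L, f ((scaledPos M (X - (y : ZMod N)) : ℕ) + (y : ℕ)) =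
      f ((scaledPos M X : ℕ) - (δ y : ℕ) + (y : ℕ)) := fun y hy => by
    have hyM : y ≤ M := by have := Finset.mem_range.1 hy; omega
    rw [hpos y ((Nat.mul_le_mul_right M hyM).trans hMN)]
  rw [Finset.sum_congr rfl hdrop]
  have hbase := abs_sum_pred_sub_sum_le hf L hm' hm
  have hswitch := abs_sum_sub_sum_sub_switch_le hf hδ hδ1 L ((scaledPos M X : ℕ) : ZMod M)
  exact (abs_sub_le _ _ _).trans ((add_le_add hbase hswitch).trans_eq (by ring))

lemma scaledPos_lt [NeZero M] (X : ZMod N) : scaledPos M X < M := by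
  unfold scaledPos
  rw [Nat.div_lt_iff_lt_mul (NeZero.pos N), mul_comm]
  exact Nat.mul_lt_mul_of_pos_left (ZMod.val_lt X) (NeZero.pos M)

end Positions

section WindowSums

variable {N : ℕ}

/-- The sum over the windows of side `L` that contain a vertex of the torus. -/
def windowSum (L : ℕ) (A : Vertex N → ℕ → ℕ → ℝ) (X : Vertex N) : ℝ :=
  ∑ y ∈ Finset.range L, ∑ z ∈ Finset.range L, A (X.1 - (y : ℕ), X.2 - (z : ℕ)) y z

lemma windowSum_sub (L : ℕ) (A A' : Vertex N → ℕ → ℕ → ℝ) (X : Vertex N) :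
    windowSum L (fun b y z => A b y z - A' b y z) X = windowSum L A X - windowSum L A' X := by
  unfold windowSum
  simp only [Finset.sum_sub_distrib]

lemma abs_windowSum_le (L : ℕ) (A : Vertex N → ℕ → ℕ → ℝ) (X : Vertex N) :
    |windowSum L A X| ≤ windowSum L (fun b y z => |A b y z|) X :=
  (Finset.abs_sum_le_sum_abs _ _).trans
    (Finset.sum_le_sum fun _ _ => Finset.abs_sum_le_sum_abs _ _)

lemma sum_windowSum {ι : Type*} (s : Finset ι) (L : ℕ) (A : ι → Vertex N → ℕ → ℕ → ℝ)
    (X : Vertex N) :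
    ∑ i ∈ s, windowSum L (A i) X = windowSum L (fun b y z => ∑ i ∈ s, A i b y z) X := by
  unfold windowSum
  rw [Finset.sum_comm]
  exact Finset.sum_congr rfl fun y _ => Finset.sum_comm

lemma abs_windowSum_right_sub_le {L : ℕ} {A : Vertex N → ℕ → ℕ → ℝ} {c : ℝ}
    (hA : ∀ b, ∀ y ≤ L, ∀ z ≤ L, |A b y z| ≤ c) (x y : ZMod N) :
    |windowSum L A (x + 1, y) - windowSum L (fun b y z => A b (y + 1) z) (x, y)| ≤ L * (2 * c) := by
  unfold windowSum
  rw [Finset.sum_comm, Finset.sum_comm (f := fun u v => A _ (u + 1) v), ← Finset.sum_sub_distrib]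
  refine (Finset.abs_sum_le_sum_abs _ _).trans ?_
  calc _ ≤ ∑ _z ∈ Finset.range L, 2 * c := by
        refine Finset.sum_le_sum fun z hz => ?_
        have hz := (Finset.mem_range.1 hz).le
        have := abs_sum_sub_shift_le (L := L) (c := c)
          (h := fun u : ℕ => A (x + 1 - (u : ℕ), y - (z : ℕ)) u z)
          (hA _ _ (Nat.zero_le _) _ hz) (hA _ _ le_rfl _ hz)
        simpa only [Nat.cast_add, Nat.cast_one, add_sub_add_right_eq_sub] using this
    _ = _ := by simp

lemma abs_windowSum_up_sub_le {L : ℕ} {A : Vertex N → ℕ → ℕ → ℝ} {c : ℝ}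
    (hA : ∀ b, ∀ y ≤ L, ∀ z ≤ L, |A b y z| ≤ c) (x y : ZMod N) :
    |windowSum L A (x, y + 1) - windowSum L (fun b y z => A b y (z + 1)) (x, y)| ≤ L * (2 * c) := by
  unfold windowSum
  rw [← Finset.sum_sub_distrib]
  refine (Finset.abs_sum_le_sum_abs _ _).trans ?_
  calc _ ≤ ∑ _z ∈ Finset.range L, 2 * c := by
        refine Finset.sum_le_sum fun z hz => ?_
        have hz := (Finset.mem_range.1 hz).le
        have := abs_sum_sub_shift_le (L := L) (c := c)
          (h := fun u : ℕ => A (x - (z : ℕ), y + 1 - (u : ℕ)) z u)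
          (hA _ _ hz _ (Nat.zero_le _)) (hA _ _ hz _ le_rfl)
        simpa only [Nat.cast_add, Nat.cast_one, add_sub_add_right_eq_sub] using this
    _ = _ := by simp

lemma abs_windowSum_right_up_sub_le {L : ℕ} {A : Vertex N → ℕ → ℕ → ℝ} {c : ℝ}
    (hA : ∀ b, ∀ y ≤ L + 1, ∀ z ≤ L + 1, |A b y z| ≤ c) (x y : ZMod N) :
    |windowSum L A (x + 1, y + 1) - windowSum L (fun b y z => A b (y + 1) (z + 1)) (x, y)| ≤
      L * (4 * c) := by
  have h1 := abs_windowSum_right_sub_le (L := L)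
    (fun b y hy z hz => hA b y (by omega) z (by omega)) x (y + 1)
  have h2 := abs_windowSum_up_sub_le (L := L) (A := fun b y z => A b (y + 1) z)
    (fun b y hy z hz => hA b (y + 1) (by omega) z (by omega)) x y
  refine (abs_sub_le _ _ _).trans ((add_le_add h1 h2).trans (le_of_eq ?_))
  ring

/-- The divergence-free flow with stream function `P`. -/
def curl (P : Vertex N → ℝ) (e : Edge N) : ℝ :=
  if e.1 then P (e.2.1, e.2.2 + 1) - P (e.2.1 + 1, e.2.2 + 1)
  else P (e.2.1 + 1, e.2.2 + 1) - P (e.2.1 + 1, e.2.2)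

lemma divergence_curl (P : Vertex N → ℝ) (p : Vertex N) : divergence (curl P) p = 0 := by
  unfold divergence curl
  simp only [if_true, Bool.false_eq_true, if_false, sub_add_cancel]
  ring

/-- The edge of the `M`-torus seen at position `(y, z)` in the window with corner `b`. -/
def windowEdge (M : ℕ) (d : Bool) (b : Vertex N) (y z : ℕ) : Edge M :=
  (d, ((scaledPos M b.1 + y : ℕ), (scaledPos M b.2 + z : ℕ)))

end WindowSums

section Gluing

variable {M N L : ℕ} {E : Vertex N → Edge M → ℝ}

/-- The stream function of the flow `E b`, read in the window with corner `b`. -/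
def windowStream (E : Vertex N → Edge M → ℝ) (b : Vertex N) (y z : ℕ) : ℝ :=
  stream (E b) (scaledPos M b.1 + y) (scaledPos M b.2 + z)

/-- The circulation on the `N`-torus obtained by averaging, at each vertex, the stream functions of
the flows `E b` on the `M`-torus over the windows that contain it. -/
def gluedCirculation (L : ℕ) (E : Vertex N → Edge M → ℝ) (e : Edge N) : ℝ :=
  ((L : ℝ) ^ 2)⁻¹ * curl (windowSum L (windowStream E)) e

lemma divergence_gluedCirculation (L : ℕ) (E : Vertex N → Edge M → ℝ) (p : Vertex N) :
    divergence (gluedCirculation L E) p = 0 := by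
  unfold gluedCirculation
  rw [divergence_mul, divergence_curl, mul_zero]

lemma windowEdge_false_eq_windowStream_sub (E : Vertex N → Edge M → ℝ) (b : Vertex N) (y z : ℕ) :
    E b (windowEdge M false b y z) =
      windowStream E b (y + 1) (z + 1) - windowStream E b (y + 1) z := by
  simp only [windowStream, ← add_assoc, stream_false, windowEdge]

lemma windowEdge_true_eq_windowStream_sub (hE : ∀ b p, divergence (E b) p = 0) (b : Vertex N)
    (y z : ℕ) :
    E b (windowEdge M true b y z) =
      windowStream E b y (z + 1) - windowStream E b (y + 1) (z + 1) := by
  simp only [windowStream, ← add_assoc, stream_true (hE b), windowEdge]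

variable [NeZero M] [NeZero N]

lemma abs_windowStream_le {δ : ℝ} (hL : L ≤ M)
    (hs : ∀ b x y, x ≤ 2 * M + 1 → y ≤ 2 * M + 1 → |stream (E b) x y| ≤ δ) (b : Vertex N) {y z : ℕ}
    (hy : y ≤ L + 1) (hz : z ≤ L + 1) : |windowStream E b y z| ≤ δ := by
  have h1 := scaledPos_lt (M := M) b.1
  have h2 := scaledPos_lt (M := M) b.2
  exact hs b _ _ (by omega) (by omega)

lemma abs_curl_windowSum_sub_le {δ : ℝ} (hL : L ≤ M) (hE : ∀ b p, divergence (E b) p = 0)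
    (hs : ∀ b x y, x ≤ 2 * M + 1 → y ≤ 2 * M + 1 → |stream (E b) x y| ≤ δ) (e : Edge N) :
    |curl (windowSum L (windowStream E)) e -
      windowSum L (fun b y z => E b (windowEdge M e.1 b y z)) e.2| ≤ L * (4 * δ) + L * (2 * δ) := by
  obtain ⟨d, x, y⟩ := e
  have hA : ∀ b, ∀ y ≤ L + 1, ∀ z ≤ L + 1, |windowStream E b y z| ≤ δ :=
    fun b y hy z hz => abs_windowStream_le hL hs b hy hz
  have hA' : ∀ b, ∀ y ≤ L, ∀ z ≤ L, |windowStream E b y z| ≤ δ :=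
    fun b y hy z hz => hA b y (by omega) z (by omega)
  have hdiag := abs_windowSum_right_up_sub_le hA x y
  cases d with
  | false =>
    simp only [windowEdge_false_eq_windowStream_sub, windowSum_sub, curl, Bool.false_eq_true,
      if_false]
    rw [sub_sub_sub_comm]
    exact (abs_sub _ _).trans (add_le_add hdiag (abs_windowSum_right_sub_le hA' x y))
  | true =>
    simp only [windowEdge_true_eq_windowStream_sub hE, windowSum_sub, curl, if_true]
    rw [sub_sub_sub_comm]
    exact (abs_sub _ _).trans
      ((add_le_add (abs_windowSum_up_sub_le hA' x y) hdiag).trans_eq (add_comm _ _))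

lemma abs_gluedCirculation_sub_le {δ : ℝ} (hL0 : 0 < L) (hL : L ≤ M)
    (hE : ∀ b p, divergence (E b) p = 0)
    (hs : ∀ b x y, x ≤ 2 * M + 1 → y ≤ 2 * M + 1 → |stream (E b) x y| ≤ δ) (e : Edge N) :
    |gluedCirculation L E e -
      ((L : ℝ) ^ 2)⁻¹ * windowSum L (fun b y z => E b (windowEdge M e.1 b y z)) e.2| ≤
        6 * δ / L := by
  unfold gluedCirculation
  rw [← mul_sub, abs_mul, abs_of_nonneg (by positivity : (0 : ℝ) ≤ ((L : ℝ) ^ 2)⁻¹)]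
  calc _ ≤ ((L : ℝ) ^ 2)⁻¹ * (L * (4 * δ) + L * (2 * δ)) := by
        gcongr
        exact abs_curl_windowSum_sub_le hL hE hs e
    _ = _ := by field_simp; ring

end Gluing

section Smoothing

variable {M N : ℕ}

/-- The average of a flow over its translates by the vectors of a square of side `L`. -/
def squareAvgFlow (L : ℕ) (φ : Edge M → ℝ) (e : Edge M) : ℝ :=
  ((L : ℝ) ^ 2)⁻¹ * ∑ y ∈ Finset.range L, ∑ z ∈ Finset.range L,
    φ (e.1, (e.2.1 + (y : ℕ), e.2.2 + (z : ℕ)))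

/-- The average of a function of the vertices over squares of side `L`. -/
def squareAvg (L : ℕ) (g : Vertex M → ℝ) (p : Vertex M) : ℝ :=
  ((L : ℝ) ^ 2)⁻¹ * ∑ y ∈ Finset.range L, ∑ z ∈ Finset.range L,
    g (p.1 + (y : ℕ), p.2 + (z : ℕ))

lemma divergence_squareAvgFlow (L : ℕ) (φ : Edge M → ℝ) (p : Vertex M) :
    divergence (squareAvgFlow L φ) p = squareAvg L (divergence φ) p := by
  unfold squareAvgFlow squareAvg
  rw [divergence_mul, divergence_sum]
  refine congrArg _ (Finset.sum_congr rfl fun y _ => ?_)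
  rw [divergence_sum]
  simp only [divergence, sub_add_eq_add_sub]

variable [NeZero M]

lemma sum_squareAvg {L : ℕ} (hL : 0 < L) (g : Vertex M → ℝ) : ∑ p, squareAvg L g p = ∑ p, g p := by
  unfold squareAvg
  rw [← Finset.mul_sum, Finset.sum_comm]
  have h : ∀ y z : ℕ, ∑ p : Vertex M, g (p.1 + (y : ℕ), p.2 + (z : ℕ)) = ∑ p, g p := fun y z =>
    Fintype.sum_equiv (Equiv.addRight ((y : ZMod M), (z : ZMod M))) _ _ fun _ => rfl
  have h' : ∀ y : ℕ, ∑ p : Vertex M, ∑ z ∈ Finset.range L, g (p.1 + (y : ℕ), p.2 + (z : ℕ)) =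
      L * ∑ p, g p := by
    intro y
    rw [Finset.sum_comm]
    simp [h]
  have hLr : (L : ℝ) ≠ 0 := by positivity
  simp only [h', Finset.sum_const, Finset.card_range, nsmul_eq_mul]
  field_simp

variable [NeZero N]

lemma abs_squareAvgFlow_sub_le (hMN : M * M ≤ N) {L : ℕ} (hL0 : 0 < L) (hL : L ≤ M + 1)
    {φ : Edge M → ℝ} {b : ℝ} (hφ : ∀ e, |φ e| ≤ b) (d : Bool) (X : Vertex N) {m n : ℕ}
    (hm : m ≤ scaledPos M X.1 + 2) (hm' : scaledPos M X.1 ≤ m)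
    (hn : n ≤ scaledPos M X.2 + 2) (hn' : scaledPos M X.2 ≤ n) :
    |squareAvgFlow L φ (d, ((m : ZMod M) - 1, (n : ZMod M) - 1)) -
      ((L : ℝ) ^ 2)⁻¹ * windowSum L (fun b y z => φ (windowEdge M d b y z)) X| ≤ 8 * b / L := by
  unfold squareAvgFlow windowSum
  rw [← mul_sub, abs_mul, abs_of_nonneg (by positivity : (0 : ℝ) ≤ ((L : ℝ) ^ 2)⁻¹)]
  have h1 : ∀ y ∈ Finset.range L, |∑ z ∈ Finset.range L,
        φ (d, ((m : ZMod M) - 1 + (y : ℕ), (n : ZMod M) - 1 + (z : ℕ))) -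
      ∑ z ∈ Finset.range L, φ (d, ((m : ZMod M) - 1 + (y : ℕ),
        (scaledPos M (X.2 - (z : ZMod N)) : ℕ) + (z : ℕ)))| ≤ 4 * b := fun y _ =>
    abs_sum_scaledPos_sub_le hMN hL (f := fun q => φ (d, ((m : ZMod M) - 1 + (y : ℕ), q)))
      (fun _ => hφ _) X.2 hn hn'
  have h2 : ∀ z ∈ Finset.range L, |∑ y ∈ Finset.range L,
        φ (d, ((m : ZMod M) - 1 + (y : ℕ), (scaledPos M (X.2 - (z : ZMod N)) : ℕ) + (z : ℕ))) -
      ∑ y ∈ Finset.range L, φ (d, ((scaledPos M (X.1 - (y : ZMod N)) : ℕ) + (y : ℕ),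
        (scaledPos M (X.2 - (z : ZMod N)) : ℕ) + (z : ℕ)))| ≤ 4 * b := fun z _ =>
    abs_sum_scaledPos_sub_le hMN hL
      (f := fun q => φ (d, (q, (scaledPos M (X.2 - (z : ZMod N)) : ℕ) + (z : ℕ))))
      (fun _ => hφ _) X.1 hm hm'
  have h1' := (Finset.abs_sum_le_sum_abs _ _).trans (Finset.sum_le_sum h1)
  have h2' := (Finset.abs_sum_le_sum_abs _ _).trans (Finset.sum_le_sum h2)
  rw [Finset.sum_sub_distrib] at h1' h2'
  rw [Finset.sum_comm] at h2'
  rw [Finset.sum_comm (f := fun (z y : ℕ) =>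
    φ (d, ((scaledPos M (X.1 - (y : ZMod N)) : ℕ) + (y : ℕ),
      (scaledPos M (X.2 - (z : ZMod N)) : ℕ) + (z : ℕ))))] at h2'
  simp only [Finset.sum_const, Finset.card_range, nsmul_eq_mul] at h1' h2'
  have h3 := (abs_sub_le _ _ _).trans (add_le_add h1' h2')
  simp only [windowEdge, Nat.cast_add]
  calc _ ≤ ((L : ℝ) ^ 2)⁻¹ * (L * (4 * b) + L * (4 * b)) := by gcongr
    _ = _ := by field_simp; ring

lemma abs_rescale_squareAvgFlow_sub_le (hMN : M * M ≤ N) {L : ℕ} (hL0 : 0 < L) (hL : L ≤ M + 1)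
    {φ : Edge M → ℝ} {b : ℝ} (hφ : ∀ e, |φ e| ≤ b) (e : Edge N) :
    |rescale (squareAvgFlow L φ) e -
      ((L : ℝ) ^ 2)⁻¹ * windowSum L (fun b y z => φ (windowEdge M e.1 b y z)) e.2| ≤ 8 * b / L := by
  have hMN' : M ≤ N := (Nat.le_mul_self M).trans hMN
  obtain ⟨d, X⟩ := e
  cases d with
  | false =>
    simp only [rescale, Bool.false_eq_true, if_false]
    exact abs_edgeAvg_sub_le hMN' fun m hm hm' => abs_vertexAvg_sub_le hMN' fun n hn hn' =>
      abs_squareAvgFlow_sub_le hMN hL0 hL hφ false X hm hm' hn hn'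
  | true =>
    simp only [rescale, if_true]
    exact abs_vertexAvg_sub_le hMN' fun m hm hm' => abs_edgeAvg_sub_le hMN' fun n hn hn' =>
      abs_squareAvgFlow_sub_le hMN hL0 hL hφ true X hm hm' hn hn'

end Smoothing

end Windows

section Gluing

section Blurring

variable {M N : ℕ}

lemma squareAvg_sub (L : ℕ) (g h : Vertex M → ℝ) (p : Vertex M) :
    squareAvg L (fun p => g p - h p) p = squareAvg L g p - squareAvg L h p := by
  unfold squareAvg
  simp only [Finset.sum_sub_distrib, mul_sub]

lemma squareAvg_mul (L : ℕ) (a : ℝ) (g : Vertex M → ℝ) (p : Vertex M) :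
    squareAvg L (fun p => a * g p) p = a * squareAvg L g p := by
  unfold squareAvg
  simp only [← Finset.mul_sum]
  ring

lemma exists_of_squareAvg_ne_zero {L : ℕ} {g : Vertex M → ℝ} {p : Vertex M}
    (h : squareAvg L g p ≠ 0) : ∃ y < L, ∃ z < L, g (p.1 + (y : ℕ), p.2 + (z : ℕ)) ≠ 0 := by
  by_contra! hc
  refine h ?_
  rw [squareAvg, Finset.sum_eq_zero fun y hy => Finset.sum_eq_zero fun z hz =>
    hc y (Finset.mem_range.1 hy) z (Finset.mem_range.1 hz), mul_zero]

variable {I : Type*} [DecidableEq I]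

/-- The smoothed indicator function of a class of vertices of the `M`-torus, carried over to the
`N`-torus. -/
def blurredIndicator (L : ℕ) (l : Vertex M → I) (i : I) (X : Vertex N) : ℝ :=
  torusAvg (squareAvg L fun p => if l p = i then 1 else 0) X

lemma blurredIndicator_nonneg (L : ℕ) (l : Vertex M → I) (i : I) (X : Vertex N) :
    0 ≤ blurredIndicator L l i X :=
  torusAvg_nonneg (fun _ => by unfold squareAvg; positivity) X

lemma sum_squareAvg_indicator [Fintype I] {L : ℕ} (hL : 0 < L) (l : Vertex M → I) (p : Vertex M) :
    ∑ i, squareAvg L (fun p => if l p = i then (1 : ℝ) else 0) p = 1 := by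
  unfold squareAvg
  rw [← Finset.mul_sum, Finset.sum_comm]
  simp only [fun y => Finset.sum_comm (s := Finset.univ) (t := Finset.range L)
    (f := fun (i : I) (z : ℕ) => if l (p.1 + (y : ℕ), p.2 + (z : ℕ)) = i then (1 : ℝ) else 0),
    Finset.sum_ite_eq, Finset.mem_univ, if_true, Finset.sum_const, Finset.card_range,
    nsmul_eq_mul, mul_one]
  rw [← sq, inv_mul_cancel₀ (by positivity)]

variable [NeZero M]

lemma isFractionalPartition_blurredIndicator [Fintype I] {L : ℕ} (hL : 0 < L) (l : Vertex M → I) :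
    IsFractionalPartition (fun i (X : Vertex N) => blurredIndicator L l i X) where
  nonneg := blurredIndicator_nonneg L l
  sum_eq_one X := by
    unfold blurredIndicator
    rw [← torusAvg_sum]
    simp only [sum_squareAvg_indicator hL, torusAvg_one]

variable [NeZero N]

lemma sum_blurredIndicator_eq_classSize {L : ℕ} (hL : 0 < L) (l : Vertex M → I) (i : I) :
    ∑ X : Vertex N, blurredIndicator L l i X = (N / M) ^ 2 * classSize l i := by
  unfold blurredIndicator
  rw [sum_torusAvg, sum_squareAvg hL, classSize]

lemma divergence_rescale_squareAvgFlow_coarseFlow {L : ℕ} {l : Vertex M → I}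
    {F : I → I → Edge M → ℝ} (hF : IsCoarseFlow l F) (i j : I) (X : Vertex N) :
    divergence (rescale (squareAvgFlow L (F i j))) X = M / N * (((M : ℝ) ^ 3)⁻¹ *
      (classSize l j * blurredIndicator L l i X - classSize l i * blurredIndicator L l j X)) := by
  have h : divergence (squareAvgFlow L (F i j)) = fun p => ((M : ℝ) ^ 3)⁻¹ *
      (classSize l j * squareAvg L (fun p => if l p = i then 1 else 0) p -
        classSize l i * squareAvg L (fun p => if l p = j then 1 else 0) p) := by
    funext p
    rw [divergence_squareAvgFlow, ← squareAvg_mul, ← squareAvg_mul, ← squareAvg_sub,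
      ← squareAvg_mul]
    congr 1
    funext p
    exact hF i j p
  rw [divergence_rescale, h, torusAvg_mul, torusAvg_sub, torusAvg_mul, torusAvg_mul]
  rfl

end Blurring

section GluedFlows

variable {M N : ℕ} [NeZero M] [NeZero N] {I : Type*} {L : ℕ}

/-- The flows between classes on the `N`-torus glued from coarse flows `F b` on the `M`-torus, one
for each window: the rescaled flow `F 0` is corrected by a circulation that replaces it with `F b`
in the window with corner `b`. -/
def gluedClassFlow (L : ℕ) (F : Vertex N → I → I → Edge M → ℝ) (i j : I) (e : Edge N) : ℝ :=
  rescale (squareAvgFlow L (F 0 i j)) e + gluedCirculation L (fun b e => F b i j e - F 0 i j e) e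

lemma divergence_gluedClassFlow [DecidableEq I] (hL : 0 < L) {l : Vertex M → I}
    {F : Vertex N → I → I → Edge M → ℝ} (hF : ∀ b, IsCoarseFlow l (F b)) (i j : I) (p : Vertex N) :
    divergence (gluedClassFlow L F i j) p = ((N : ℝ) ^ 3)⁻¹ *
      ((∑ v : Vertex N, blurredIndicator L l j v) * blurredIndicator L l i p -
        (∑ v : Vertex N, blurredIndicator L l i v) * blurredIndicator L l j p) := by
  have hM : (M : ℝ) ≠ 0 := NeZero.ne _
  have hN : (N : ℝ) ≠ 0 := NeZero.ne _
  unfold gluedClassFlow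
  rw [divergence_add, divergence_gluedCirculation, add_zero,
    divergence_rescale_squareAvgFlow_coarseFlow (hF 0), sum_blurredIndicator_eq_classSize hL,
    sum_blurredIndicator_eq_classSize hL]
  field_simp

variable [Fintype I]

lemma abs_gluedClassFlow_le [DecidableEq I] (hMN : M * M ≤ N) (hL0 : 0 < L) (hL : L ≤ M)
    {l : Vertex M → I} {F : Vertex N → I → I → Edge M → ℝ}
    (hF : ∀ b, IsCoarseFlow l (F b)) {B δ : ℝ} (hB : ∀ b e, totalVolume (F b) e ≤ B)
    (hs : ∀ b b' i j x y, x ≤ 2 * M + 1 → y ≤ 2 * M + 1 →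
      |stream (fun e => F b i j e - F b' i j e) x y| ≤ δ) (i j : I) (e : Edge N) :
    |gluedClassFlow L F i j e| ≤
      ((L : ℝ) ^ 2)⁻¹ * windowSum L (fun b y z => |F b i j (windowEdge M e.1 b y z)|) e.2 +
        (6 * δ / L + 8 * B / L) := by
  have hcirc := abs_gluedCirculation_sub_le (N := N) hL0 hL
    (E := fun b e => F b i j e - F 0 i j e)
    (fun b p => by rw [divergence_sub, hF b i j p, hF 0 i j p, sub_self]) (fun b => hs b 0 i j) e
  rw [windowSum_sub L (fun b y z => F b i j (windowEdge M e.1 b y z))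
    (fun b y z => F 0 i j (windowEdge M e.1 b y z)), mul_sub] at hcirc
  have hbase := abs_rescale_squareAvgFlow_sub_le hMN hL0 (by omega : L ≤ M + 1)
    (fun e' => (abs_le_totalVolume (F 0) i j e').trans (hB 0 e')) e
  have havg : |((L : ℝ) ^ 2)⁻¹ * windowSum L (fun b y z => F b i j (windowEdge M e.1 b y z)) e.2| ≤
      ((L : ℝ) ^ 2)⁻¹ * windowSum L (fun b y z => |F b i j (windowEdge M e.1 b y z)|) e.2 := by
    rw [abs_mul, abs_of_nonneg (by positivity : (0 : ℝ) ≤ ((L : ℝ) ^ 2)⁻¹)]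
    gcongr
    exact abs_windowSum_le _ _ _
  unfold gluedClassFlow
  rw [abs_le] at hcirc hbase havg ⊢
  constructor <;> linarith [hcirc.1, hcirc.2, hbase.1, hbase.2, havg.1, havg.2]

variable [DecidableEq I]

/-- The multiflow on the `N`-torus glued from coarse flows on the `M`-torus, one for each
window. -/
def gluedMultiflow (L : ℕ) (l : Vertex M → I) (F : Vertex N → I → I → Edge M → ℝ) :
    Vertex N → Vertex N → Edge N → ℝ :=
  partitionFlow (fun i X => blurredIndicator L l i X) (gluedClassFlow L F)

lemma isMultiflow_gluedMultiflow (hL : 0 < L) {l : Vertex M → I} {F : Vertex N → I → I → Edge M → ℝ}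
    (hF : ∀ b, IsCoarseFlow l (F b)) : IsMultiflow (gluedMultiflow L l F) :=
  isMultiflow_partitionFlow (isFractionalPartition_blurredIndicator hL l)
    (divergence_gluedClassFlow hL hF)

theorem totalVolume_gluedMultiflow_le (hMN : M * M ≤ N) {D : ℕ} (hL0 : 0 < L) (hL : L ≤ M)
    {l : Vertex M → I}
    (hD : ∀ i (v w : Vertex N), blurredIndicator L l i v ≠ 0 → blurredIndicator L l i w ≠ 0 →
      (w.1 - v.1).valMinAbs.natAbs ≤ D ∧ (w.2 - v.2).valMinAbs.natAbs ≤ D)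
    {F : Vertex N → I → I → Edge M → ℝ} (hF : ∀ b, IsCoarseFlow l (F b)) {B δ : ℝ}
    (hB : ∀ b e, totalVolume (F b) e ≤ B)
    (hs : ∀ b b' i j x y, x ≤ 2 * M + 1 → y ≤ 2 * M + 1 →
      |stream (fun e => F b i j e - F b' i j e) x y| ≤ δ) (e : Edge N) :
    totalVolume (gluedMultiflow L l F) e ≤
      ((L : ℝ) ^ 2)⁻¹ * windowSum L (fun b y z => totalVolume (F b) (windowEdge M e.1 b y z)) e.2 +
        Fintype.card I ^ 2 * (6 * δ / L + 8 * B / L) + 4 * D / N := by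
  have hχ := isFractionalPartition_blurredIndicator (N := N) hL0 l
  refine (totalVolume_partitionFlow_le hχ hD _ e).trans ?_
  gcongr
  calc totalVolume (gluedClassFlow L F) e
      ≤ ∑ i, ∑ j,
          (((L : ℝ) ^ 2)⁻¹ * windowSum L (fun b y z => |F b i j (windowEdge M e.1 b y z)|) e.2 +
          (6 * δ / L + 8 * B / L)) :=
        Finset.sum_le_sum fun i _ => Finset.sum_le_sum fun j _ =>
          abs_gluedClassFlow_le hMN hL0 hL hF hB hs i j e
    _ = _ := by
        simp only [Finset.sum_add_distrib, ← Finset.mul_sum, sum_windowSum, Finset.sum_const,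
          Finset.card_univ, nsmul_eq_mul, totalVolume]
        ring

end GluedFlows

section Cells

variable {M N : ℕ}

lemma exists_val_mul_add_eq [NeZero N] {R : ℕ} (hR : 0 < R) {q s y : ℕ} {x : ZMod N}
    (h : ((((x.val * M + s) / N : ℕ) : ZMod M) + (y : ℕ)).val / R = q) :
    ∃ k r m : ℕ, r < R ∧ m < N ∧ x.val * M + s + N * y = N * (q * R + r + M * k) + m := by
  set n := (x.val * M + s) / N + y with hn
  rw [← Nat.cast_add, ZMod.val_natCast] at h
  refine ⟨n / M, n % M % R, (x.val * M + s) % N, Nat.mod_lt _ hR, Nat.mod_lt _ (NeZero.pos N), ?_⟩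
  have hqR : q * R + n % M % R = n % M := by
    rw [← h]
    exact Nat.div_add_mod' _ _
  rw [hqR, Nat.mod_add_div, hn]
  linarith [Nat.div_add_mod (x.val * M + s) N]

lemma natAbs_valMinAbs_sub_mul_le [NeZero N] (v w : ZMod N) (a : ℤ) :
    (w - v).valMinAbs.natAbs ≤ (w.val - v.val - N * a : ℤ).natAbs := by
  refine ZMod.natAbs_min_of_le_div_two N _ _ ?_ (ZMod.natAbs_valMinAbs_le _)
  rw [ZMod.coe_valMinAbs]
  push_cast
  simp

variable [NeZero M]

/-- The cell, in a partition of the torus into `K × K` squares, of a vertex. -/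
def cell (K : ℕ) [NeZero K] (p : Vertex M) : Fin K × Fin K :=
  have h : ∀ a : ZMod M, a.val / (M / K + 1) < K := fun a => by
    rw [Nat.div_lt_iff_lt_mul (Nat.succ_pos _), mul_comm]
    exact (ZMod.val_lt a).trans (by
      rw [mul_comm]; exact Nat.lt_mul_div_succ M (NeZero.pos K))
  (⟨p.1.val / (M / K + 1), h p.1⟩, ⟨p.2.val / (M / K + 1), h p.2⟩)

lemma exists_of_blurredIndicator_cell_ne_zero {K L : ℕ} [NeZero K] {i : Fin K × Fin K}
    {x : Vertex N} (hx : blurredIndicator L (cell K (M := M)) i x ≠ 0) :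
    ∃ s < M, ∃ t < M, ∃ y < L, ∃ z < L,
      ((((x.1.val * M + s) / N : ℕ) : ZMod M) + (y : ℕ)).val / (M / K + 1) = i.1 ∧
      ((((x.2.val * M + t) / N : ℕ) : ZMod M) + (z : ℕ)).val / (M / K + 1) = i.2 := by
  obtain ⟨s, hs, t, ht, h⟩ := exists_of_torusAvg_ne_zero hx
  obtain ⟨y, hy, z, hz, h⟩ := exists_of_squareAvg_ne_zero h
  obtain ⟨rfl, -⟩ := ite_ne_right_iff.1 h
  exact ⟨s, hs, t, ht, y, hy, z, hz, rfl, rfl⟩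

variable [NeZero N]

lemma natAbs_valMinAbs_le_of_val_div_eq {R L : ℕ} (hR : 0 < R) {q s t y z : ℕ} {v w : ZMod N}
    (hs : s < M) (ht : t < M) (hy : y < L) (hz : z < L)
    (hv : ((((v.val * M + s) / N : ℕ) : ZMod M) + (y : ℕ)).val / R = q)
    (hw : ((((w.val * M + t) / N : ℕ) : ZMod M) + (z : ℕ)).val / R = q) :
    (w - v).valMinAbs.natAbs ≤ (N * (R + L) + N + M) / M := by
  obtain ⟨k, r, m, hr, hm, hv⟩ := exists_val_mul_add_eq hR hv
  obtain ⟨k', r', m', hr', hm', hw⟩ := exists_val_mul_add_eq hR hw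
  refine (natAbs_valMinAbs_sub_mul_le v w (k' - k)).trans ?_
  rw [Nat.le_div_iff_mul_le (NeZero.pos M), ← Int.natAbs_natCast M, ← Int.natAbs_mul]
  zify at hv hw hs ht hy hz hr hr' hm hm' ⊢
  have hdiff : (w.val - v.val - N * (k' - k) : ℤ) * M =
      N * ((r' - r) + (y - z)) + (m' - m) + (s - t) := by linear_combination hw - hv
  have hcoarse : |(N : ℤ) * ((r' - r) + (y - z))| ≤ N * (R + L) := by
    rw [abs_mul, Nat.abs_cast]
    gcongr
    rw [abs_le]
    constructor <;> omega
  rw [hdiff, Nat.abs_cast, abs_le]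
  rw [abs_le] at hcoarse
  constructor <;> linarith [hcoarse.1, hcoarse.2, Int.natCast_nonneg m, Int.natCast_nonneg m',
    Int.natCast_nonneg s, Int.natCast_nonneg t]

lemma dist_le_of_blurredIndicator_cell_ne_zero {K L : ℕ} [NeZero K] {i : Fin K × Fin K}
    {v w : Vertex N} (hv : blurredIndicator L (cell K (M := M)) i v ≠ 0)
    (hw : blurredIndicator L (cell K (M := M)) i w ≠ 0) :
    (w.1 - v.1).valMinAbs.natAbs ≤ (N * (M / K + 1 + L) + N + M) / M ∧
      (w.2 - v.2).valMinAbs.natAbs ≤ (N * (M / K + 1 + L) + N + M) / M := by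
  obtain ⟨s, hs, t, ht, y, hy, z, hz, h1, h2⟩ := exists_of_blurredIndicator_cell_ne_zero hv
  obtain ⟨s', hs', t', ht', y', hy', z', hz', h1', h2'⟩ :=
    exists_of_blurredIndicator_cell_ne_zero hw
  exact ⟨natAbs_valMinAbs_le_of_val_div_eq (Nat.succ_pos _) hs hs' hy hy' h1 h1',
    natAbs_valMinAbs_le_of_val_div_eq (Nat.succ_pos _) ht ht' hz hz' h2 h2'⟩

end Cells

end Gluing

section Capacity

lemma windowSum_le {N L : ℕ} {A : Vertex N → ℕ → ℕ → ℝ} {B : ℝ} (hA : ∀ b y z, A b y z ≤ B)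
    (X : Vertex N) : windowSum L A X ≤ (L : ℝ) ^ 2 * B := by
  unfold windowSum
  calc _ ≤ ∑ _y ∈ Finset.range L, ∑ _z ∈ Finset.range L, B := by gcongr; exact hA _ _ _
    _ = _ := by simp; ring

lemma totalVolume_add_le {N : ℕ} {ι κ : Type*} [Fintype ι] [Fintype κ]
    (F G : ι → κ → Edge N → ℝ) {a b : ℝ} (ha : 0 ≤ a) (hb : 0 ≤ b) (e : Edge N) :
    totalVolume (fun i j e => a * F i j e + b * G i j e) e ≤
      a * totalVolume F e + b * totalVolume G e := by
  unfold totalVolume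
  simp only [Finset.mul_sum, ← Finset.sum_add_distrib]
  refine Finset.sum_le_sum fun i _ => Finset.sum_le_sum fun j _ => (abs_add_le _ _).trans ?_
  rw [abs_mul, abs_mul, abs_of_nonneg ha, abs_of_nonneg hb]

lemma IsMultiflow.mix {N : ℕ} {F G : Vertex N → Vertex N → Edge N → ℝ} (hF : IsMultiflow F)
    (hG : IsMultiflow G) {a b : ℝ} (hab : a + b = 1) :
    IsMultiflow fun i j e => a * F i j e + b * G i j e := by
  intro v w p
  rw [divergence_add, divergence_mul, divergence_mul, hF, hG, ← add_mul, hab, one_mul]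

-- The canonical multiflow has volume at most `1 / 4 < B`, so that mixing in a small multiple of it
-- restores the capacity bound after a small overshoot.
lemma exists_capacity_correction {B ε : ℝ} (hB : 1 / 4 < B) (hε : 0 < ε) :
    ∃ ε' > 0, ∀ (N : ℕ) [NeZero N] (G : Vertex N → Vertex N → Edge N → ℝ), IsMultiflow G →
      ∃ G' : Vertex N → Vertex N → Edge N → ℝ, IsMultiflow G' ∧ ∀ e a, a ≤ B →
        totalVolume G e ≤ a + ε' → totalVolume G' e ≤ B ∧ totalVolume G' e ≤ a + ε := by
  have hB0 : 0 < B := by linarith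
  set θ := min 1 (ε / B)
  have hθ0 : 0 < θ := by positivity
  have hθ1 : θ ≤ 1 := min_le_left _ _
  have hθB : θ * B ≤ ε := (le_div_iff₀ hB0).1 (min_le_right _ _)
  set ε' := θ * (B - 1 / 4) with hε'_def
  have hε' : 0 < ε' := mul_pos hθ0 (by linarith)
  refine ⟨ε', hε', fun N _ G hG =>
    ⟨_, hG.mix isMultiflow_canonicalMultiflow (sub_add_cancel 1 θ), fun e a haB hGe => ?_⟩⟩
  have hmix := totalVolume_add_le G (canonicalMultiflow N) (by linarith : 0 ≤ 1 - θ) hθ0.le e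
  have hstd := totalVolume_canonicalMultiflow_le e
  have hG0 := totalVolume_nonneg G e
  constructor <;> nlinarith

lemma width_div_le {K M N : ℕ} (hM : 0 < M) (hN : 0 < N) (hMN : M ≤ N) :
    4 * (((N * (M / K + 1 + (M / K + 1)) + N + M) / M : ℕ) : ℝ) / N ≤ 8 / K + 16 / M := by
  have hMNr : (M : ℝ) ≤ N := by exact_mod_cast hMN
  have h1 : (((N * (M / K + 1 + (M / K + 1)) + N + M) / M : ℕ) : ℝ) ≤
      ((N * (M / K + 1 + (M / K + 1)) + N + M : ℕ) : ℝ) / M := Nat.cast_div_le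
  have h2 : ((M / K : ℕ) : ℝ) ≤ M / K := Nat.cast_div_le
  have h3 : ((N * (M / K + 1 + (M / K + 1)) + N + M : ℕ) : ℝ) ≤
      N * (2 * ((M : ℝ) / K) + 4) := by
    push_cast
    nlinarith
  calc _ ≤ 4 * ((N * (2 * ((M : ℝ) / K) + 4)) / M) / N := by
        gcongr
        exact h1.trans (by gcongr)
    _ = _ := by
        field_simp
        ring

lemma gluing_error_le {K M N : ℕ} {B η : ℝ} (hB : 0 ≤ B) (hη : 0 ≤ η) (hK : 0 < K) (hM : 0 < M)
    (hN : 0 < N) (hMN : M ≤ N) :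
    (Fintype.card (Fin K × Fin K) : ℝ) ^ 2 *
        (6 * (η * M) / (M / K + 1 : ℕ) + 8 * B / (M / K + 1 : ℕ)) +
      4 * (((N * (M / K + 1 + (M / K + 1)) + N + M) / M : ℕ) : ℝ) / N ≤
      6 * (K : ℝ) ^ 5 * η + (8 * B * (K : ℝ) ^ 5 + 16) / M + 8 / K := by
  have hLr : (0 : ℝ) < (M / K + 1 : ℕ) := by positivity
  have hLK : (M : ℝ) ≤ K * (M / K + 1 : ℕ) := by
    exact_mod_cast (Nat.lt_mul_div_succ M hK).le
  have hstream : 6 * (η * M) / (M / K + 1 : ℕ) ≤ 6 * η * K := by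
    rw [div_le_iff₀ hLr]
    nlinarith
  have hboundary : 8 * B / (M / K + 1 : ℕ) ≤ 8 * B * K / M := by
    rw [div_le_div_iff₀ hLr (by positivity)]
    nlinarith
  have hcard : (Fintype.card (Fin K × Fin K) : ℝ) ^ 2 = (K : ℝ) ^ 4 := by
    simp only [Fintype.card_prod, Fintype.card_fin, Nat.cast_mul]
    ring
  rw [hcard]
  calc _ ≤ (K : ℝ) ^ 4 * (6 * η * K + 8 * B * K / M) + (8 / K + 16 / M) :=
        add_le_add (by gcongr) (width_div_le hM hN hMN)
    _ = _ := by ring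

lemma exists_gluing_error_le {B ε : ℝ} (hB : 0 ≤ B) (hε : 0 < ε) :
    ∃ (K : ℕ) (_ : NeZero K) (η : ℝ) (M₁ : ℕ), 0 < η ∧ ∀ M N : ℕ, 0 < N → M₁ ≤ M → M ≤ N →
      M / K + 1 ≤ M ∧ (Fintype.card (Fin K × Fin K) : ℝ) ^ 2 *
          (6 * (η * M) / (M / K + 1 : ℕ) + 8 * B / (M / K + 1 : ℕ)) +
        4 * (((N * (M / K + 1 + (M / K + 1)) + N + M) / M : ℕ) : ℝ) / N ≤ ε := by
  obtain ⟨K₀, hK₀⟩ := exists_nat_gt (24 / ε)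
  set K := K₀ + 2 with hK
  have hKr : (0 : ℝ) < K := by positivity
  have hKε : 8 / (K : ℝ) ≤ ε / 3 := by
    have hK₀K : (K₀ : ℝ) ≤ K := by exact_mod_cast (by omega : K₀ ≤ K)
    rw [div_lt_iff₀ hε] at hK₀
    rw [div_le_div_iff₀ hKr three_pos]
    nlinarith
  obtain ⟨M₀, hM₀⟩ := exists_nat_gt (3 * (8 * B * (K : ℝ) ^ 5 + 16) / ε)
  refine ⟨K, ⟨by omega⟩, ε / (18 * (K : ℝ) ^ 5), M₀ + 2, by positivity,
    fun M N hN hM hMN => ⟨?_, ?_⟩⟩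
  · have hhalf : M / K ≤ M / 2 := Nat.div_le_div_left (by omega) (by omega)
    omega
  have hMε : (8 * B * (K : ℝ) ^ 5 + 16) / M ≤ ε / 3 := by
    have hM₀M : (M₀ : ℝ) ≤ M := by exact_mod_cast (by omega : M₀ ≤ M)
    rw [div_lt_iff₀ hε] at hM₀
    rw [div_le_div_iff₀ (by exact_mod_cast (by omega : 0 < M)) three_pos]
    nlinarith
  have hηε : 6 * (K : ℝ) ^ 5 * (ε / (18 * (K : ℝ) ^ 5)) = ε / 3 := by
    field_simp
    ring
  refine (gluing_error_le hB (by positivity) (by omega) (by omega) hN hMN).trans ?_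
  linarith

theorem exists_glued_multiflow_of_capacity {B ε : ℝ} (hB : 1 / 4 < B) (hε : 0 < ε) :
    ∃ (K : ℕ) (_ : NeZero K) (η : ℝ) (M₁ : ℕ), 0 < η ∧ ∀ (M N : ℕ) [NeZero M] [NeZero N],
      M₁ ≤ M → M * M ≤ N → M / K + 1 ≤ M ∧
      ∀ F : Vertex N → (Fin K × Fin K) → (Fin K × Fin K) → Edge M → ℝ,
        (∀ b, IsCoarseFlow (cell K) (F b)) → (∀ b e, totalVolume (F b) e ≤ B) →
        (∀ b b' i j x y, x ≤ 2 * M + 1 → y ≤ 2 * M + 1 →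
          |stream (fun e => F b i j e - F b' i j e) x y| ≤ η * M) →
        ∃ G : Vertex N → Vertex N → Edge N → ℝ, IsMultiflow G ∧
          ∀ e, totalVolume G e ≤ B ∧ totalVolume G e ≤ (((M / K + 1 : ℕ) : ℝ) ^ 2)⁻¹ *
            windowSum (M / K + 1) (fun b y z => totalVolume (F b) (windowEdge M e.1 b y z)) e.2
              + ε := by
  obtain ⟨ε', hε', hcorrect⟩ := exists_capacity_correction hB hε
  obtain ⟨K, _, η, M₁, hη, herror⟩ := exists_gluing_error_le (by linarith : 0 ≤ B) hε'
  refine ⟨K, inferInstance, η, M₁, hη, fun M N _ _ hM hMN => ?_⟩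
  obtain ⟨hL, herror⟩ := herror M N (NeZero.pos N) hM ((Nat.le_mul_self M).trans hMN)
  refine ⟨hL, fun F hF hFB hs => ?_⟩
  obtain ⟨G, hG, hGle⟩ := hcorrect N _
    (isMultiflow_gluedMultiflow (Nat.succ_pos (M / K)) hF)
  refine ⟨G, hG, fun e => hGle e _ ?_ ?_⟩
  · rw [inv_mul_le_iff₀ (by positivity)]
    exact windowSum_le (fun b y z => hFB b _) e.2
  · have hglued := totalVolume_gluedMultiflow_le hMN (Nat.succ_pos (M / K)) hL
      (fun i v w hv hw => dist_le_of_blurredIndicator_cell_ne_zero (K := K) hv hw) hF hFB hs e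
    linarith

end Capacity

section Averaging

variable {M N : ℕ}

section Positions

variable [NeZero M] [NeZero N]

lemma card_filter_scaledPos_eq_le (m : ZMod M) :
    (Finset.univ.filter fun b : ZMod N => scaledPos M b = m.val).card ≤ N / M + 1 := by
  have hM := NeZero.pos M
  set a := (m.val * N + (M - 1)) / M with ha
  calc _ ≤ (Finset.Ico a (a + (N / M + 1))).card := by
        refine Finset.card_le_card_of_injOn ZMod.val (fun b hb => ?_) (ZMod.val_injective N).injOn
        replace hb : b.val * M / N = m.val := (Finset.mem_filter.1 hb).2
        have hlower := Nat.div_mul_le_self (b.val * M) N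
        have hupper := Nat.lt_mul_div_succ (b.val * M) (NeZero.pos N)
        rw [hb] at hlower hupper
        have hstart := Nat.lt_mul_div_succ (m.val * N + (M - 1)) hM
        have hlength := Nat.lt_mul_div_succ N hM
        rw [← ha, mul_add_one, mul_comm M a] at hstart
        simp only [Finset.coe_Ico, mem_Ico]
        constructor
        · rw [ha, Nat.div_le_iff_le_mul_add_pred hM]
          nlinarith
        · have hma : m.val * N ≤ a * M := by omega
          by_contra! hge
          have hmul : (a + (N / M + 1)) * M ≤ b.val * M := Nat.mul_le_mul_right _ hge
          nlinarith
    _ = N / M + 1 := by rw [Nat.card_Ico, Nat.add_sub_cancel_left]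

lemma sum_scaledPos_le {g : ZMod M → ℝ} (hg : ∀ m, 0 ≤ g m) :
    ∑ b : ZMod N, g (scaledPos M b : ℕ) ≤ (N / M + 1) * ∑ m, g m := by
  have hpos : ∀ b : ZMod N, ((scaledPos M b : ℕ) : ZMod M).val = scaledPos M b := fun b => by
    rw [ZMod.val_natCast, Nat.mod_eq_of_lt (scaledPos_lt b)]
  have hfiber : ∀ m : ZMod M,
      ((Finset.univ.filter fun b : ZMod N => ((scaledPos M b : ℕ) : ZMod M) = m).card : ℝ) ≤
        N / M + 1 := fun m => by
    simp only [← (ZMod.val_injective M).eq_iff, hpos]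
    calc _ ≤ ((N / M + 1 : ℕ) : ℝ) := by exact_mod_cast card_filter_scaledPos_eq_le m
      _ ≤ N / M + 1 := by
        push_cast
        gcongr
        exact Nat.cast_div_le
  rw [← Finset.sum_fiberwise (s := Finset.univ)
    (g := fun b : ZMod N => ((scaledPos M b : ℕ) : ZMod M)), Finset.mul_sum]
  refine Finset.sum_le_sum fun m _ => ?_
  rw [Finset.sum_congr rfl fun b hb => by rw [(Finset.mem_filter.1 hb).2], Finset.sum_const,
    nsmul_eq_mul]
  exact mul_le_mul_of_nonneg_right (hfiber m) (hg m)

lemma sum_windowEdge_le {h : Edge M → ℝ} (hh : ∀ e, 0 ≤ h e) (d : Bool) (y z : ℕ) :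
    ∑ b : Vertex N, h (windowEdge M d b y z) ≤ (N / M + 1) ^ 2 * ∑ p : Vertex M, h (d, p) := by
  have hshift : ∀ (g : ZMod M → ℝ) (y : ℕ), ∑ m, g (m + (y : ℕ)) = ∑ m, g m := fun g y =>
    Fintype.sum_equiv (Equiv.addRight (y : ZMod M)) _ _ fun _ => rfl
  unfold windowEdge
  simp only [Nat.cast_add]
  rw [Fintype.sum_prod_type, Fintype.sum_prod_type]
  calc _ ≤ ∑ x : ZMod N, (N / M + 1) * ∑ n, h (d, (scaledPos M x : ℕ) + (y : ℕ), n) := by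
        refine Finset.sum_le_sum fun x _ => ?_
        rw [← hshift (fun n => h (d, (scaledPos M x : ℕ) + (y : ℕ), n)) z]
        exact sum_scaledPos_le (g := fun n : ZMod M =>
          h (d, (scaledPos M x : ℕ) + (y : ℕ), n + (z : ℕ))) fun _ => hh _
    _ ≤ (N / M + 1) * ((N / M + 1) * ∑ m, ∑ n, h (d, m, n)) := by
        rw [← Finset.mul_sum, ← hshift (fun m => ∑ n, h (d, m, n)) y]
        gcongr
        exact sum_scaledPos_le (g := fun m : ZMod M => ∑ n, h (d, m + (y : ℕ), n))
          fun _ => Finset.sum_nonneg fun _ _ => hh _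
    _ = _ := by ring

end Positions

/-- The window with corner `b`, as a map from the edges of the small torus to those of the large
torus. -/
def window (M : ℕ) (b : Vertex N) (e : Edge M) : Edge N :=
  (e.1, (b.1 + (e.2.1 - (scaledPos M b.1 : ℕ)).val, b.2 + (e.2.2 - (scaledPos M b.2 : ℕ)).val))

lemma window_injective [NeZero M] (hMN : M ≤ N) (b : Vertex N) :
    Function.Injective (window M b) := by
  have h : ∀ a a' p : ZMod M, (((a - p).val : ℕ) : ZMod N) = (((a' - p).val : ℕ) : ZMod N) →
      a = a' := by
    intro a a' p h
    rw [ZMod.natCast_eq_natCast_iff', Nat.mod_eq_of_lt ((ZMod.val_lt _).trans_le hMN),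
      Nat.mod_eq_of_lt ((ZMod.val_lt _).trans_le hMN)] at h
    exact sub_left_injective (ZMod.val_injective M h)
  rintro ⟨d, x, y⟩ ⟨d', x', y'⟩ he
  simp only [window, Prod.mk.injEq, add_right_inj] at he
  rw [he.1, h _ _ _ he.2.1, h _ _ _ he.2.2]

lemma window_windowEdge (d : Bool) (b : Vertex N) {y z : ℕ} (hy : y < M) (hz : z < M) :
    window M b (windowEdge M d b y z) = (d, (b.1 + (y : ℕ), b.2 + (z : ℕ))) := by
  simp only [window, windowEdge, Nat.cast_add, add_sub_cancel_left, ZMod.val_natCast,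
    Nat.mod_eq_of_lt hy, Nat.mod_eq_of_lt hz]

lemma sum_mul_windowSum [NeZero N] (c : Edge N → ℝ) (d : Bool) (L : ℕ) (A : Vertex N → ℕ → ℕ → ℝ) :
    ∑ X : Vertex N, c (d, X) * windowSum L A X = ∑ y ∈ Finset.range L, ∑ z ∈ Finset.range L,
      ∑ b : Vertex N, c (d, (b.1 + (y : ℕ), b.2 + (z : ℕ))) * A b y z := by
  unfold windowSum
  simp only [Finset.mul_sum]
  rw [Finset.sum_comm]
  refine Finset.sum_congr rfl fun y _ => ?_
  rw [Finset.sum_comm]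
  refine Finset.sum_congr rfl fun z _ => ?_
  refine (Fintype.sum_equiv (Equiv.addRight ((y : ZMod N), (z : ZMod N))) _ _ fun b => ?_).symm
  simp only [Equiv.coe_addRight, Prod.fst_add, Prod.snd_add, add_sub_cancel_right]
  rfl

lemma sq_avg_windowSum_le {L : ℕ} (hL : 0 < L) (A : Vertex N → ℕ → ℕ → ℝ) (X : Vertex N) :
    (((L : ℝ) ^ 2)⁻¹ * windowSum L A X) ^ 2 ≤
      ((L : ℝ) ^ 2)⁻¹ * windowSum L (fun b y z => A b y z ^ 2) X := by
  have h : windowSum L A X ^ 2 ≤ (L : ℝ) ^ 2 * windowSum L (fun b y z => A b y z ^ 2) X := by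
    have := sq_sum_le_card_mul_sum_sq (s := Finset.range L ×ˢ Finset.range L)
      (f := fun q : ℕ × ℕ => A (X.1 - (q.1 : ZMod N), X.2 - (q.2 : ZMod N)) q.1 q.2)
    rw [Finset.sum_product, Finset.sum_product] at this
    simp only [Finset.card_product, Finset.card_range, Nat.cast_mul] at this
    rw [sq (L : ℝ)]
    exact this
  rw [mul_pow, inv_pow, inv_mul_le_iff₀ (by positivity), ← mul_assoc, sq ((L : ℝ) ^ 2),
    mul_assoc ((L : ℝ) ^ 2), mul_inv_cancel₀ (by positivity), mul_one]
  exact h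

lemma measurePreserving_comp_injective {E F : Type*} [Fintype E] [Fintype F] (κ : Measure ℝ)
    [IsProbabilityMeasure κ] {φ : E → F} (hφ : Function.Injective φ) :
    MeasurePreserving (fun (c : F → ℝ) e => c (φ e)) (Measure.pi fun _ => κ)
      (Measure.pi fun _ => κ) := by
  have hindep : ProbabilityTheory.iIndepFun (fun e (c : F → ℝ) => c (φ e))
      (Measure.pi fun _ => κ) :=
    (ProbabilityTheory.iIndepFun_pi (X := fun _ => id) fun _ => aemeasurable_id).precomp hφ
  refine ⟨by fun_prop, ?_⟩
  rw [(ProbabilityTheory.iIndepFun_iff_map_fun_eq_pi_map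
    fun e => (measurable_pi_apply (φ e)).aemeasurable).1 hindep]
  simp only [(measurePreserving_eval (fun _ : F => κ) _).map_eq]

end Averaging

section Costs

variable {N : ℕ} [NeZero N] {κ : Measure ℝ} [IsProbabilityMeasure κ] {cm B : ℝ}

lemma quadCost_mono {E : Type*} [Fintype E] {v w c : E → ℝ} (hc : ∀ e, 0 ≤ c e) (hv : ∀ e, 0 ≤ v e)
    (hvw : ∀ e, v e ≤ w e) : quadCost v c ≤ quadCost w c :=
  Finset.sum_le_sum fun e _ =>
    mul_le_mul_of_nonneg_left (pow_le_pow_left₀ (hv e) (hvw e) 2) (hc e)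

/-- The volumes of the feasible flows. -/
def feasibleVolume (hN : 3 ≤ N) (B : ℝ) (t : feasibleFlows N B) (e : Edge N) : ℝ :=
  t.1 (edgeEquiv hN e)

lemma feasibleVolume_nonneg (hN : 3 ≤ N) (t : feasibleFlows N B) (e : Edge N) :
    0 ≤ feasibleVolume hN B t e :=
  NNReal.coe_nonneg _

lemma feasibleVolume_le (hN : 3 ≤ N) (t : feasibleFlows N B) (e : Edge N) :
    feasibleVolume hN B t e ≤ B :=
  t.2.2 _

lemma costN_eq (hN : 3 ≤ N) (c : TorusEdge N → ℝ) :
    costN N c B = infCost (feasibleVolume hN B) fun e => c (edgeEquiv hN e) := by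
  unfold costN infCost
  rw [sInf_image']
  refine iInf_congr fun t => ?_
  exact (Fintype.sum_equiv (edgeEquiv hN) _ _ fun _ => rfl).symm

lemma exists_feasibleFlow_of_multiflow (hN : 3 ≤ N) {G : Vertex N → Vertex N → Edge N → ℝ}
    (hG : IsMultiflow G) (hB : ∀ e, totalVolume G e ≤ B) :
    ∃ t : feasibleFlows N B, ∀ e, feasibleVolume hN B t e ≤ totalVolume G e := by
  obtain ⟨f, hf, hfG⟩ := exists_standardizedGlobalFlow hN hG
  refine ⟨⟨f, hf, fun e => ?_⟩, hfG⟩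
  obtain ⟨e, rfl⟩ := (edgeEquiv hN).surjective e
  exact (hfG e).trans (hB e)

lemma nonempty_feasibleFlows (hN : 3 ≤ N) (hB : 1 / 4 < B) : (feasibleFlows N B).Nonempty := by
  obtain ⟨t, -⟩ := exists_feasibleFlow_of_multiflow hN isMultiflow_canonicalMultiflow
    fun e => (totalVolume_canonicalMultiflow_le e).trans hB.le
  exact ⟨t, t.2⟩

lemma integrable_costN (hN : 3 ≤ N) (hB : 1 / 4 < B) (hκ : κ (Icc 0 cm) = 1) :
    Integrable (fun c => costN N c B) (environment N κ) := by
  have : Nonempty (feasibleFlows N B) := (nonempty_feasibleFlows hN hB).to_subtype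
  simp only [costN_eq hN]
  exact (measurePreserving_comp_injective κ (edgeEquiv hN).injective).integrable_comp_of_integrable
    (integrable_infCost hκ (feasibleVolume_nonneg hN) (feasibleVolume_le hN))

lemma integral_costN (hN : 3 ≤ N) (hB : 1 / 4 < B) :
    ∫ c, costN N c B ∂(environment N κ) =
      ∫ c, infCost (feasibleVolume hN B) c ∂(Measure.pi fun _ => κ) := by
  have : Nonempty (feasibleFlows N B) := (nonempty_feasibleFlows hN hB).to_subtype
  have hmp := measurePreserving_comp_injective κ (edgeEquiv hN).injective
  rw [← hmp.map_eq, integral_map hmp.measurable.aemeasurable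
    (continuous_infCost (feasibleVolume_nonneg hN) (feasibleVolume_le hN)).aestronglyMeasurable]
  simp only [costN_eq hN]
  rfl

lemma infCost_le_of_multiflow (hN : 3 ≤ N) {G : Vertex N → Vertex N → Edge N → ℝ}
    (hG : IsMultiflow G) (hB : ∀ e, totalVolume G e ≤ B) {c : Edge N → ℝ} (hc : ∀ e, 0 ≤ c e) :
    infCost (feasibleVolume hN B) c ≤ quadCost (totalVolume G) c := by
  obtain ⟨t, ht⟩ := exists_feasibleFlow_of_multiflow hN hG hB
  exact (infCost_le (feasibleVolume_nonneg hN) (feasibleVolume_le hN) c t).trans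
    (quadCost_mono hc (feasibleVolume_nonneg hN t) ht)

/-- The coarse flows between the cells of the torus with volumes at most `B`. -/
abbrev CoarseFlows (K N : ℕ) [NeZero K] [NeZero N] (B : ℝ) : Type :=
  {F : Fin K × Fin K → Fin K × Fin K → Edge N → ℝ //
    IsCoarseFlow (cell K) F ∧ ∀ e, totalVolume F e ≤ B}

lemma nonempty_coarseFlows (K : ℕ) [NeZero K] (hB : 1 / 4 < B) : Nonempty (CoarseFlows K N B) :=
  ⟨coarsening (cell K) (canonicalMultiflow N),
    isCoarseFlow_coarsening (cell K) isMultiflow_canonicalMultiflow, fun e =>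
      (totalVolume_coarsening_le (cell K) _ e).trans
        ((totalVolume_canonicalMultiflow_le e).trans hB.le)⟩

lemma infCost_coarseFlows_le (K : ℕ) [NeZero K] (hN : 3 ≤ N) (hB : 1 / 4 < B) {c : Edge N → ℝ}
    (hc : ∀ e, 0 ≤ c e) :
    infCost (fun F : CoarseFlows K N B => totalVolume F.1) c ≤ infCost (feasibleVolume hN B) c := by
  have : Nonempty (feasibleFlows N B) := (nonempty_feasibleFlows hN hB).to_subtype
  refine le_ciInf fun t => ?_
  obtain ⟨G, hG, hGv⟩ := exists_multiflow hN t.2.1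
  set F := coarsening (cell K) G
  have hle : ∀ e, totalVolume F e ≤ feasibleVolume hN B t e := fun e =>
    (totalVolume_coarsening_le (cell K) G e).trans (hGv e)
  have h := infCost_le (vol := fun F : CoarseFlows K N B => totalVolume F.1)
    (fun F => totalVolume_nonneg F.1) (fun F => F.2.2) c
    ⟨F, isCoarseFlow_coarsening (cell K) hG, fun e => (hle e).trans (feasibleVolume_le hN t e)⟩
  exact h.trans (quadCost_mono hc (totalVolume_nonneg F) hle)

end Costs

section Comparison

variable {M N : ℕ} {κ : Measure ℝ} {cm B : ℝ}

lemma mul_sq_le_of_le_avg_windowSum {L : ℕ} (hL : 0 < L) (hB : 0 ≤ B) {A : Vertex N → ℕ → ℕ → ℝ}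
    (hA : ∀ b y z, A b y z ≤ B) {a x ε : ℝ} (ha : a ∈ Icc 0 cm) (hx : 0 ≤ x) (hε : 0 ≤ ε)
    {X : Vertex N} (hxA : x ≤ ((L : ℝ) ^ 2)⁻¹ * windowSum L A X + ε) :
    a * x ^ 2 ≤ ((L : ℝ) ^ 2)⁻¹ * (a * windowSum L (fun b y z => A b y z ^ 2) X) +
      cm * (2 * B * ε + ε ^ 2) := by
  have havg : ((L : ℝ) ^ 2)⁻¹ * windowSum L A X ≤ B := by
    rw [inv_mul_le_iff₀ (by positivity)]
    exact windowSum_le hA X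
  have hsq : x ^ 2 ≤ ((L : ℝ) ^ 2)⁻¹ * windowSum L (fun b y z => A b y z ^ 2) X +
      (2 * B * ε + ε ^ 2) :=
    calc x ^ 2 ≤ (((L : ℝ) ^ 2)⁻¹ * windowSum L A X + ε) ^ 2 := pow_le_pow_left₀ hx hxA 2
      _ = (((L : ℝ) ^ 2)⁻¹ * windowSum L A X) ^ 2 +
          (2 * (((L : ℝ) ^ 2)⁻¹ * windowSum L A X) * ε + ε ^ 2) := by ring
      _ ≤ _ := by
        gcongr
        exact sq_avg_windowSum_le hL A X
  calc _ ≤ a * (((L : ℝ) ^ 2)⁻¹ * windowSum L (fun b y z => A b y z ^ 2) X +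
        (2 * B * ε + ε ^ 2)) := mul_le_mul_of_nonneg_left hsq ha.1
    _ ≤ _ := by
      rw [mul_add, mul_left_comm]
      gcongr
      exact ha.2

/-- The cost of the flows that a selection `v` of flow-volumes on the small torus prescribes in the
windows of the large one, summed over all windows and over the `L × L` edges of each direction next
to their corners. -/
def windowCost (M L : ℕ) [NeZero N] (v : (Edge M → ℝ) → Edge M → ℝ) (c : Edge N → ℝ) : ℝ :=
  ∑ d, ∑ y ∈ Finset.range L, ∑ z ∈ Finset.range L, ∑ b : Vertex N,
    c (window M b (windowEdge M d b y z)) * v (fun e => c (window M b e)) (windowEdge M d b y z) ^ 2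

lemma sum_mul_windowSum_sq_eq_windowCost [NeZero N] {L : ℕ} (hL : L ≤ M)
    (v : (Edge M → ℝ) → Edge M → ℝ) (c : Edge N → ℝ) :
    ∑ e : Edge N, c e * windowSum L (fun b y z =>
      v (fun e' => c (window M b e')) (windowEdge M e.1 b y z) ^ 2) e.2 = windowCost M L v c := by
  rw [Fintype.sum_prod_type]
  simp only [sum_mul_windowSum]
  refine Finset.sum_congr rfl fun d _ => Finset.sum_congr rfl fun y hy =>
    Finset.sum_congr rfl fun z hz => Finset.sum_congr rfl fun b _ => ?_
  rw [window_windowEdge d b ((Finset.mem_range.1 hy).trans_le hL)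
    ((Finset.mem_range.1 hz).trans_le hL)]

lemma infCost_le_windowCost [NeZero N] (hN : 3 ≤ N) {L : ℕ} (hL0 : 0 < L) (hL : L ≤ M)
    (hB : 0 ≤ B) {ε : ℝ} (hε : 0 ≤ ε) {v : (Edge M → ℝ) → Edge M → ℝ} (hvB : ∀ c e, v c e ≤ B)
    {c : Edge N → ℝ} (hc : ∀ e, c e ∈ Icc 0 cm) {G : Vertex N → Vertex N → Edge N → ℝ}
    (hG : IsMultiflow G)
    (hGv : ∀ e, totalVolume G e ≤ B ∧ totalVolume G e ≤ ((L : ℝ) ^ 2)⁻¹ *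
      windowSum L (fun b y z => v (fun e' => c (window M b e')) (windowEdge M e.1 b y z)) e.2 + ε) :
    infCost (feasibleVolume hN B) c ≤ ((L : ℝ) ^ 2)⁻¹ * windowCost M L v c +
      Fintype.card (Edge N) * (cm * (2 * B * ε + ε ^ 2)) :=
  calc _ ≤ quadCost (totalVolume G) c :=
        infCost_le_of_multiflow hN hG (fun e => (hGv e).1) fun e => (hc e).1
    _ ≤ ∑ e : Edge N, (((L : ℝ) ^ 2)⁻¹ * (c e * windowSum L (fun b y z =>
          v (fun e' => c (window M b e')) (windowEdge M e.1 b y z) ^ 2) e.2) +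
          cm * (2 * B * ε + ε ^ 2)) :=
        Finset.sum_le_sum fun e _ => mul_sq_le_of_le_avg_windowSum hL0 hB (fun _ _ _ => hvB _ _)
          (hc e) (totalVolume_nonneg G e) hε (hGv e).2
    _ = _ := by
        rw [Finset.sum_add_distrib, ← Finset.mul_sum, sum_mul_windowSum_sq_eq_windowCost hL,
          Finset.sum_const, nsmul_eq_mul, Finset.card_univ]

section Integrals

variable [IsProbabilityMeasure κ]

lemma integrable_mul_sq {E : Type*} [Fintype E] (hκ : κ (Icc 0 cm) = 1) {v : (E → ℝ) → E → ℝ}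
    (hv0 : ∀ c e, 0 ≤ v c e) (hvB : ∀ c e, v c e ≤ B) (hvm : ∀ e, Measurable fun c => v c e)
    (e : E) : Integrable (fun c => c e * v c e ^ 2) (Measure.pi fun _ => κ) := by
  refine Integrable.of_bound ((measurable_pi_apply e).mul
    ((hvm e).pow_const 2)).aestronglyMeasurable (cm * B ^ 2) ?_
  filter_upwards [ae_pi_mem_Icc hκ] with c hc
  rw [Real.norm_of_nonneg (mul_nonneg (hc e).1 (sq_nonneg _))]
  exact mul_le_mul (hc e).2 (pow_le_pow_left₀ (hv0 c e) (hvB c e) 2) (sq_nonneg _)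
    ((hc e).1.trans (hc e).2)

variable [NeZero M] [NeZero N]

lemma integrable_window_mul_sq (hMN : M ≤ N) (hκ : κ (Icc 0 cm) = 1)
    {v : (Edge M → ℝ) → Edge M → ℝ} (hv0 : ∀ c e, 0 ≤ v c e) (hvB : ∀ c e, v c e ≤ B)
    (hvm : ∀ e, Measurable fun c => v c e) (b : Vertex N) (e : Edge M) :
    Integrable (fun c : Edge N → ℝ => c (window M b e) * v (fun e' => c (window M b e')) e ^ 2)
      (Measure.pi fun _ => κ) :=
  (measurePreserving_comp_injective κ (window_injective hMN b)).integrable_comp_of_integrable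
    (integrable_mul_sq hκ hv0 hvB hvm e)

lemma integral_window_mul_sq (hMN : M ≤ N) (hκ : κ (Icc 0 cm) = 1)
    {v : (Edge M → ℝ) → Edge M → ℝ} (hv0 : ∀ c e, 0 ≤ v c e) (hvB : ∀ c e, v c e ≤ B)
    (hvm : ∀ e, Measurable fun c => v c e) (b : Vertex N) (e : Edge M) :
    ∫ c : Edge N → ℝ, c (window M b e) * v (fun e' => c (window M b e')) e ^ 2
        ∂(Measure.pi fun _ => κ) =
      ∫ c : Edge M → ℝ, c e * v c e ^ 2 ∂(Measure.pi fun _ => κ) := by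
  have hmp := measurePreserving_comp_injective κ (window_injective hMN b)
  rw [← hmp.map_eq, integral_map hmp.measurable.aemeasurable]
  rw [hmp.map_eq]
  exact (integrable_mul_sq hκ hv0 hvB hvm e).aestronglyMeasurable

lemma integrable_windowCost (hMN : M ≤ N) (hκ : κ (Icc 0 cm) = 1) (L : ℕ)
    {v : (Edge M → ℝ) → Edge M → ℝ} (hv0 : ∀ c e, 0 ≤ v c e) (hvB : ∀ c e, v c e ≤ B)
    (hvm : ∀ e, Measurable fun c => v c e) :
    Integrable (windowCost (N := N) M L v) (Measure.pi fun _ => κ) :=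
  integrable_finsetSum _ fun _ _ => integrable_finsetSum _ fun _ _ =>
    integrable_finsetSum _ fun _ _ => integrable_finsetSum _ fun b _ =>
      integrable_window_mul_sq hMN hκ hv0 hvB hvm b _

lemma integral_windowCost (hMN : M ≤ N) (hκ : κ (Icc 0 cm) = 1) (L : ℕ)
    {v : (Edge M → ℝ) → Edge M → ℝ} (hv0 : ∀ c e, 0 ≤ v c e) (hvB : ∀ c e, v c e ≤ B)
    (hvm : ∀ e, Measurable fun c => v c e) :
    ∫ c : Edge N → ℝ, windowCost M L v c ∂(Measure.pi fun _ => κ) =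
      ∑ d, ∑ y ∈ Finset.range L, ∑ z ∈ Finset.range L, ∑ b : Vertex N,
        ∫ c : Edge M → ℝ, c (windowEdge M d b y z) * v c (windowEdge M d b y z) ^ 2
          ∂(Measure.pi fun _ => κ) := by
  have hint := integrable_window_mul_sq (N := N) hMN hκ hv0 hvB hvm
  unfold windowCost
  rw [integral_finsetSum _ fun d _ => integrable_finsetSum _ fun y _ =>
    integrable_finsetSum _ fun z _ => integrable_finsetSum _ fun b _ => hint b _]
  refine Finset.sum_congr rfl fun d _ => ?_
  rw [integral_finsetSum _ fun y _ => integrable_finsetSum _ fun z _ =>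
    integrable_finsetSum _ fun b _ => hint b _]
  refine Finset.sum_congr rfl fun y _ => ?_
  rw [integral_finsetSum _ fun z _ => integrable_finsetSum _ fun b _ => hint b _]
  refine Finset.sum_congr rfl fun z _ => ?_
  rw [integral_finsetSum _ fun b _ => hint b _]
  exact Finset.sum_congr rfl fun b _ => integral_window_mul_sq hMN hκ hv0 hvB hvm b _

lemma integral_windowCost_le (hMN : M ≤ N) (hκ : κ (Icc 0 cm) = 1) (L : ℕ)
    {v : (Edge M → ℝ) → Edge M → ℝ} (hv0 : ∀ c e, 0 ≤ v c e) (hvB : ∀ c e, v c e ≤ B)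
    (hvm : ∀ e, Measurable fun c => v c e) :
    ∫ c : Edge N → ℝ, windowCost M L v c ∂(Measure.pi fun _ => κ) ≤
      (L : ℝ) ^ 2 * ((N / M + 1) ^ 2 * ∫ c, quadCost (v c) c ∂(Measure.pi fun _ => κ)) := by
  set H : Edge M → ℝ := fun e => ∫ c : Edge M → ℝ, c e * v c e ^ 2 ∂(Measure.pi fun _ => κ)
  have hH : ∀ e, 0 ≤ H e := fun e => integral_nonneg_of_ae <| by
    filter_upwards [ae_pi_mem_Icc hκ] with c hc
    exact mul_nonneg (hc e).1 (sq_nonneg _)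
  have hquad : ∫ c, quadCost (v c) c ∂(Measure.pi fun _ => κ) = ∑ e, H e :=
    integral_finsetSum _ fun e _ => integrable_mul_sq hκ hv0 hvB hvm e
  rw [integral_windowCost hMN hκ L hv0 hvB hvm, hquad]
  calc _ ≤ ∑ d, ∑ _y ∈ Finset.range L, ∑ _z ∈ Finset.range L,
        ((N : ℝ) / M + 1) ^ 2 * ∑ p : Vertex M, H (d, p) := by
        gcongr with d _ y _ z _
        exact sum_windowEdge_le hH d y z
    _ = _ := by
        rw [Fintype.sum_prod_type (f := H)]
        simp only [Finset.sum_const, Finset.card_range, nsmul_eq_mul, ← Finset.mul_sum]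
        ring

theorem integral_infCost_le_of_gluing (hN : 3 ≤ N) (hMN : M ≤ N) (hB : 1 / 4 < B)
    (hκ : κ (Icc 0 cm) = 1) {L : ℕ} (hL0 : 0 < L) (hL : L ≤ M) {ε : ℝ} (hε : 0 ≤ ε)
    {v : (Edge M → ℝ) → Edge M → ℝ} (hv0 : ∀ c e, 0 ≤ v c e) (hvB : ∀ c e, v c e ≤ B)
    (hvm : ∀ e, Measurable fun c => v c e)
    (hglue : ∀ c : Edge N → ℝ, ∃ G : Vertex N → Vertex N → Edge N → ℝ, IsMultiflow G ∧ ∀ e,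
      totalVolume G e ≤ B ∧ totalVolume G e ≤ ((L : ℝ) ^ 2)⁻¹ *
        windowSum L (fun b y z => v (fun e' => c (window M b e')) (windowEdge M e.1 b y z)) e.2
          + ε) :
    ∫ c, infCost (feasibleVolume hN B) c ∂(Measure.pi fun _ => κ) ≤
      (N / M + 1) ^ 2 * ∫ c, quadCost (v c) c ∂(Measure.pi fun _ => κ) +
        Fintype.card (Edge N) * (cm * (2 * B * ε + ε ^ 2)) := by
  have : Nonempty (feasibleFlows N B) := (nonempty_feasibleFlows hN hB).to_subtype
  have hint := (integrable_windowCost (N := N) hMN hκ L hv0 hvB hvm).const_mul ((L : ℝ) ^ 2)⁻¹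
  calc _ ≤ ∫ c : Edge N → ℝ, (((L : ℝ) ^ 2)⁻¹ * windowCost M L v c +
        Fintype.card (Edge N) * (cm * (2 * B * ε + ε ^ 2))) ∂(Measure.pi fun _ => κ) := by
        refine integral_mono_ae
          (integrable_infCost hκ (feasibleVolume_nonneg hN) (feasibleVolume_le hN))
          (hint.add (integrable_const _)) ?_
        filter_upwards [ae_pi_mem_Icc hκ] with c hc
        obtain ⟨G, hG, hGv⟩ := hglue c
        exact infCost_le_windowCost hN hL0 hL (by linarith) hε hvB hc hG hGv
    _ = ((L : ℝ) ^ 2)⁻¹ * ∫ c : Edge N → ℝ, windowCost M L v c ∂(Measure.pi fun _ => κ) +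
        Fintype.card (Edge N) * (cm * (2 * B * ε + ε ^ 2)) := by
        rw [integral_add hint (integrable_const _), integral_const_mul, integral_const,
          probReal_univ, one_smul]
    _ ≤ _ := add_le_add ((inv_mul_le_iff₀ (by positivity)).2
        (integral_windowCost_le hMN hκ L hv0 hvB hvm)) le_rfl

lemma integral_infCost_coarseFlows_le (K : ℕ) [NeZero K] (hN : 3 ≤ N) (hB : 1 / 4 < B)
    (hκ : κ (Icc 0 cm) = 1) :
    ∫ c, infCost (fun F : CoarseFlows K N B => totalVolume F.1) c ∂(Measure.pi fun _ => κ) ≤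
      ∫ c, infCost (feasibleVolume hN B) c ∂(Measure.pi fun _ => κ) := by
  have : Nonempty (CoarseFlows K N B) := nonempty_coarseFlows K hB
  have : Nonempty (feasibleFlows N B) := (nonempty_feasibleFlows hN hB).to_subtype
  refine integral_mono_ae (integrable_infCost hκ (fun F => totalVolume_nonneg F.1) fun F => F.2.2)
    (integrable_infCost hκ (feasibleVolume_nonneg hN) (feasibleVolume_le hN)) ?_
  filter_upwards [ae_pi_mem_Icc hκ] with c hc
  exact infCost_coarseFlows_le K hN hB fun e => (hc e).1

end Integrals

lemma card_edge (N : ℕ) [NeZero N] : (Fintype.card (Edge N) : ℝ) = 2 * N ^ 2 := by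
  simp only [Fintype.card_prod, Fintype.card_bool, ZMod.card, Nat.cast_mul, Nat.cast_ofNat]
  ring

lemma sqrt_card_edge_le (N : ℕ) [NeZero N] : √(Fintype.card (Edge N)) ≤ 2 * N := by
  rw [card_edge, Real.sqrt_le_left (by positivity)]
  nlinarith [sq_nonneg (N : ℝ)]

theorem exists_integral_infCost_le [IsProbabilityMeasure κ] (hcm : 0 ≤ cm)
    (hκ : κ (Icc 0 cm) = 1) (hB : 1 / 4 < B) {ε : ℝ} (hε : 0 < ε) :
    ∃ (C : ℝ) (M₁ : ℕ), ∀ (M N : ℕ) [NeZero M] [NeZero N] (hM : 3 ≤ M) (hN : 3 ≤ N), M₁ ≤ M →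
      M * M ≤ N → ∫ c, infCost (feasibleVolume hN B) c ∂(Measure.pi fun _ => κ) ≤
        (N / M + 1) ^ 2 * (∫ c, infCost (feasibleVolume hM B) c ∂(Measure.pi fun _ => κ) +
          C * M + 1) + 2 * N ^ 2 * (cm * (2 * B * ε + ε ^ 2)) := by
  obtain ⟨K, _, η, M₁, hη, hglue⟩ := exists_glued_multiflow_of_capacity hB hε
  obtain ⟨n, M₀, hclass⟩ := exists_classification_of_stream (Fin K × Fin K)
    (by linarith : 0 ≤ B) hη
  refine ⟨n * (cm * B ^ 2 * 2), max M₀ M₁, fun M N _ _ hM hN hMM hMN => ?_⟩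
  obtain ⟨hL, hglue⟩ := hglue M N ((le_max_right _ _).trans hMM) hMN
  have : Nonempty (CoarseFlows K M B) := nonempty_coarseFlows K hB
  obtain ⟨pr, hpr⟩ := hclass M ((le_max_left _ _).trans hMM) (CoarseFlows K M B)
    (fun F => F.1) (fun F => F.2.2) (fun F F' i j p => by rw [F.2.1 i j p, F'.2.1 i j p])
  obtain ⟨s, hs, hsm, hsc⟩ := exists_selection_in_class hcm hκ
    (vol := fun F : CoarseFlows K M B => totalVolume F.1) (fun F => totalVolume_nonneg F.1)
    (fun F => F.2.2) pr
  have hmain := integral_infCost_le_of_gluing hN ((Nat.le_mul_self M).trans hMN) hB hκ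
    (Nat.succ_pos _) hL hε.le (v := fun c => totalVolume (s c).1) (fun c => totalVolume_nonneg _)
    (fun c => (s c).2.2) hsm fun c =>
      hglue (fun b => (s fun e' => c (window M b e')).1) (fun b => (s _).2.1)
        (fun b => (s _).2.2) fun b b' => hpr _ _ (hs _ _)
  rw [card_edge] at hmain
  refine hmain.trans ?_
  gcongr
  have hclasses : (n : ℝ) * ((cm * B ^ 2) * √(Fintype.card (Edge M))) ≤
      n * (cm * B ^ 2 * 2) * M :=
    calc _ ≤ (n : ℝ) * ((cm * B ^ 2) * (2 * M)) := by gcongr; exact sqrt_card_edge_le M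
      _ = _ := by ring
  rw [Fintype.card_fin] at hsc
  linarith [integral_infCost_coarseFlows_le K hM hB hκ]

end Comparison

section Limit

lemma exists_tendsto_of_eventually_le {a : ℕ → ℝ} {A : ℝ} (h0 : ∀ᶠ n in atTop, 0 ≤ a n)
    (hA : ∀ᶠ n in atTop, a n ≤ A)
    (h : ∀ ε > 0, ∀ᶠ m in atTop, ∀ᶠ n in atTop, a n ≤ a m + ε) :
    ∃ γ, Tendsto a atTop (𝓝 γ) := by
  have hbelow : IsBoundedUnder (· ≥ ·) atTop a := isBoundedUnder_of_eventually_ge h0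
  have habove : IsBoundedUnder (· ≤ ·) atTop a := isBoundedUnder_of_eventually_le hA
  refine ⟨liminf a atTop, tendsto_order.2 ⟨fun b hb => eventually_lt_of_lt_liminf hb hbelow,
    fun b hb => ?_⟩⟩
  set ε := (b - liminf a atTop) / 3 with hε
  have hε0 : 0 < ε := by rw [hε]; linarith
  have hfreq : ∃ᶠ m in atTop, a m < liminf a atTop + ε :=
    frequently_lt_of_liminf_lt habove.isCoboundedUnder_ge (by linarith)
  obtain ⟨m, hm, hm'⟩ := (hfreq.and_eventually (h ε hε0)).exists
  filter_upwards [hm'] with n hn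
  linarith

end Limit

section Convergence

variable {κ : Measure ℝ} [IsProbabilityMeasure κ] {cm B : ℝ}

lemma integral_costN_nonneg {N : ℕ} (hκ : κ (Icc 0 cm) = 1) :
    0 ≤ ∫ c, costN N c B ∂(environment N κ) := by
  refine integral_nonneg_of_ae ?_
  filter_upwards [ae_pi_mem_Icc hκ] with c hc
  refine Real.sInf_nonneg ?_
  rintro _ ⟨f, -, rfl⟩
  exact Finset.sum_nonneg fun e _ => mul_nonneg (hc e).1 (sq_nonneg _)

lemma integral_costN_le {N : ℕ} (hN : 3 ≤ N) (hκ : κ (Icc 0 cm) = 1) (hB : 1 / 4 < B) :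
    ∫ c, costN N c B ∂(environment N κ) ≤ (N : ℝ) ^ 2 * (2 * (cm * B ^ 2)) := by
  have : NeZero N := ⟨by omega⟩
  have : Nonempty (feasibleFlows N B) := (nonempty_feasibleFlows hN hB).to_subtype
  rw [integral_costN hN hB]
  calc _ ≤ ∫ _c : Edge N → ℝ, Fintype.card (Edge N) * (cm * B ^ 2) ∂(Measure.pi fun _ => κ) := by
        refine integral_mono_ae
          (integrable_infCost hκ (feasibleVolume_nonneg hN) (feasibleVolume_le hN))
          (integrable_const _) ?_
        filter_upwards [ae_pi_mem_Icc hκ] with c hc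
        exact infCost_le_card (feasibleVolume_nonneg hN) (feasibleVolume_le hN) hc
    _ = _ := by
        rw [integral_const, probReal_univ, one_smul, card_edge]
        ring

lemma exists_avg_integral_costN_le (hcm : 0 ≤ cm) (hκ : κ (Icc 0 cm) = 1) (hB : 1 / 4 < B) {δ : ℝ}
    (hδ : 0 < δ) :
    ∃ (C : ℝ) (M₁ : ℕ), ∀ M N : ℕ, 3 ≤ M → M₁ ≤ M → M * M ≤ N →
      ((N : ℝ) ^ 2)⁻¹ * ∫ c, costN N c B ∂(environment N κ) ≤
        (1 + M / N) ^ 2 * (((M : ℝ) ^ 2)⁻¹ * ∫ c, costN M c B ∂(environment M κ) +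
          (C / M + ((M : ℝ) ^ 2)⁻¹)) + 2 * (cm * (2 * B * δ + δ ^ 2)) := by
  obtain ⟨C, M₁, hC⟩ := exists_integral_infCost_le hcm hκ hB hδ
  refine ⟨C, M₁, fun M N hM hMM hMN => ?_⟩
  have hN : 3 ≤ N := hM.trans ((Nat.le_mul_self M).trans hMN)
  have : NeZero M := ⟨by omega⟩
  have : NeZero N := ⟨by omega⟩
  have hM0 : (M : ℝ) ≠ 0 := Nat.cast_ne_zero.2 (NeZero.ne M)
  have : (0 : ℝ) < N := Nat.cast_pos.2 (NeZero.pos N)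
  have hmain := hC M N hM hN hMM hMN
  rw [← integral_costN hN hB, ← integral_costN hM hB] at hmain
  rw [inv_mul_le_iff₀ (by positivity)]
  refine hmain.trans (le_of_eq ?_)
  field_simp
  ring

lemma exists_pos_mul_le (cm B : ℝ) {ε : ℝ} (hε : 0 < ε) :
    ∃ δ > 0, 2 * (cm * (2 * B * δ + δ ^ 2)) ≤ ε := by
  have hlim : Tendsto (fun δ : ℝ => 2 * (cm * (2 * B * δ + δ ^ 2))) (𝓝 0) (𝓝 0) :=
    Continuous.tendsto' (by fun_prop) 0 0 (by simp)
  obtain ⟨δ, hle, hδ⟩ := (((hlim.eventually (ge_mem_nhds hε)).filter_mono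
    nhdsWithin_le_nhds).and (self_mem_nhdsWithin (s := Ioi 0))).exists
  exact ⟨δ, hδ, hle⟩

lemma eventually_div_add_inv_sq_le (C : ℝ) {ε : ℝ} (hε : 0 < ε) :
    ∀ᶠ m : ℕ in atTop, C / m + ((m : ℝ) ^ 2)⁻¹ ≤ ε := by
  have hlim : Tendsto (fun m : ℕ => C / (m : ℝ) + ((m : ℝ) ^ 2)⁻¹) atTop (𝓝 (0 + 0)) :=
    (tendsto_const_div_atTop_nhds_zero_nat C).add
      ((tendsto_pow_atTop two_ne_zero).comp tendsto_natCast_atTop_atTop).inv_tendsto_atTop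
  rw [add_zero] at hlim
  exact hlim.eventually (ge_mem_nhds hε)

lemma eventually_one_add_div_sq_mul_le (m x : ℝ) {ε : ℝ} (hε : 0 < ε) :
    ∀ᶠ n : ℕ in atTop, (1 + m / n) ^ 2 * x ≤ x + ε := by
  have hlim : Tendsto (fun n : ℕ => (1 + m / (n : ℝ)) ^ 2 * x) atTop (𝓝 ((1 + 0) ^ 2 * x)) :=
    (((tendsto_const_div_atTop_nhds_zero_nat m).const_add 1).pow 2).mul_const x
  exact hlim.eventually (ge_mem_nhds (by linarith))

theorem exists_tendsto_integral_costN (hcm : 0 ≤ cm) (hκ : κ (Icc 0 cm) = 1) (hB : 1 / 4 < B) :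
    ∃ γ : ℝ, Tendsto (fun N : ℕ => ((N : ℝ) ^ 2)⁻¹ * ∫ c, costN N c B ∂(environment N κ))
      atTop (𝓝 γ) := by
  refine exists_tendsto_of_eventually_le (A := 2 * (cm * B ^ 2)) (.of_forall fun N =>
    mul_nonneg (by positivity) (integral_costN_nonneg hκ)) ?_ fun ε hε => ?_
  · filter_upwards [eventually_ge_atTop 3] with N hN
    rw [inv_mul_le_iff₀ (by positivity)]
    exact integral_costN_le hN hκ hB
  · obtain ⟨δ, hδ, hδε⟩ := exists_pos_mul_le cm B (by positivity : 0 < ε / 3)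
    obtain ⟨C, M₁, hC⟩ := exists_avg_integral_costN_le hcm hκ hB hδ
    filter_upwards [eventually_div_add_inv_sq_le C (by positivity : 0 < ε / 3),
      eventually_ge_atTop M₁, eventually_ge_atTop 3] with M hM hM₁ hM3
    filter_upwards [eventually_one_add_div_sq_mul_le M
      (((M : ℝ) ^ 2)⁻¹ * ∫ c, costN M c B ∂(environment M κ) + (C / M + ((M : ℝ) ^ 2)⁻¹))
      (by positivity : 0 < ε / 3), eventually_ge_atTop (M * M)] with N hN hMN
    linarith [hC M N hM3 hM₁ hMN]

end Convergence

end LatticeFlow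

end

theorem theorem1 (κ : Measure ℝ) [IsProbabilityMeasure κ]
    (hκ : ∃ cmax : ℝ, 0 < cmax ∧ κ (Set.Icc 0 cmax) = 1)
    (B : ℝ) (hB : 1 / 4 < B) :
    (∀ N : ℕ, 3 ≤ N →
      (LatticeFlow.feasibleFlows N B).Nonempty ∧
      Integrable (fun c => LatticeFlow.costN N c B) (LatticeFlow.environment N κ)) ∧
    ∃ γ : ℝ,
      Tendsto
        (fun N : ℕ => ((N : ℝ) ^ 2)⁻¹ *
          ∫ c, LatticeFlow.costN N c B ∂(LatticeFlow.environment N κ))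
        atTop (𝓝 γ) := by
  obtain ⟨cm, hcm, hκ⟩ := hκ
  refine ⟨fun N hN => ?_, LatticeFlow.exists_tendsto_integral_costN hcm.le hκ hB⟩
  have : NeZero N := ⟨by omega⟩
  exact ⟨LatticeFlow.nonempty_feasibleFlows hN hB, LatticeFlow.integrable_costN hN hB hκ⟩
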